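/- Let $d\ge 2$ and let $g:[-1,1]\to[0,\infty)$ be measurable with $\int_{S^{d-1}}g(\omega\cdot n)\,dn=1$ for every $\omega\in S^{d-1}$, where $dn$ is the surface measure. For functions $\varphi,\psi:\mathbb R^d\to\mathbb C$ put $$\mathcal I^+(\varphi,\psi)(k)=\int_{S^{d-1}}g(\hat k\cdot n)\,\varphi(k_+)\,\psi(k_-)\,dn,\qquad k_\pm=\tfrac12(k\pm|k|n),\quad \hat k=k/|k|$$ (at $k=0$ any unit vector may be taken for $\hat k$), $\Gamma[\varphi]=\mathcal I^+(\varphi,\varphi)$ and $\mathcal L[\varphi]=\mathcal I^+(\varphi,1)+\mathcal I^+(1,\varphi)$. Let $\Phi$ be the set of characteristic functions $k\mapsto\int e^{-ik\cdot v}\,d\mu(v)$ of Borel probability measures $\mu$ on $\mathbb R^d$. For a real $d\times d$ matrix $A$ let $\|A\|=\sup_{|k|=1}|Ak|$, and for $\beta\in\mathbb R$ put $A_\beta=A+\beta I$ and $(E_\beta(t)\psi)(k)=e^{-t}\psi(e^{-tA_\beta}k)$. Let $q=\int_{S^{d-1}}g(\omega\cdot n)\,(1-(\omega\cdot n)^2)\,dn$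 (independent of the unit vector $\omega$), and consider the eigenvalue problem $$2\beta B+\big(BA+(BA)^T\big)+\frac{qd}{2(d-1)}\Big(B-\frac{\mathrm{Tr}(B)}{d}I\Big)=0,\qquad 0\neq B\in\mathrm{Symm}_{d\times d}(\mathbb C),\ \beta\in\mathbb C. \qquad (1)$$ **Theorem.** For every integer $M\ge 3$ there is $\varepsilon_M>0$, depending only on $d$, $g$ and $M$, such that the following holds for every real $d\times d$ matrix $A$ with $\|A\|\le\varepsilon_M$. 1. Problem (1) has an eigenvalue $\beta$ that is real and simple and whose real part is strictly larger than that of every other eigenvalue; it has a real symmetric positive definite eigenvector $N$ normalized by $\frac1d\mathrm{Tr}(N^TN)=1$. 2. For these $\beta$ and $N$ there is a unique family $Q_2,\dots,Q_M$, with $Q_\ell$ a complex homogeneous polynomial of degree $\ell$ in $k\in\mathbb R^d$, such that $Q_2(k)=-\frac12\sum_{j,\ell}N_{j\ell}k_jk_\ell$ and, for $3\le\ell\le M$, $$Q_\ell-\mathcal L Q_\ell+(A_\beta k)\cdot\partial_kQ_\ell=\sum_{\substack{j+m=\ell\\ 2\le j,m\le M}}\mathcal I^+(Q_j,Q_m).$$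 3. For every $p\in(M,M+1]$ the set $$\mathcal F_{p,M}(N)=\Big\{\Psi\in\Phi:\ \sup_{k\in\mathbb{R}^d\setminus\{0\}}\frac{\big|\Psi(k)-\big(1+\sum_{\ell=2}^{M}Q_\ell(k)\big)\big|}{|k|^p}<\infty\Big\}$$ is nonempty, and there is a unique $\Psi\in\mathcal F_{p,M}(N)$ that solves $$\Psi(k)=\int_0^\infty E_\beta(\tau)\,\Gamma[\Psi](k)\,d\tau,\qquad k\in\mathbb R^d.$$ 4. The stationary profile, that is, the probability measure $f_{st}$ on $\mathbb R^d$ whose characteristic function is this $\Psi$, has finite moments up to order $M$: $\int_{\mathbb R^d}|v|^m\,df_{st}(v)<\infty$ for $0\le m\le M$. -/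

import Mathlib

open MeasureTheory
open scoped RealInnerProductSpace

namespace MaxwellBoltzmann

noncomputable section

/-- The space `ℝ^d` with its Euclidean norm. -/
abbrev E (d : ℕ) := EuclideanSpace ℝ (Fin d)

/-- The unit sphere of `ℝ^d`; `(volume : Measure (E d)).toSphere` is its surface measure `dn`. -/
abbrev S (d : ℕ) := Metric.sphere (0 : E d) 1

/-- The unit vector `e = (1, 0, …, 0)`. -/
def e1 (d : ℕ) : E d := WithLp.toLp 2 fun i => if i.val = 0 then 1 else 0

/-- The direction `k / |k|`. At `k = 0` any unit vector may be used, because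
`∫ g (ω · n) dn` does not depend on the unit vector `ω`. -/
def dir {d : ℕ} (k : E d) : E d := if k = 0 then e1 d else ‖k‖⁻¹ • k

/-- A collision kernel: `g` is nonnegative and measurable on `[-1, 1]`, and
`n ↦ g (ω · n)` is a probability density on the sphere for every unit vector `ω`. -/
structure IsCollisionKernel (d : ℕ) (g : ℝ → ℝ) : Prop where
  measurable : Measurable ((Set.Icc (-1 : ℝ) 1).domRestrict g)
  nonneg : ∀ η ∈ Set.Icc (-1 : ℝ) 1, 0 ≤ g η
  integrable : ∀ ω : S d,
    Integrable (fun n : S d => g ⟪(ω : E d), (n : E d)⟫) (volume : Measure (E d)).toSphere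
  normalized : ∀ ω : S d,
    ∫ n : S d, g ⟪(ω : E d), (n : E d)⟫ ∂(volume : Measure (E d)).toSphere = 1

/-- The bilinear gain operator
`I⁺(φ, ψ)(k) = ∫ g (k̂ · n) φ(k₊) ψ(k₋) dn`, with `k₊ = (k + |k| n) / 2`, `k₋ = (k - |k| n) / 2`. -/
def gain {d : ℕ} (g : ℝ → ℝ) (φ ψ : E d → ℂ) (k : E d) : ℂ :=
  ∫ n : S d, (g ⟪dir k, (n : E d)⟫ : ℂ) *
      (φ ((1 / 2 : ℝ) • (k + ‖k‖ • (n : E d))) * ψ ((1 / 2 : ℝ) • (k - ‖k‖ • (n : E d))))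
    ∂(volume : Measure (E d)).toSphere

/-- `Γ[φ] = I⁺(φ, φ)`. -/
def Gam {d : ℕ} (g : ℝ → ℝ) (φ : E d → ℂ) : E d → ℂ := gain g φ φ

/-- The linearized operator `L[φ] = I⁺(φ, 1) + I⁺(1, φ)`. -/
def linGain {d : ℕ} (g : ℝ → ℝ) (φ : E d → ℂ) (k : E d) : ℂ :=
  gain g φ (fun _ => 1) k + gain g (fun _ => 1) φ k

/-- The Fourier transform `k ↦ ∫ e^{-i k · v} dμ(v)`. -/
def charFn {d : ℕ} (μ : Measure (E d)) (k : E d) : ℂ :=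
  ∫ v, Complex.exp (-Complex.I * (⟪k, v⟫ : ℝ)) ∂μ

/-- The set `Φ` of characteristic functions of probability measures on `ℝ^d`. -/
def Phi (d : ℕ) : Set (E d → ℂ) :=
  {φ | ∃ μ : Measure (E d), IsProbabilityMeasure μ ∧ φ = charFn μ}

/-- A real matrix as an operator of Euclidean space; the norm of this operator is
`sup_{|k| = 1} |A k|`. -/
def op {d : ℕ} (A : Matrix (Fin d) (Fin d) ℝ) : E d →L[ℝ] E d :=
  Matrix.toEuclideanCLM (n := Fin d) (𝕜 := ℝ) A

/-- `A_β = A + β I`. -/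
def shifted {d : ℕ} (A : Matrix (Fin d) (Fin d) ℝ) (β : ℝ) : Matrix (Fin d) (Fin d) ℝ :=
  A + β • (1 : Matrix (Fin d) (Fin d) ℝ)

/-- `q = ∫ g (ω · n) (1 - (ω · n)²) dn`, which is the same for all unit vectors `ω`. -/
def qConst (d : ℕ) (g : ℝ → ℝ) : ℝ :=
  ∫ n : S d, g ⟪e1 d, (n : E d)⟫ * (1 - ⟪e1 d, (n : E d)⟫ ^ 2) ∂(volume : Measure (E d)).toSphere

/-- The left-hand side
`2 β B + (B A + (B A)ᵀ) + (q d / (2 (d - 1))) (B - (Tr B / d) I)` of the eigenvalue problem. -/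
def eigLHS {d : ℕ} (g : ℝ → ℝ) (A : Matrix (Fin d) (Fin d) ℝ) (β : ℂ)
    (B : Matrix (Fin d) (Fin d) ℂ) : Matrix (Fin d) (Fin d) ℂ :=
  (2 * β) • B + (B * A.map Complex.ofReal + (B * A.map Complex.ofReal).transpose) +
    ((qConst d g : ℂ) * d / (2 * ((d : ℂ) - 1))) • (B - (B.trace / d) • 1)

/-- `β` is an eigenvalue: some nonzero complex symmetric `B` solves the eigenvalue problem. -/
def IsEig {d : ℕ} (g : ℝ → ℝ) (A : Matrix (Fin d) (Fin d) ℝ) (β : ℂ) : Prop :=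
  ∃ B : Matrix (Fin d) (Fin d) ℂ, B ≠ 0 ∧ B.IsSymm ∧ eigLHS g A β B = 0

/-- `β` is the eigenvalue with the largest real part, it is real and simple, and `N` is its real,
positive definite eigenvector, normalized by `(1/d) Tr (Nᵀ N) = 1`.
In `simple`, `eigLHS g A β` is twice `β - T`, where the eigenvalues are those of the linear
operator `T`; so the clause says that the kernel of `(T - β)²` on symmetric matrices is the line
spanned by `N`, that is, that `β` has algebraic multiplicity one. -/
structure IsLeadingPair {d : ℕ} (g : ℝ → ℝ) (A : Matrix (Fin d) (Fin d) ℝ) (β : ℝ)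
    (N : Matrix (Fin d) (Fin d) ℝ) : Prop where
  symm : N.IsSymm
  posDef : N.PosDef
  normalized : (1 / (d : ℝ)) * (N.transpose * N).trace = 1
  eigenvector : eigLHS g A (β : ℂ) (N.map Complex.ofReal) = 0
  simple : ∀ B : Matrix (Fin d) (Fin d) ℂ, B.IsSymm →
    eigLHS g A (β : ℂ) (eigLHS g A (β : ℂ) B) = 0 → ∃ c : ℂ, B = c • N.map Complex.ofReal
  largest : ∀ β' : ℂ, IsEig g A β' → β' ≠ (β : ℂ) → β'.re < β

/-- Value of a complex polynomial in `k_1, …, k_d` at a point of `ℝ^d`. -/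
def pval {d : ℕ} (P : MvPolynomial (Fin d) ℂ) (k : E d) : ℂ :=
  MvPolynomial.eval (fun i => (k i : ℂ)) P

/-- `((A_β k) · ∂_k P)(k)`. -/
def driftPoly {d : ℕ} (A : Matrix (Fin d) (Fin d) ℝ) (β : ℝ) (P : MvPolynomial (Fin d) ℂ)
    (k : E d) : ℂ :=
  ∑ j, ((op (shifted A β) k) j : ℂ) * pval (MvPolynomial.pderiv j P) k

/-- `K_ℓ(k) = ∑_{j + m = ℓ, 2 ≤ j, m ≤ M} ∫ g (k̂ · n) Q_j(k₊) Q_m(k₋) dn`. -/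
def momentSource {d : ℕ} (g : ℝ → ℝ) (M : ℕ) (Q : ℕ → MvPolynomial (Fin d) ℂ) (l : ℕ)
    (k : E d) : ℂ :=
  ∑ jm ∈ (Finset.Icc 2 M ×ˢ Finset.Icc 2 M).filter (fun jm => jm.1 + jm.2 = l),
    gain g (pval (Q jm.1)) (pval (Q jm.2)) k

/-- `Q_2, …, Q_M` are homogeneous polynomials, `Q_l` of degree `l`, with
`Q_2(k) = -(1/2) ∑ N_{jl} k_j k_l` and
`Q_l - L Q_l + (A_β k) · ∂_k Q_l = K_l` for `3 ≤ l ≤ M`. -/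
structure IsMomentFamily {d : ℕ} (g : ℝ → ℝ) (A : Matrix (Fin d) (Fin d) ℝ) (β : ℝ)
    (N : Matrix (Fin d) (Fin d) ℝ) (M : ℕ) (Q : ℕ → MvPolynomial (Fin d) ℂ) : Prop where
  homogeneous : ∀ l ∈ Finset.Icc 2 M, (Q l).IsHomogeneous l
  second : ∀ k : E d, pval (Q 2) k = -(1 / 2) * ∑ i, ∑ j, (N i j : ℂ) * (k i : ℂ) * (k j : ℂ)
  equation : ∀ l ∈ Finset.Icc 3 M, ∀ k : E d,
    pval (Q l) k - linGain g (pval (Q l)) k + driftPoly A β (Q l) k = momentSource g M Q l k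

/-- The class `F_{p,M}`: characteristic functions `Ψ` such that
`|Ψ(k) - (1 + ∑_{l=2}^M Q_l(k))| / |k|^p` is bounded. -/
def F {d : ℕ} (p : ℝ) (M : ℕ) (Q : ℕ → MvPolynomial (Fin d) ℂ) : Set (E d → ℂ) :=
  {Ψ | Ψ ∈ Phi d ∧ ∃ C : ℝ, ∀ k : E d,
    ‖Ψ k - (1 + ∑ l ∈ Finset.Icc 2 M, pval (Q l) k)‖ ≤ C * ‖k‖ ^ p}

/-- The semigroup `(E_β(t) ψ)(k) = e^{-t} ψ(e^{-t A_β} k)`. -/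
def semigroup {d : ℕ} (A : Matrix (Fin d) (Fin d) ℝ) (β t : ℝ) (ψ : E d → ℂ) (k : E d) : ℂ :=
  (Real.exp (-t) : ℂ) * ψ (NormedSpace.exp ((-t) • op (shifted A β)) k)

/-- The stationary integral equation `Ψ(k) = ∫_0^∞ E_β(τ) Γ[Ψ](k) dτ`. -/
def IsStationary {d : ℕ} (g : ℝ → ℝ) (A : Matrix (Fin d) (Fin d) ℝ) (β : ℝ)
    (Ψ : E d → ℂ) : Prop :=
  ∀ k : E d, Ψ k = ∫ τ in Set.Ioi (0 : ℝ), semigroup A β τ (Gam g Ψ) k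

end

end MaxwellBoltzmann

namespace MaxwellBoltzmann

noncomputable section

open Set Filter Topology
open scoped ENNReal Pointwise

/-- The surface measure of the unit sphere. -/
abbrev sph (d : ℕ) : Measure (S d) := (volume : Measure (E d)).toSphere

/-- The action of a linear isometry on the unit sphere. -/
def rot {d : ℕ} (R : E d ≃ₗᵢ[ℝ] E d) (n : S d) : S d := ⟨R n, by simp⟩

lemma measurable_rot {d : ℕ} (R : E d ≃ₗᵢ[ℝ] E d) : Measurable (rot R) :=
  (R.continuous.measurable.comp measurable_subtype_coe).subtype_mk

lemma measurePreserving_rot {d : ℕ} (R : E d ≃ₗᵢ[ℝ] E d) :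
    MeasurePreserving (rot R) (sph d) (sph d) := by
  refine ⟨measurable_rot R, ?_⟩
  ext s hs
  rw [Measure.map_apply (measurable_rot R) hs, Measure.toSphere_apply' _ hs,
    Measure.toSphere_apply' _ (measurable_rot R hs)]
  congr 1
  have : Ioo (0 : ℝ) 1 • (((↑) : S d → E d) '' (rot R ⁻¹' s)) =
      R ⁻¹' (Ioo (0 : ℝ) 1 • (((↑) : S d → E d) '' s)) := by
    ext x
    simp only [Set.mem_smul, mem_image, mem_preimage]
    constructor
    · rintro ⟨t, ht, _, ⟨n, hn, rfl⟩, rfl⟩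
      exact ⟨t, ht, _, ⟨rot R n, hn, rfl⟩, by simp [rot]⟩
    · rintro ⟨t, ht, _, ⟨n, hn, rfl⟩, h⟩
      refine ⟨t, ht, _, ⟨rot R.symm n, ?_, rfl⟩, ?_⟩
      · have : rot R (rot R.symm n) = n := by ext1; simp [rot]
        rwa [this]
      · apply R.injective
        rw [← h]; simp [rot]
  rw [this]
  exact R.measurePreserving.measure_preimage_equiv (f := R.toMeasurableEquiv) _

lemma norm_e1 {d : ℕ} (hd : 2 ≤ d) : ‖e1 d‖ = 1 := by
  have : NeZero d := ⟨by omega⟩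
  have : e1 d = EuclideanSpace.single 0 1 := by
    ext i
    simp only [e1, PiLp.single_apply, Fin.val_eq_zero_iff]
  rw [this]; simp

lemma norm_dir {d : ℕ} (hd : 2 ≤ d) (k : E d) : ‖dir k‖ = 1 := by
  unfold dir
  split_ifs with h
  · exact norm_e1 hd
  · rw [norm_smul, norm_inv, norm_norm, inv_mul_cancel₀ (norm_ne_zero_iff.2 h)]

lemma norm_smul_dir {d : ℕ} (k : E d) : ‖k‖ • dir k = k := by
  unfold dir
  split_ifs with h
  · simp [h]
  · rw [smul_smul, mul_inv_cancel₀ (norm_ne_zero_iff.2 h), one_smul]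

lemma measurable_dir {d : ℕ} : Measurable (dir : E d → E d) := by
  unfold dir
  exact Measurable.ite (measurableSet_singleton 0) measurable_const (by fun_prop)

lemma norm_sphere {d : ℕ} (n : S d) : ‖(n : E d)‖ = 1 := by simp

lemma inner_mem_Icc {d : ℕ} {w : E d} (hw : ‖w‖ = 1) (n : S d) :
    ⟪w, (n : E d)⟫ ∈ Icc (-1 : ℝ) 1 := by
  have := abs_real_inner_le_norm w n
  rw [hw, norm_sphere, one_mul, abs_le] at this
  exact this

section Scattering

variable {d : ℕ} {g : ℝ → ℝ}

lemma IsCollisionKernel.measurable_comp (hg : IsCollisionKernel d g) {X : Type*}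
    [MeasurableSpace X] {f : X → ℝ} (hf : Measurable f) (h : ∀ x, f x ∈ Icc (-1 : ℝ) 1) :
    Measurable fun x => g (f x) :=
  hg.measurable.comp (hf.subtype_mk (h := h))

/-- The scattering distribution with density `g (ω · n)` on the sphere. -/
def scat (g : ℝ → ℝ) (w : E d) : Measure (S d) :=
  (sph d).withDensity fun n => ENNReal.ofReal (g ⟪w, (n : E d)⟫)

lemma measurable_density (hg : IsCollisionKernel d g) {w : E d} (hw : ‖w‖ = 1) :
    Measurable fun n : S d => g ⟪w, (n : E d)⟫ :=
  hg.measurable_comp (by fun_prop) (inner_mem_Icc hw)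

lemma isProbabilityMeasure_scat (hg : IsCollisionKernel d g) {w : E d} (hw : ‖w‖ = 1) :
    IsProbabilityMeasure (scat g w) := by
  constructor
  have h1 := hg.integrable ⟨w, by simp [hw]⟩
  have h2 := hg.normalized ⟨w, by simp [hw]⟩
  rw [scat, withDensity_apply _ MeasurableSet.univ, Measure.restrict_univ,
    ← ofReal_integral_eq_lintegral_ofReal h1, h2, ENNReal.ofReal_one]
  exact Eventually.of_forall fun n => hg.nonneg _ (inner_mem_Icc hw n)

lemma lintegral_scat (hg : IsCollisionKernel d g) {w : E d} (hw : ‖w‖ = 1) {f : S d → ℝ≥0∞}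
    (hf : Measurable f) :
    ∫⁻ n, f n ∂scat g w = ∫⁻ n, ENNReal.ofReal (g ⟪w, (n : E d)⟫) * f n ∂sph d := by
  rw [scat, lintegral_withDensity_eq_lintegral_mul _
    (measurable_density hg hw).ennreal_ofReal hf]
  rfl

lemma integral_scat (hg : IsCollisionKernel d g) {w : E d} (hw : ‖w‖ = 1) {F : Type*}
    [NormedAddCommGroup F] [NormedSpace ℝ F] (f : S d → F) :
    ∫ n, f n ∂scat g w = ∫ n, g ⟪w, (n : E d)⟫ • f n ∂sph d := by
  rw [scat, integral_withDensity_eq_integral_toReal_smul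
    (measurable_density hg hw).ennreal_ofReal (by simp)]
  refine integral_congr_ae (Eventually.of_forall fun n => ?_)
  dsimp only
  rw [ENNReal.toReal_ofReal (hg.nonneg _ (inner_mem_Icc hw n))]

/-- The scattering distributions of different directions are images of each other. -/
lemma map_rot_scat (hg : IsCollisionKernel d g) {w : E d} (hw : ‖w‖ = 1)
    (R : E d ≃ₗᵢ[ℝ] E d) : (scat g w).map (rot R) = scat g (R w) := by
  ext s hs
  have hRw : ‖R w‖ = 1 := by simp [hw]
  rw [Measure.map_apply (measurable_rot R) hs, scat, scat,
    withDensity_apply _ (measurable_rot R hs), withDensity_apply _ hs,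
    ← (measurePreserving_rot R).setLIntegral_comp_preimage hs
      (measurable_density hg hRw).ennreal_ofReal]
  simp [rot]

lemma exists_isometry_swap {w w' : E d} (h : ‖w‖ = ‖w'‖) :
    ∃ R : E d ≃ₗᵢ[ℝ] E d, R w = w' ∧ R w' = w := by
  refine ⟨(Submodule.span ℝ {w - w'})ᗮ.reflection, Submodule.reflection_sub h, ?_⟩
  have := congrArg (Submodule.span ℝ {w - w'})ᗮ.reflection (Submodule.reflection_sub h)
  rwa [Submodule.reflection_reflection, eq_comm] at this

/-- The law of `ω' · n` under the scattering distribution of `ω` is symmetric in `ω`, `ω'`. -/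
lemma map_inner_scat_comm (hg : IsCollisionKernel d g) {w w' : E d} (hw : ‖w‖ = 1)
    (hw' : ‖w'‖ = 1) :
    (scat g w).map (fun n : S d => ⟪w', (n : E d)⟫) =
      (scat g w').map (fun n : S d => ⟪w, (n : E d)⟫) := by
  obtain ⟨R, h1, h2⟩ := exists_isometry_swap (hw.trans hw'.symm)
  rw [← h1, ← map_rot_scat hg hw R, Measure.map_map (by fun_prop) (measurable_rot R), h1]
  congr 1
  ext n
  simp only [Function.comp, rot]
  rw [← h2, LinearIsometryEquiv.inner_map_map]

/-- The law of `ω · n` under the scattering distribution of `ω` does not depend on `ω`. -/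
lemma map_inner_scat_self (hg : IsCollisionKernel d g) {w w' : E d} (hw : ‖w‖ = 1)
    (hw' : ‖w'‖ = 1) :
    (scat g w).map (fun n : S d => ⟪w, (n : E d)⟫) =
      (scat g w').map (fun n : S d => ⟪w', (n : E d)⟫) := by
  obtain ⟨R, h1, h2⟩ := exists_isometry_swap (hw.trans hw'.symm)
  rw [← h1, ← map_rot_scat hg hw R, Measure.map_map (by fun_prop) (measurable_rot R)]
  congr 1
  ext n
  simp only [Function.comp, rot]
  rw [LinearIsometryEquiv.inner_map_map]

/-- `k₊ = (k + |k| n) / 2`. -/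
def kplus (k : E d) (n : S d) : E d := (1 / 2 : ℝ) • (k + ‖k‖ • (n : E d))

/-- `k₋ = (k - |k| n) / 2`. -/
def kminus (k : E d) (n : S d) : E d := (1 / 2 : ℝ) • (k - ‖k‖ • (n : E d))

lemma continuous_kplus (k : E d) : Continuous (kplus k) := by unfold kplus; fun_prop

lemma continuous_kminus (k : E d) : Continuous (kminus k) := by unfold kminus; fun_prop

lemma gain_eq (hd : 2 ≤ d) (hg : IsCollisionKernel d g) (φ ψ : E d → ℂ) (k : E d) :
    gain g φ ψ k = ∫ n, φ (kplus k n) * ψ (kminus k n) ∂scat g (dir k) := by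
  rw [integral_scat hg (norm_dir hd k), gain]
  simp only [Complex.real_smul]
  rfl

/-- The gain part of the collision operator, acting on measures of velocities. -/
def gainMeas (g : ℝ → ℝ) (μ : Measure (E d)) : Measure (E d) :=
  (((μ.prod μ).prod (sph d)).withDensity
    (fun x => ENNReal.ofReal (g ⟪dir (x.1.1 - x.1.2), (x.2 : E d)⟫))).map
    (fun x => (1 / 2 : ℝ) • (x.1.1 + x.1.2 + ‖x.1.1 - x.1.2‖ • (x.2 : E d)))

lemma measurable_gain_density (hd : 2 ≤ d) (hg : IsCollisionKernel d g) :
    Measurable fun x : (E d × E d) × S d => g ⟪dir (x.1.1 - x.1.2), (x.2 : E d)⟫ := by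
  refine hg.measurable_comp ?_ fun x => inner_mem_Icc (norm_dir hd _) _
  have : Measurable fun x : (E d × E d) × S d => dir (x.1.1 - x.1.2) :=
    measurable_dir.comp (by fun_prop)
  fun_prop

lemma lintegral_gainMeas (hd : 2 ≤ d) (hg : IsCollisionKernel d g) (μ : Measure (E d))
    [SFinite μ] {f : E d → ℝ≥0∞} (hf : Measurable f) :
    ∫⁻ v, f v ∂gainMeas g μ = ∫⁻ x, ∫⁻ n,
      f ((1 / 2 : ℝ) • (x.1 + x.2 + ‖x.1 - x.2‖ • (n : E d))) ∂scat g (dir (x.1 - x.2))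
        ∂(μ.prod μ) := by
  have hm : Measurable fun x : (E d × E d) × S d =>
      (1 / 2 : ℝ) • (x.1.1 + x.1.2 + ‖x.1.1 - x.1.2‖ • (x.2 : E d)) := by fun_prop
  have hfm : Measurable fun x : (E d × E d) × S d =>
      f ((1 / 2 : ℝ) • (x.1.1 + x.1.2 + ‖x.1.1 - x.1.2‖ • (x.2 : E d))) := hf.comp hm
  rw [gainMeas, lintegral_map hf hm, lintegral_withDensity_eq_lintegral_mul _
    (measurable_gain_density hd hg).ennreal_ofReal hfm, lintegral_prod]
  · refine lintegral_congr fun x => ?_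
    have hfn : Measurable fun n : S d =>
        f ((1 / 2 : ℝ) • (x.1 + x.2 + ‖x.1 - x.2‖ • (n : E d))) := hf.comp (by fun_prop)
    rw [lintegral_scat hg (norm_dir hd _) hfn]
    rfl
  · exact ((measurable_gain_density hd hg).ennreal_ofReal.mul (hf.comp hm)).aemeasurable

lemma isProbabilityMeasure_gainMeas (hd : 2 ≤ d) (hg : IsCollisionKernel d g)
    (μ : Measure (E d)) [IsProbabilityMeasure μ] : IsProbabilityMeasure (gainMeas g μ) := by
  constructor
  rw [← lintegral_one, lintegral_gainMeas hd hg μ measurable_const]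
  have : ∀ x : E d × E d, ∫⁻ _, 1 ∂scat g (dir (x.1 - x.2)) = 1 := fun x => by
    have := isProbabilityMeasure_scat hg (norm_dir hd (x.1 - x.2))
    simp
  simp [this]

lemma lintegral_scat_swap (hd : 2 ≤ d) (hg : IsCollisionKernel d g) (u k : E d)
    {h : ℝ → ℝ≥0∞} (hh : Measurable h) :
    ∫⁻ n, h (‖u‖ * ⟪k, (n : E d)⟫) ∂scat g (dir u) =
      ∫⁻ n, h (‖k‖ * ⟪u, (n : E d)⟫) ∂scat g (dir k) := by
  have e1 : ∀ u k : E d, ∫⁻ n, h (‖u‖ * ⟪k, (n : E d)⟫) ∂scat g (dir u) =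
      ∫⁻ x, h (‖u‖ * ‖k‖ * x) ∂(scat g (dir u)).map (fun n : S d => ⟪dir k, (n : E d)⟫) := by
    intro u k
    have hm : Measurable fun x : ℝ => h (‖u‖ * ‖k‖ * x) := hh.comp (by fun_prop)
    rw [lintegral_map hm (by fun_prop)]
    refine lintegral_congr fun n => ?_
    conv_lhs => rw [← norm_smul_dir k]
    rw [inner_smul_left]
    simp [mul_assoc]
  rw [e1 u k, e1 k u, map_inner_scat_comm hg (norm_dir hd u) (norm_dir hd k), mul_comm ‖u‖]

/-- The law of `k · v` under the gain measure. -/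
lemma map_inner_gainMeas (hd : 2 ≤ d) (hg : IsCollisionKernel d g) (μ : Measure (E d))
    [SFinite μ] (k : E d) :
    (gainMeas g μ).map (fun v => ⟪k, v⟫) = ((scat g (dir k)).prod (μ.prod μ)).map
      (fun x => ⟪kplus k x.1, x.2.1⟫ + ⟪kminus k x.1, x.2.2⟫) := by
  have := isProbabilityMeasure_scat hg (norm_dir hd k)
  have hm : Measurable (fun x : S d × E d × E d =>
      ⟪kplus k x.1, x.2.1⟫ + ⟪kminus k x.1, x.2.2⟫) := by
    have h1 := (continuous_kplus k).measurable
    have h2 := (continuous_kminus k).measurable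
    fun_prop
  refine Measure.ext_of_lintegral _ fun h hh => ?_
  have hk : Measurable fun v : E d => h ⟪k, v⟫ := hh.comp (by fun_prop)
  have hhm : Measurable (fun x : S d × E d × E d =>
      h (⟪kplus k x.1, x.2.1⟫ + ⟪kminus k x.1, x.2.2⟫)) := hh.comp hm
  rw [lintegral_map hh (by fun_prop), lintegral_map hh hm,
    lintegral_gainMeas hd hg μ hk, lintegral_prod_symm' _ hhm]
  refine lintegral_congr fun x => ?_
  have e1 : ∀ n : S d, ⟪k, (1 / 2 : ℝ) • (x.1 + x.2 + ‖x.1 - x.2‖ • (n : E d))⟫ =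
      (1 / 2) * (⟪k, x.1 + x.2⟫ + ‖x.1 - x.2‖ * ⟪k, (n : E d)⟫) := fun n => by
    simp only [inner_smul_right, inner_add_right]
  have e2 : ∀ n : S d, ⟪kplus k n, x.1⟫ + ⟪kminus k n, x.2⟫ =
      (1 / 2) * (⟪k, x.1 + x.2⟫ + ‖k‖ * ⟪x.1 - x.2, (n : E d)⟫) := fun n => by
    simp only [kplus, kminus, real_inner_smul_left, inner_add_right, inner_add_left,
      inner_sub_left, real_inner_comm _ (n : E d)]
    ring
  simp only [e1, e2]
  exact lintegral_scat_swap hd hg (x.1 - x.2) k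
    (h := fun r => h ((1 / 2) * (⟪k, x.1 + x.2⟫ + r))) (hh.comp (by fun_prop))

end Scattering

end

end MaxwellBoltzmann

namespace MaxwellBoltzmann

noncomputable section

open Set Filter Topology
open scoped ENNReal Pointwise

section ScatteringMoments

variable {d : ℕ} {g : ℝ → ℝ}

lemma qConst_eq (hd : 2 ≤ d) (hg : IsCollisionKernel d g) {w : E d} (hw : ‖w‖ = 1) :
    ∫ n, (1 - ⟪w, (n : E d)⟫ ^ 2) ∂scat g w = qConst d g := by
  have h : qConst d g = ∫ n, (1 - ⟪e1 d, (n : E d)⟫ ^ 2) ∂scat g (e1 d) := by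
    rw [integral_scat hg (norm_e1 hd)]; rfl
  have key : ∀ w : E d, ∫ n, (1 - ⟪w, (n : E d)⟫ ^ 2) ∂scat g w =
      ∫ x, (1 - x ^ 2) ∂(scat g w).map (fun n : S d => ⟪w, (n : E d)⟫) := fun w => by
    rw [integral_map (by fun_prop) (by fun_prop)]
  rw [h, key, key, map_inner_scat_self hg hw (norm_e1 hd)]

lemma sph_polar_null (hd : 2 ≤ d) {w : E d} (hw : ‖w‖ = 1) :
    sph d {n | 1 - ⟪w, (n : E d)⟫ ^ 2 = 0} = 0 := by
  have hs : MeasurableSet {n : S d | 1 - ⟪w, (n : E d)⟫ ^ 2 = 0} :=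
    measurableSet_eq_fun (by fun_prop) measurable_const
  have hsub : Ioo (0 : ℝ) 1 • (((↑) : S d → E d) '' {n : S d | 1 - ⟪w, (n : E d)⟫ ^ 2 = 0}) ⊆
      (Submodule.span ℝ {w} : Set (E d)) := by
    rintro x ⟨t, -, _, ⟨n, hn, rfl⟩, rfl⟩
    have h0 : ‖(n : E d) - ⟪w, (n : E d)⟫ • w‖ ^ 2 = 0 := by
      rw [norm_sub_sq_real, norm_smul, inner_smul_right, hw, norm_sphere, real_inner_comm,
        mul_one, Real.norm_eq_abs, sq_abs, real_inner_comm]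
      have : 1 - ⟪w, (n : E d)⟫ ^ 2 = 0 := hn
      linarith
    have h1 : (n : E d) = ⟪w, (n : E d)⟫ • w := by
      rw [← sub_eq_zero, ← norm_eq_zero]; exact pow_eq_zero_iff two_ne_zero |>.1 h0
    rw [SetLike.mem_coe]
    refine Submodule.smul_mem _ _ ?_
    rw [h1]
    exact Submodule.smul_mem _ _ (Submodule.mem_span_singleton_self w)
  rw [Measure.toSphere_apply' _ hs]
  have : (volume : Measure (E d)) (Submodule.span ℝ {w} : Set (E d)) = 0 := by
    refine Measure.addHaar_submodule _ _ fun h => ?_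
    have h1 := finrank_span_singleton (K := ℝ) (v := w) (by rintro rfl; simp at hw)
    rw [h] at h1
    simp at h1
    omega
  rw [measure_mono_null hsub this, mul_zero]

lemma integrable_scat (hg : IsCollisionKernel d g) {w : E d} (hw : ‖w‖ = 1) {F : Type*}
    [NormedAddCommGroup F] [SecondCountableTopology F] {f : S d → F} (hf : Continuous f) : Integrable f (scat g w) := by
  have := isProbabilityMeasure_scat hg hw
  borelize F
  exact BoundedContinuousFunction.integrable _ (BoundedContinuousFunction.mkOfCompact ⟨f, hf⟩)

lemma inner_sq_le_one {w : E d} (hw : ‖w‖ = 1) (n : S d) : ⟪w, (n : E d)⟫ ^ 2 ≤ 1 := by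
  have := inner_mem_Icc hw n
  rw [sq_le_one_iff_abs_le_one, abs_le]; exact this

lemma qConst_pos (hd : 2 ≤ d) (hg : IsCollisionKernel d g) : 0 < qConst d g := by
  have hw := norm_e1 hd
  have hp := isProbabilityMeasure_scat hg hw
  rw [← qConst_eq hd hg hw]
  have h0 : 0 ≤ fun n : S d => 1 - ⟪e1 d, (n : E d)⟫ ^ 2 := fun n => by
    simpa using inner_sq_le_one hw n
  refine lt_of_le_of_ne (integral_nonneg h0) fun h => ?_
  rw [eq_comm, integral_eq_zero_iff_of_nonneg h0 (integrable_scat hg hw (by fun_prop))] at h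
  have h2 : scat g (e1 d) {n : S d | 1 - ⟪e1 d, (n : E d)⟫ ^ 2 = 0} = 0 :=
    withDensity_absolutelyContinuous (sph d) _ (sph_polar_null hd hw)
  have h3 : ∀ᵐ n : S d ∂scat g (e1 d), ¬ (1 - ⟪e1 d, (n : E d)⟫ ^ 2 = 0) := by
    rw [ae_iff]; simpa only [not_not] using h2
  have h4 : ∀ᵐ n ∂scat g (e1 d), False := by
    filter_upwards [h, h3] with n h1 h2 using h2 h1
  have h5 := hp.neZero
  simp [ae_iff] at h4

lemma qConst_le_one (hd : 2 ≤ d) (hg : IsCollisionKernel d g) : qConst d g ≤ 1 := by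
  have hw := norm_e1 hd
  have hp := isProbabilityMeasure_scat hg hw
  rw [← qConst_eq hd hg hw]
  calc _ ≤ ∫ _ : S d, (1 : ℝ) ∂scat g (e1 d) :=
        integral_mono (integrable_scat hg hw (by fun_prop)) (integrable_const _)
          fun n => by simp [sq_nonneg]
    _ = 1 := by simp

lemma integral_scat_comp_isometry (hg : IsCollisionKernel d g) {w : E d} (hw : ‖w‖ = 1)
    {R : E d ≃ₗᵢ[ℝ] E d} (hR : R w = w) {f : E d → ℝ} (hf : Continuous f) :
    ∫ n : S d, f (R n) ∂scat g w = ∫ n : S d, f n ∂scat g w := by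
  have hc : Continuous fun n : S d => f n := hf.comp continuous_subtype_val
  conv_rhs => rw [← hR, ← map_rot_scat hg hw R,
    integral_map (measurable_rot R).aemeasurable hc.aestronglyMeasurable]
  rfl

lemma integral_scat_cross (hg : IsCollisionKernel d g) {w y : E d} (hw : ‖w‖ = 1)
    (hy : ⟪w, y⟫ = 0) : ∫ n : S d, ⟪w, (n : E d)⟫ * ⟪y, (n : E d)⟫ ∂scat g w = 0 := by
  set R : E d ≃ₗᵢ[ℝ] E d := (Submodule.span ℝ {y})ᗮ.reflection
  have hRw : R w = w := by
    rw [Submodule.reflection_eq_self_iff, Submodule.mem_orthogonal_singleton_iff_inner_right,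
      real_inner_comm, hy]
  have hRy : R y = -y := Submodule.reflection_orthogonalComplement_singleton_eq_neg y
  have h := integral_scat_comp_isometry hg hw hRw
    (f := fun x => ⟪w, x⟫ * ⟪y, x⟫) (by fun_prop)
  have e : ∀ n : S d, ⟪w, R n⟫ * ⟪y, R n⟫ = -(⟪w, (n : E d)⟫ * ⟪y, (n : E d)⟫) := fun n => by
    have h1 : ⟪w, R n⟫ = ⟪w, (n : E d)⟫ := by
      conv_lhs => rw [← hRw]
      exact R.inner_map_map _ _
    have h2 : ⟪y, R n⟫ = -⟪y, (n : E d)⟫ := by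
      have : y = -R y := by rw [hRy, neg_neg]
      conv_lhs => rw [this]
      rw [inner_neg_left, R.inner_map_map]
    rw [h1, h2, mul_neg]
  simp only [e, integral_neg] at h
  linarith

lemma integral_scat_perp_comm (hg : IsCollisionKernel d g) {w y z : E d} (hw : ‖w‖ = 1)
    (hy : ⟪w, y⟫ = 0) (hz : ⟪w, z⟫ = 0) :
    ‖z‖ ^ 2 * ∫ n : S d, ⟪y, (n : E d)⟫ ^ 2 ∂scat g w =
      ‖y‖ ^ 2 * ∫ n : S d, ⟪z, (n : E d)⟫ ^ 2 ∂scat g w := by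
  have hn : ‖‖z‖ • y‖ = ‖‖y‖ • z‖ := by simp [norm_smul, mul_comm]
  set R : E d ≃ₗᵢ[ℝ] E d := (Submodule.span ℝ {‖z‖ • y - ‖y‖ • z})ᗮ.reflection
  have hR : R (‖z‖ • y) = ‖y‖ • z := Submodule.reflection_sub hn
  have hRw : R w = w := by
    rw [Submodule.reflection_eq_self_iff, Submodule.mem_orthogonal_singleton_iff_inner_right,
      real_inner_comm, inner_sub_right, inner_smul_right, inner_smul_right, hy, hz]
    simp
  have h := integral_scat_comp_isometry hg hw hRw (f := fun x => ⟪‖y‖ • z, x⟫ ^ 2)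
    (by fun_prop)
  have e : ∀ n : S d, ⟪‖y‖ • z, R n⟫ = ⟪‖z‖ • y, (n : E d)⟫ := fun n => by
    rw [← hR, R.inner_map_map]
  simp only [e, real_inner_smul_left, mul_pow, integral_const_mul] at h
  exact h

lemma integral_scat_inner_sq (hd : 2 ≤ d) (hg : IsCollisionKernel d g) {w : E d} (hw : ‖w‖ = 1)
    (x : E d) :
    ∫ n : S d, ⟪x, (n : E d)⟫ ^ 2 ∂scat g w = (1 - qConst d g) * ⟪w, x⟫ ^ 2 +
      qConst d g / (d - 1) * (‖x‖ ^ 2 - ⟪w, x⟫ ^ 2) := by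
  have hp := isProbabilityMeasure_scat hg hw
  have hww : ⟪w, w⟫ = 1 := by rw [real_inner_self_eq_norm_sq, hw, one_pow]
  set y : E d → E d := fun x => x - ⟪w, x⟫ • w with hydef
  have hy : ∀ x, ⟪w, y x⟫ = 0 := fun x => by
    simp [y, inner_sub_right, inner_smul_right, hw]
  have hny : ∀ x, ‖y x‖ ^ 2 = ‖x‖ ^ 2 - ⟪w, x⟫ ^ 2 := fun x => by
    rw [hydef, norm_sub_sq_real, norm_smul, inner_smul_right, hw, mul_one, Real.norm_eq_abs,
      sq_abs, real_inner_comm]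
    ring
  have hη : ∫ n : S d, ⟪w, (n : E d)⟫ ^ 2 ∂scat g w = 1 - qConst d g := by
    have := qConst_eq hd hg hw
    rw [integral_sub (integrable_const _) (integrable_scat hg hw (by fun_prop))] at this
    simp at this
    linarith
  have hdec : ∀ x : E d, ∫ n : S d, ⟪x, (n : E d)⟫ ^ 2 ∂scat g w =
      (1 - qConst d g) * ⟪w, x⟫ ^ 2 + ∫ n : S d, ⟪y x, (n : E d)⟫ ^ 2 ∂scat g w := fun x => by
    have e : ∀ n : S d, ⟪x, (n : E d)⟫ ^ 2 = ⟪w, x⟫ ^ 2 * ⟪w, (n : E d)⟫ ^ 2 +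
        2 * ⟪w, x⟫ * (⟪w, (n : E d)⟫ * ⟪y x, (n : E d)⟫) + ⟪y x, (n : E d)⟫ ^ 2 := fun n => by
      have : ⟪x, (n : E d)⟫ = ⟪w, x⟫ * ⟪w, (n : E d)⟫ + ⟪y x, (n : E d)⟫ := by
        simp [y, inner_sub_left, real_inner_smul_left]
      rw [this]; ring
    simp only [e]
    rw [integral_add (integrable_scat hg hw (by fun_prop))
      (integrable_scat hg hw (by fun_prop)),
      integral_add (integrable_scat hg hw (by fun_prop))
      (integrable_scat hg hw (by fun_prop)), integral_const_mul, integral_const_mul,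
      integral_scat_cross hg hw (hy x), hη]
    ring
  let b := EuclideanSpace.basisFun (Fin d) ℝ
  have hsum1 : ∑ i, ∫ n : S d, ⟪b i, (n : E d)⟫ ^ 2 ∂scat g w = 1 := by
    rw [← integral_finsetSum _ fun i _ => integrable_scat hg hw (by fun_prop)]
    have : ∀ n : S d, ∑ i, ⟪b i, (n : E d)⟫ ^ 2 = 1 := fun n => by
      rw [b.sum_sq_inner_right, norm_sphere, one_pow]
    simp [this]
  have hw2 : ∑ i, ⟪w, b i⟫ ^ 2 = 1 := by
    rw [b.sum_sq_inner_left, hw, one_pow]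
  have hsumy : ∑ i, ∫ n : S d, ⟪y (b i), (n : E d)⟫ ^ 2 ∂scat g w = qConst d g := by
    simp only [hdec (b _), Finset.sum_add_distrib, ← Finset.mul_sum, hw2] at hsum1
    linarith
  have hsumn : ∑ i, ‖y (b i)‖ ^ 2 = (d : ℝ) - 1 := by
    simp [hny, Finset.sum_sub_distrib, hw2]
  have hfin : qConst d g * ‖y x‖ ^ 2 =
      (d - 1) * ∫ n : S d, ⟪y x, (n : E d)⟫ ^ 2 ∂scat g w := by
    rw [← hsumy, ← hsumn, Finset.sum_mul, Finset.sum_mul]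
    refine Finset.sum_congr rfl fun i _ => ?_
    rw [mul_comm]
    exact integral_scat_perp_comm hg hw (hy _) (hy _)
  have hd1 : (d : ℝ) - 1 ≠ 0 := by
    have : (2 : ℝ) ≤ d := by exact_mod_cast hd
    linarith
  rw [hdec, ← hny]
  field_simp
  linarith

lemma norm_kplus_sq (k : E d) (n : S d) :
    ‖kplus k n‖ ^ 2 = ‖k‖ ^ 2 * ((1 + ⟪dir k, (n : E d)⟫) / 2) := by
  have : ⟪k, (n : E d)⟫ = ‖k‖ * ⟪dir k, (n : E d)⟫ := by
    conv_lhs => rw [← norm_smul_dir k, real_inner_smul_left]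
  rw [kplus, norm_smul, mul_pow, norm_add_sq_real, inner_smul_right, this, norm_smul,
    norm_sphere, norm_norm]
  norm_num
  ring

lemma norm_kminus_sq (k : E d) (n : S d) :
    ‖kminus k n‖ ^ 2 = ‖k‖ ^ 2 * ((1 - ⟪dir k, (n : E d)⟫) / 2) := by
  have : ⟪k, (n : E d)⟫ = ‖k‖ * ⟪dir k, (n : E d)⟫ := by
    conv_lhs => rw [← norm_smul_dir k, real_inner_smul_left]
  rw [kminus, norm_smul, mul_pow, norm_sub_sq_real, inner_smul_right, this, norm_smul,
    norm_sphere, norm_norm]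
  norm_num
  ring

lemma norm_kplus_le (k : E d) (n : S d) : ‖kplus k n‖ ≤ ‖k‖ := by
  rw [kplus, norm_smul]
  have := norm_add_le k (‖k‖ • (n : E d))
  rw [norm_smul, norm_norm, norm_sphere] at this
  norm_num
  linarith

lemma norm_kminus_le (k : E d) (n : S d) : ‖kminus k n‖ ≤ ‖k‖ := by
  rw [kminus, norm_smul]
  have := norm_sub_le k (‖k‖ • (n : E d))
  rw [norm_smul, norm_norm, norm_sphere] at this
  norm_num
  linarith

lemma cube_le_of_sq_add_sq_eq_one {x y : ℝ} (hx : 0 ≤ x) (hy : 0 ≤ y) (h : x ^ 2 + y ^ 2 = 1) :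
    x ^ 3 + y ^ 3 ≤ 1 - x ^ 2 * y ^ 2 := by
  have hx1 : x ≤ 1 := by nlinarith
  have hy1 : y ≤ 1 := by nlinarith
  have h1 : x ^ 2 * (1 - x) ≥ x ^ 2 * y ^ 2 / 2 := by
    have : 1 - x ≥ y ^ 2 / 2 := by nlinarith
    nlinarith [sq_nonneg x]
  have h2 : y ^ 2 * (1 - y) ≥ x ^ 2 * y ^ 2 / 2 := by
    have : 1 - y ≥ x ^ 2 / 2 := by nlinarith
    nlinarith [sq_nonneg y]
  nlinarith

lemma rpow_kplus_add_rpow_kminus_le (hd : 2 ≤ d) {p : ℝ} (hp : 3 ≤ p) (k : E d) (n : S d) :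
    ‖kplus k n‖ ^ p + ‖kminus k n‖ ^ p ≤
      ‖k‖ ^ p * (1 - (1 - ⟪dir k, (n : E d)⟫ ^ 2) / 4) := by
  obtain ⟨h1, h2⟩ := inner_mem_Icc (norm_dir hd k) n
  set η := ⟪dir k, (n : E d)⟫
  set x := √((1 + η) / 2)
  set y := √((1 - η) / 2)
  have hx : 0 ≤ x := Real.sqrt_nonneg _
  have hy : 0 ≤ y := Real.sqrt_nonneg _
  have hx2 : x ^ 2 = (1 + η) / 2 := Real.sq_sqrt (by linarith)
  have hy2 : y ^ 2 = (1 - η) / 2 := Real.sq_sqrt (by linarith)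
  have e1 : ‖kplus k n‖ = ‖k‖ * x := by
    rw [← sq_eq_sq₀ (norm_nonneg _) (by positivity), norm_kplus_sq, mul_pow, hx2]
  have e2 : ‖kminus k n‖ = ‖k‖ * y := by
    rw [← sq_eq_sq₀ (norm_nonneg _) (by positivity), norm_kminus_sq, mul_pow, hy2]
  have hsum : x ^ 2 + y ^ 2 = 1 := by rw [hx2, hy2]; ring
  have hx1 : x ≤ 1 := by nlinarith
  have hy1 : y ≤ 1 := by nlinarith
  have h3 : ∀ z : ℝ, 0 ≤ z → z ≤ 1 → z ^ p ≤ z ^ 3 := fun z hz hz1 => by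
    rw [← Real.rpow_natCast]
    exact Real.rpow_le_rpow_of_exponent_ge' hz hz1 (by norm_num) (by exact_mod_cast hp)
  rw [e1, e2, Real.mul_rpow (norm_nonneg _) hx, Real.mul_rpow (norm_nonneg _) hy, ← mul_add]
  refine mul_le_mul_of_nonneg_left ?_ (by positivity)
  have h4 := cube_le_of_sq_add_sq_eq_one hx hy hsum
  have h5 := h3 x hx hx1
  have h6 := h3 y hy hy1
  have h7 : x ^ 2 * y ^ 2 = (1 - η ^ 2) / 4 := by rw [hx2, hy2]; ring
  linarith

/-- The contraction constant of the linearized gain operator on functions of order at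
least three. -/
def lam (d : ℕ) (g : ℝ → ℝ) : ℝ := 1 - qConst d g / 4

lemma lam_nonneg (hd : 2 ≤ d) (hg : IsCollisionKernel d g) : 0 ≤ lam d g := by
  have := qConst_le_one hd hg
  unfold lam; linarith

lemma lam_lt_one (hd : 2 ≤ d) (hg : IsCollisionKernel d g) : lam d g < 1 := by
  have := qConst_pos hd hg
  unfold lam; linarith

lemma integral_rpow_kplus_add_le (hd : 2 ≤ d) (hg : IsCollisionKernel d g) {p : ℝ} (hp : 3 ≤ p)
    (k : E d) :
    ∫ n, (‖kplus k n‖ ^ p + ‖kminus k n‖ ^ p) ∂scat g (dir k) ≤ lam d g * ‖k‖ ^ p := by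
  have hw := norm_dir hd k
  have := isProbabilityMeasure_scat hg hw
  have h0 : 0 ≤ p := by linarith
  have c1 : Continuous fun n => ‖kplus k n‖ ^ p :=
    (continuous_kplus k).norm.rpow_const fun _ => Or.inr h0
  have c2 : Continuous fun n => ‖kminus k n‖ ^ p :=
    (continuous_kminus k).norm.rpow_const fun _ => Or.inr h0
  calc _ ≤ ∫ n, ‖k‖ ^ p * (1 - (1 - ⟪dir k, (n : E d)⟫ ^ 2) / 4) ∂scat g (dir k) :=
        integral_mono (integrable_scat hg hw (c1.add c2)) (integrable_scat hg hw (by fun_prop))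
          fun n => rpow_kplus_add_rpow_kminus_le hd hp k n
    _ = lam d g * ‖k‖ ^ p := by
        rw [integral_const_mul, integral_sub (integrable_const _)
          (integrable_scat hg hw (by fun_prop)), integral_div, qConst_eq hd hg hw, lam]
        simp [mul_comm]

end ScatteringMoments

end

end MaxwellBoltzmann

namespace MaxwellBoltzmann

noncomputable section

open Set Filter Topology
open scoped ENNReal Pointwise

section Flow

variable {d : ℕ}

/-- The linear flow `e^{-τ T}`. -/
def flow (T : E d →L[ℝ] E d) (τ : ℝ) : E d →L[ℝ] E d := NormedSpace.exp ((-τ) • T)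

lemma flow_zero (T : E d →L[ℝ] E d) : flow T 0 = 1 := by
  rw [flow, neg_zero, zero_smul ℝ T, NormedSpace.exp_zero]

lemma exp_neg_add_smul {𝔸 : Type*} [NormedRing 𝔸] [NormedAlgebra ℝ 𝔸] [CompleteSpace 𝔸]
    (x : 𝔸) (s t : ℝ) : NormedSpace.exp ((-(s + t)) • x) =
      NormedSpace.exp ((-s) • x) * NormedSpace.exp ((-t) • x) := by
  let +nondep : NormedAlgebra ℚ 𝔸 := .restrictScalars ℚ ℝ 𝔸
  rw [neg_add, add_smul, NormedSpace.exp_add_of_commute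
    (((Commute.refl x).smul_left _).smul_right _)]

lemma flow_add (T : E d →L[ℝ] E d) (s t : ℝ) (k : E d) :
    flow T (s + t) k = flow T s (flow T t k) := by
  have h : flow T (s + t) = flow T s * flow T t := exp_neg_add_smul T s t
  rw [h]
  rfl

lemma hasDerivAt_flow_clm (T : E d →L[ℝ] E d) (τ : ℝ) :
    HasDerivAt (flow T) (-(T * flow T τ)) τ := by
  have h := (hasDerivAt_exp_smul_const' (𝕂 := ℝ) T (-τ)).scomp τ (hasDerivAt_neg τ)
  have e : -(T * flow T τ) = (-1 : ℝ) • (T * flow T τ) := (neg_one_smul ℝ _).symm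
  rw [e]
  exact h

lemma hasDerivAt_flow (T : E d →L[ℝ] E d) (k : E d) (τ : ℝ) :
    HasDerivAt (fun τ => flow T τ k) (-(T (flow T τ k))) τ := by
  have h := (hasDerivAt_flow_clm T τ).clm_apply (hasDerivAt_const τ k)
  simpa using h

lemma continuous_flow_clm (T : E d →L[ℝ] E d) : Continuous (flow T) :=
  continuous_iff_continuousAt.2 fun τ => (hasDerivAt_flow_clm T τ).continuousAt

lemma continuous_flow (T : E d →L[ℝ] E d) (k : E d) : Continuous fun τ => flow T τ k :=
  (continuous_flow_clm T).clm_apply continuous_const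

lemma norm_flow_le (T : E d →L[ℝ] E d) (k : E d) {τ : ℝ} (hτ : 0 ≤ τ) :
    ‖flow T τ k‖ ≤ Real.exp (‖T‖ * τ) * ‖k‖ := by
  have h := norm_le_gronwallBound_of_norm_deriv_right_le (f := fun τ => flow T τ k)
    (f' := fun τ => -(T (flow T τ k))) (δ := ‖k‖) (K := ‖T‖) (ε := 0) (a := 0) (b := τ)
    (continuous_flow T k).continuousOn (fun x _ => (hasDerivAt_flow T k x).hasDerivWithinAt)
    (by simp [flow_zero]) (fun x _ => by simpa using T.le_opNorm (flow T x k)) τ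
    (right_mem_Icc.2 hτ)
  rw [gronwallBound_ε0] at h
  simpa [mul_comm] using h

end Flow

section Waiting

/-- The standard exponential distribution. -/
def waitMeas : Measure ℝ :=
  (volume.restrict (Ioi 0)).withDensity fun τ => ENNReal.ofReal (Real.exp (-τ))

lemma integral_waitMeas {F : Type*} [NormedAddCommGroup F] [NormedSpace ℝ F] (f : ℝ → F) :
    ∫ τ, f τ ∂waitMeas = ∫ τ in Ioi (0 : ℝ), Real.exp (-τ) • f τ := by
  rw [waitMeas, integral_withDensity_eq_integral_toReal_smul (by fun_prop) (by simp)]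
  refine integral_congr_ae (Eventually.of_forall fun τ => ?_)
  dsimp only
  rw [ENNReal.toReal_ofReal (Real.exp_pos _).le]

instance : IsProbabilityMeasure waitMeas := by
  constructor
  rw [waitMeas, withDensity_apply _ MeasurableSet.univ, Measure.restrict_univ,
    ← ofReal_integral_eq_lintegral_ofReal (integrableOn_exp_neg_Ioi 0)
      (Eventually.of_forall fun _ => (Real.exp_pos _).le), integral_exp_neg_Ioi_zero,
    ENNReal.ofReal_one]

lemma ae_waitMeas_pos : ∀ᵐ τ ∂waitMeas, 0 < τ :=
  (withDensity_absolutelyContinuous (volume.restrict (Ioi (0 : ℝ))) _).ae_le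
    (ae_restrict_mem measurableSet_Ioi)

lemma integrable_waitMeas_iff {F : Type*} [NormedAddCommGroup F] [NormedSpace ℝ F] {f : ℝ → F} :
    Integrable f waitMeas ↔ IntegrableOn (fun τ => Real.exp (-τ) • f τ) (Ioi 0) := by
  rw [waitMeas, integrable_withDensity_iff_integrable_smul' (by fun_prop) (by simp)]
  refine integrable_congr (Eventually.of_forall fun τ => ?_)
  dsimp only
  rw [ENNReal.toReal_ofReal (Real.exp_pos _).le]

lemma integrable_exp_waitMeas {a : ℝ} (ha : a < 1) :
    Integrable (fun τ => Real.exp (a * τ)) waitMeas := by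
  rw [integrable_waitMeas_iff]
  refine (integrableOn_exp_mul_Ioi (a := a - 1) (by linarith) 0).congr_fun (fun τ _ => ?_)
    measurableSet_Ioi
  rw [smul_eq_mul, ← Real.exp_add]
  ring_nf

lemma integral_exp_waitMeas {a : ℝ} (ha : a < 1) :
    ∫ τ, Real.exp (a * τ) ∂waitMeas = 1 / (1 - a) := by
  rw [integral_waitMeas]
  have : ∀ τ : ℝ, Real.exp (-τ) • Real.exp (a * τ) = Real.exp ((a - 1) * τ) := fun τ => by
    rw [smul_eq_mul, ← Real.exp_add]; ring_nf
  simp only [this]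
  rw [integral_exp_mul_Ioi (by linarith)]
  simp only [mul_zero, Real.exp_zero]
  rw [← neg_sub 1 a, neg_div_neg_eq]

/-- Averages of functions of order `p` along the flow. -/
lemma norm_integral_flow_le {d : ℕ} (T : E d →L[ℝ] E d) {p : ℝ} (hp0 : 0 ≤ p) (hp : p * ‖T‖ < 1)
    {F : Type*} [NormedAddCommGroup F] [NormedSpace ℝ F] {f : E d → F} {C : ℝ} (hC : 0 ≤ C)
    (hf : ∀ k, ‖f k‖ ≤ C * ‖k‖ ^ p) (k : E d) :
    ‖∫ τ, f (flow T τ k) ∂waitMeas‖ ≤ C / (1 - p * ‖T‖) * ‖k‖ ^ p := by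
  have hint := (integrable_exp_waitMeas hp).const_mul (C * ‖k‖ ^ p)
  calc _ ≤ ∫ τ, C * ‖k‖ ^ p * Real.exp (p * ‖T‖ * τ) ∂waitMeas := by
        refine norm_integral_le_of_norm_le hint ?_
        filter_upwards [ae_waitMeas_pos] with τ hτ
        refine (hf _).trans ?_
        rw [mul_assoc]
        refine mul_le_mul_of_nonneg_left ?_ hC
        calc _ ≤ (Real.exp (‖T‖ * τ) * ‖k‖) ^ p :=
              Real.rpow_le_rpow (norm_nonneg _) (norm_flow_le T k hτ.le) hp0
          _ = _ := by
            rw [Real.mul_rpow (Real.exp_pos _).le (norm_nonneg _), ← Real.exp_mul, mul_comm]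
            ring_nf
    _ = _ := by
        rw [integral_const_mul, integral_exp_waitMeas hp]
        ring

lemma integrable_flow {d : ℕ} (T : E d →L[ℝ] E d) {p : ℝ} (hp0 : 0 ≤ p) (hp : p * ‖T‖ < 1)
    {F : Type*} [NormedAddCommGroup F] [NormedSpace ℝ F] {f : E d → F} {C : ℝ} (hC : 0 ≤ C)
    (hf : ∀ k, ‖f k‖ ≤ C * ‖k‖ ^ p) (k : E d)
    (hm : AEStronglyMeasurable (fun τ => f (flow T τ k)) waitMeas) :
    Integrable (fun τ => f (flow T τ k)) waitMeas := by
  refine ((integrable_exp_waitMeas hp).const_mul (C * ‖k‖ ^ p)).mono' hm ?_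
  filter_upwards [ae_waitMeas_pos] with τ hτ
  refine (hf _).trans ?_
  rw [mul_assoc]
  refine mul_le_mul_of_nonneg_left ?_ hC
  calc _ ≤ (Real.exp (‖T‖ * τ) * ‖k‖) ^ p :=
        Real.rpow_le_rpow (norm_nonneg _) (norm_flow_le T k hτ.le) hp0
    _ = _ := by
      rw [Real.mul_rpow (Real.exp_pos _).le (norm_nonneg _), ← Real.exp_mul, mul_comm]
      ring_nf

end Waiting

section Evolve

variable {d : ℕ}

/-- The law of `(e^{-τ T})ᵀ v` for `v` distributed according to `ν` and an independent
standard exponential time `τ`. -/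
def evolve (T : E d →L[ℝ] E d) (ν : Measure (E d)) : Measure (E d) :=
  (waitMeas.prod ν).map fun x => ContinuousLinearMap.adjoint (flow T x.1) x.2

lemma measurable_evolve (T : E d →L[ℝ] E d) :
    Measurable fun x : ℝ × E d => ContinuousLinearMap.adjoint (flow T x.1) x.2 := by
  refine Continuous.measurable ?_
  exact ((ContinuousLinearMap.adjoint.continuous.comp (continuous_flow_clm T)).comp
    continuous_fst).clm_apply continuous_snd

instance (T : E d →L[ℝ] E d) (ν : Measure (E d)) [IsProbabilityMeasure ν] :
    IsProbabilityMeasure (evolve T ν) :=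
  Measure.isProbabilityMeasure_map (measurable_evolve T).aemeasurable

lemma measurable_inner_flow (T : E d →L[ℝ] E d) (k : E d) :
    Measurable fun x : ℝ × E d => ⟪flow T x.1 k, x.2⟫ := by
  have := (continuous_flow T k)
  exact Continuous.measurable (by fun_prop)

lemma map_inner_evolve (T : E d →L[ℝ] E d) (ν : Measure (E d)) (k : E d) :
    (evolve T ν).map (fun v => ⟪k, v⟫) =
      (waitMeas.prod ν).map fun x => ⟪flow T x.1 k, x.2⟫ := by
  rw [evolve, Measure.map_map (by fun_prop) (measurable_evolve T)]
  congr 1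
  ext x
  simp [ContinuousLinearMap.adjoint_inner_right]

end Evolve

section CharFn

variable {d : ℕ} {g : ℝ → ℝ}

lemma charFn_eq (μ : Measure (E d)) (k : E d) : charFn μ k = charFun μ (-k) := by
  rw [charFn, charFun_apply]
  congr 1
  ext v
  rw [inner_neg_right, real_inner_comm]
  push_cast
  ring_nf

lemma norm_charFn_le_one (μ : Measure (E d)) [IsProbabilityMeasure μ] (k : E d) :
    ‖charFn μ k‖ ≤ 1 := by
  rw [charFn_eq]; exact norm_charFun_le_one _

lemma continuous_charFn (μ : Measure (E d)) [IsProbabilityMeasure μ] :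
    Continuous (charFn μ) := by
  have : charFn μ = fun k => charFun μ (-k) := funext (charFn_eq μ)
  rw [this]
  exact continuous_charFun.comp continuous_neg

lemma measure_ext_of_charFn {μ ν : Measure (E d)} [IsProbabilityMeasure μ]
    [IsProbabilityMeasure ν] (h : charFn μ = charFn ν) : μ = ν := by
  refine Measure.ext_of_charFun (funext fun k => ?_)
  have := congrFun h (-k)
  rwa [charFn_eq, charFn_eq, neg_neg] at this

lemma charFn_eq_map (μ : Measure (E d)) (k : E d) :
    charFn μ k = ∫ x : ℝ, Complex.exp (-Complex.I * x) ∂μ.map (fun v => ⟪k, v⟫) := by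
  rw [integral_map (by fun_prop) (by fun_prop)]
  rfl

lemma norm_exp_neg_I_mul (x : ℝ) : ‖Complex.exp (-Complex.I * x)‖ = 1 := by
  rw [Complex.norm_exp]; simp

lemma charFn_gainMeas (hd : 2 ≤ d) (hg : IsCollisionKernel d g) (μ : Measure (E d))
    [IsProbabilityMeasure μ] : charFn (gainMeas g μ) = Gam g (charFn μ) := by
  ext k
  have := isProbabilityMeasure_scat hg (norm_dir hd k)
  have h1 := continuous_kplus k
  have h2 := continuous_kminus k
  have hc : Continuous (fun x : S d × E d × E d =>
      ⟪kplus k x.1, x.2.1⟫ + ⟪kminus k x.1, x.2.2⟫) := by fun_prop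
  rw [charFn_eq_map, map_inner_gainMeas hd hg, integral_map hc.measurable.aemeasurable
    (by fun_prop), Gam, gain_eq hd hg, integral_prod]
  · refine integral_congr_ae (Eventually.of_forall fun n => ?_)
    dsimp only
    rw [charFn, charFn, ← integral_prod_mul]
    refine integral_congr_ae (Eventually.of_forall fun x => ?_)
    dsimp only
    rw [← Complex.exp_add]
    push_cast
    ring_nf
  · refine (integrable_const (1 : ℝ)).mono' ?_ (Eventually.of_forall fun x => ?_)
    · exact (Continuous.comp (g := fun y : ℝ => Complex.exp (-Complex.I * y)) (by fun_prop)
        hc).aestronglyMeasurable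
    · rw [norm_exp_neg_I_mul]

lemma charFn_evolve (T : E d →L[ℝ] E d) (ν : Measure (E d)) [IsProbabilityMeasure ν] (k : E d) :
    charFn (evolve T ν) k = ∫ τ, charFn ν (flow T τ k) ∂waitMeas := by
  have hm := measurable_inner_flow T k
  rw [charFn_eq_map, map_inner_evolve, integral_map hm.aemeasurable (by fun_prop),
    integral_prod]
  · rfl
  · refine (integrable_const (1 : ℝ)).mono' ?_ (Eventually.of_forall fun x => ?_)
    · exact (Continuous.measurable (f := fun y : ℝ => Complex.exp (-Complex.I * y))
        (by fun_prop) |>.comp hm).aestronglyMeasurable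
    · rw [norm_exp_neg_I_mul]

/-- One step of the stationary iteration on the level of measures. -/
def stepMeas (g : ℝ → ℝ) (T : E d →L[ℝ] E d) (μ : Measure (E d)) : Measure (E d) :=
  evolve T (gainMeas g μ)

lemma isProbabilityMeasure_stepMeas (hd : 2 ≤ d) (hg : IsCollisionKernel d g)
    (T : E d →L[ℝ] E d) (μ : Measure (E d)) [IsProbabilityMeasure μ] :
    IsProbabilityMeasure (stepMeas g T μ) := by
  have := isProbabilityMeasure_gainMeas hd hg μ
  unfold stepMeas; infer_instance

lemma charFn_stepMeas (hd : 2 ≤ d) (hg : IsCollisionKernel d g)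
    (T : E d →L[ℝ] E d) (μ : Measure (E d)) [IsProbabilityMeasure μ] (k : E d) :
    charFn (stepMeas g T μ) k = ∫ τ, Gam g (charFn μ) (flow T τ k) ∂waitMeas := by
  have := isProbabilityMeasure_gainMeas hd hg μ
  rw [stepMeas, charFn_evolve, charFn_gainMeas hd hg]

lemma isStationary_iff (hd : 2 ≤ d) (hg : IsCollisionKernel d g) (A : Matrix (Fin d) (Fin d) ℝ)
    (β : ℝ) (μ : Measure (E d)) [IsProbabilityMeasure μ] :
    IsStationary g A β (charFn μ) ↔ stepMeas g (op (shifted A β)) μ = μ := by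
  have := isProbabilityMeasure_stepMeas hd hg (op (shifted A β)) μ
  have e : ∀ k, ∫ τ in Ioi (0 : ℝ), semigroup A β τ (Gam g (charFn μ)) k =
      charFn (stepMeas g (op (shifted A β)) μ) k := fun k => by
    rw [charFn_stepMeas hd hg, integral_waitMeas]
    rfl
  constructor
  · intro h
    refine measure_ext_of_charFn (funext fun k => ?_)
    rw [h k, e]
  · intro h k
    rw [e, h]

/-- The gain operator contracts differences of order `p ≥ 3`. -/
lemma norm_Gam_sub_le (hd : 2 ≤ d) (hg : IsCollisionKernel d g) {p : ℝ} (hp : 3 ≤ p)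
    {φ ψ : E d → ℂ} (hφ : Continuous φ) (hψ : Continuous ψ) (hφ1 : ∀ k, ‖φ k‖ ≤ 1)
    (hψ1 : ∀ k, ‖ψ k‖ ≤ 1) {C : ℝ} (h : ∀ k, ‖φ k - ψ k‖ ≤ C * ‖k‖ ^ p) (k : E d) :
    ‖Gam g φ k - Gam g ψ k‖ ≤ C * lam d g * ‖k‖ ^ p := by
  have hw := norm_dir hd k
  have := isProbabilityMeasure_scat hg hw
  have h1 := continuous_kplus k
  have h2 := continuous_kminus k
  by_cases hC : 0 ≤ C
  · have h0 : 0 ≤ p := by linarith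
    have c1 : Continuous fun n => ‖kplus k n‖ ^ p := h1.norm.rpow_const fun _ => Or.inr h0
    have c2 : Continuous fun n => ‖kminus k n‖ ^ p := h2.norm.rpow_const fun _ => Or.inr h0
    have i1 : Integrable (fun n => φ (kplus k n) * φ (kminus k n)) (scat g (dir k)) :=
      integrable_scat hg hw ((hφ.comp h1).mul (hφ.comp h2))
    have i2 : Integrable (fun n => ψ (kplus k n) * ψ (kminus k n)) (scat g (dir k)) :=
      integrable_scat hg hw ((hψ.comp h1).mul (hψ.comp h2))
    rw [Gam, Gam, gain_eq hd hg, gain_eq hd hg, ← integral_sub i1 i2]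
    calc _ ≤ ∫ n, C * (‖kplus k n‖ ^ p + ‖kminus k n‖ ^ p) ∂scat g (dir k) := by
          refine norm_integral_le_of_norm_le
            (integrable_scat hg hw (continuous_const.mul (c1.add c2)))
            (Eventually.of_forall fun n => ?_)
          have e : φ (kplus k n) * φ (kminus k n) - ψ (kplus k n) * ψ (kminus k n) =
              (φ (kplus k n) - ψ (kplus k n)) * φ (kminus k n) +
                ψ (kplus k n) * (φ (kminus k n) - ψ (kminus k n)) := by ring
          rw [e, mul_add]
          refine (norm_add_le _ _).trans (add_le_add ?_ ?_) <;> rw [norm_mul]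
          · exact (mul_le_of_le_one_right (norm_nonneg _) (hφ1 _)).trans (h _)
          · exact (mul_le_of_le_one_left (norm_nonneg _) (hψ1 _)).trans (h _)
      _ ≤ _ := by
          rw [integral_const_mul, mul_assoc]
          exact mul_le_mul_of_nonneg_left (integral_rpow_kplus_add_le hd hg hp k) hC
  · have : ∀ k : E d, k = 0 := fun k => by
      by_contra hk
      have h3 := h k
      have : 0 < ‖k‖ ^ p := Real.rpow_pos_of_pos (norm_pos_iff.2 hk) _
      nlinarith [norm_nonneg (φ k - ψ k)]
    have h4 := norm_dir hd k
    rw [this (dir k)] at h4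
    simp at h4

lemma norm_charFn_stepMeas_sub_le (hd : 2 ≤ d) (hg : IsCollisionKernel d g)
    (T : E d →L[ℝ] E d) {p : ℝ} (hp : 3 ≤ p) (hpT : p * ‖T‖ < 1) (μ ν : Measure (E d))
    [IsProbabilityMeasure μ] [IsProbabilityMeasure ν] {C : ℝ} (hC : 0 ≤ C)
    (h : ∀ k, ‖charFn μ k - charFn ν k‖ ≤ C * ‖k‖ ^ p) (k : E d) :
    ‖charFn (stepMeas g T μ) k - charFn (stepMeas g T ν) k‖ ≤
      lam d g / (1 - p * ‖T‖) * C * ‖k‖ ^ p := by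
  have i1 := isProbabilityMeasure_gainMeas hd hg μ
  have i2 := isProbabilityMeasure_gainMeas hd hg ν
  have hint : ∀ (ρ : Measure (E d)) [IsProbabilityMeasure ρ],
      Integrable (fun τ => charFn ρ (flow T τ k)) waitMeas := fun ρ _ =>
    (integrable_const (1 : ℝ)).mono'
      ((continuous_charFn ρ).comp (continuous_flow T k)).aestronglyMeasurable
      (Eventually.of_forall fun τ => norm_charFn_le_one ρ _)
  rw [stepMeas, stepMeas, charFn_evolve, charFn_evolve, ← integral_sub (hint _) (hint _)]
  have := norm_integral_flow_le T (by linarith) hpT (C := C * lam d g)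
    (mul_nonneg hC (lam_nonneg hd hg))
    (f := fun k => charFn (gainMeas g μ) k - charFn (gainMeas g ν) k) (fun k => by
      rw [charFn_gainMeas hd hg, charFn_gainMeas hd hg]
      exact norm_Gam_sub_le hd hg hp (continuous_charFn μ) (continuous_charFn ν)
        (norm_charFn_le_one μ) (norm_charFn_le_one ν) h k) k
  refine this.trans (le_of_eq ?_)
  ring

end CharFn

end

end MaxwellBoltzmann

namespace MaxwellBoltzmann

noncomputable section

open Set Filter Topology
open scoped ENNReal Pointwise

section Moments

variable {d : ℕ} {g : ℝ → ℝ}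

/-- The directional absolute moments of order `l` are bounded by `b`. -/
def MomBound (μ : Measure (E d)) (l : ℕ) (b : ℝ) : Prop :=
  ∀ k : E d, ∫⁻ v, ENNReal.ofReal (|⟪k, v⟫| ^ l) ∂μ ≤ ENNReal.ofReal (b * ‖k‖ ^ l)

lemma MomBound.mono {μ : Measure (E d)} {l : ℕ} {b b' : ℝ} (h : MomBound μ l b) (hb : b ≤ b') :
    MomBound μ l b' := fun k =>
  (h k).trans (ENNReal.ofReal_le_ofReal (mul_le_mul_of_nonneg_right hb (by positivity)))

lemma momBound_zero (μ : Measure (E d)) [IsProbabilityMeasure μ] : MomBound μ 0 1 := fun k => by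
  simp

lemma momBound_of_integrable {μ : Measure (E d)} {l : ℕ}
    (h : Integrable (fun v => ‖v‖ ^ l) μ) : MomBound μ l (∫ v, ‖v‖ ^ l ∂μ) := fun k => by
  have h2 := h.const_mul (‖k‖ ^ l)
  rw [mul_comm, ← integral_const_mul, ofReal_integral_eq_lintegral_ofReal h2
    (Eventually.of_forall fun v => by positivity)]
  refine lintegral_mono fun v => ENNReal.ofReal_le_ofReal ?_
  rw [← mul_pow]
  exact pow_le_pow_left₀ (abs_nonneg _) (abs_real_inner_le_norm k v) l

lemma norm_pow_le_sum (v : E d) (l : ℕ) :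
    ‖v‖ ^ l ≤ 1 + (d : ℝ) ^ l * ∑ i, |v i| ^ l := by
  rcases Nat.eq_zero_or_pos l with rfl | hl
  · simp only [pow_zero, one_mul, Finset.sum_const, Finset.card_univ, Fintype.card_fin,
      nsmul_eq_mul, mul_one]
    linarith [Nat.cast_nonneg (α := ℝ) d]
  rcases Nat.eq_zero_or_pos d with rfl | hd
  · have : v = 0 := Subsingleton.elim _ _
    simp [this, hl.ne']
  have h1 : ‖v‖ ≤ ∑ i, |v i| := by
    have h := norm_sum_le Finset.univ fun i => v i • EuclideanSpace.basisFun (Fin d) ℝ i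
    have e := (EuclideanSpace.basisFun (Fin d) ℝ).sum_repr v
    simp only [EuclideanSpace.basisFun_repr] at e
    rw [e] at h
    simpa [norm_smul] using h
  have h2 := pow_sum_div_card_le_sum_pow (s := Finset.univ) (f := fun i => |v i|)
    (fun i _ => abs_nonneg _) (l - 1)
  rw [Nat.sub_add_cancel hl, Finset.card_univ, Fintype.card_fin, div_le_iff₀ (by positivity)] at h2
  have hd1 : (1 : ℝ) ≤ d := by exact_mod_cast hd
  have h3 : (d : ℝ) ^ (l - 1) ≤ d ^ l := pow_le_pow_right₀ hd1 (Nat.sub_le _ _)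
  have h4 : 0 ≤ ∑ i, |v i| ^ l := Finset.sum_nonneg fun i _ => by positivity
  calc ‖v‖ ^ l ≤ (∑ i, |v i|) ^ l := pow_le_pow_left₀ (norm_nonneg _) h1 l
    _ ≤ (∑ i, |v i| ^ l) * d ^ (l - 1) := h2
    _ ≤ 1 + (d : ℝ) ^ l * ∑ i, |v i| ^ l := by nlinarith

lemma MomBound.integrable {μ : Measure (E d)} {l : ℕ} {b : ℝ} (h : MomBound μ l b) (k : E d) :
    Integrable (fun v => |⟪k, v⟫| ^ l) μ := by
  refine ⟨by fun_prop, ?_⟩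
  rw [hasFiniteIntegral_iff_ofReal (Eventually.of_forall fun v => by positivity)]
  exact (h k).trans_lt ENNReal.ofReal_lt_top

lemma MomBound.integrable_norm_pow {μ : Measure (E d)} [IsProbabilityMeasure μ] {l : ℕ} {b : ℝ}
    (h : MomBound μ l b) : Integrable (fun v => ‖v‖ ^ l) μ := by
  have h1 : Integrable (fun v : E d => 1 + (d : ℝ) ^ l * ∑ i, |v i| ^ l) μ := by
    refine (integrable_const _).add (Integrable.const_mul (integrable_finsetSum _ fun i _ => ?_) _)
    have := h.integrable (EuclideanSpace.single i 1)
    simpa [EuclideanSpace.inner_single_left] using this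
  refine h1.mono' (by fun_prop) (Eventually.of_forall fun v => ?_)
  rw [Real.norm_of_nonneg (by positivity)]
  exact norm_pow_le_sum v l

lemma MomBound.one_of_two {μ : Measure (E d)} [IsProbabilityMeasure μ] {b : ℝ} (hb : 0 ≤ b)
    (h : MomBound μ 2 b) : MomBound μ 1 (1 + b) := fun k => by
  rcases eq_or_ne k 0 with rfl | hk
  · simp
  have hk' : 0 < ‖k‖ := norm_pos_iff.2 hk
  have h1 := h (‖k‖⁻¹ • k)
  calc ∫⁻ v, ENNReal.ofReal (|⟪k, v⟫| ^ 1) ∂μ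
      ≤ ∫⁻ v, (ENNReal.ofReal ‖k‖ + ENNReal.ofReal ‖k‖ *
          ENNReal.ofReal (|⟪‖k‖⁻¹ • k, v⟫| ^ 2)) ∂μ := by
        refine lintegral_mono fun v => ?_
        rw [← ENNReal.ofReal_mul hk'.le, ← ENNReal.ofReal_add hk'.le (by positivity)]
        refine ENNReal.ofReal_le_ofReal ?_
        have e : ⟪k, v⟫ = ‖k‖ * ⟪‖k‖⁻¹ • k, v⟫ := by
          rw [real_inner_smul_left, ← mul_assoc, mul_inv_cancel₀ hk'.ne', one_mul]
        rw [pow_one, e, abs_mul, abs_norm]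
        nlinarith [sq_nonneg (|⟪‖k‖⁻¹ • k, v⟫| - 1), abs_nonneg (⟪‖k‖⁻¹ • k, v⟫)]
    _ = ENNReal.ofReal ‖k‖ + ENNReal.ofReal ‖k‖ *
          ∫⁻ v, ENNReal.ofReal (|⟪‖k‖⁻¹ • k, v⟫| ^ 2) ∂μ := by
        rw [lintegral_add_left measurable_const, lintegral_const_mul _ (by fun_prop)]
        simp
    _ ≤ ENNReal.ofReal ‖k‖ + ENNReal.ofReal ‖k‖ * ENNReal.ofReal b := by
        gcongr
        simpa [norm_smul, hk'.ne'] using h1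
    _ = ENNReal.ofReal ((1 + b) * ‖k‖ ^ 1) := by
        rw [← ENNReal.ofReal_mul hk'.le, ← ENNReal.ofReal_add hk'.le (by positivity)]
        ring_nf

lemma lintegral_abs_add_pow_le (μ : Measure (E d)) [IsProbabilityMeasure μ] {l : ℕ} (hl : 1 ≤ l)
    {B b : ℝ} (hB : 1 ≤ B) (hb : 0 ≤ b) (hlow : ∀ j < l, MomBound μ j B) (hμ : MomBound μ l b)
    {x y k : E d} (hx : ‖x‖ ≤ ‖k‖) (hy : ‖y‖ ≤ ‖k‖) :
    ∫⁻ z, ENNReal.ofReal (|⟪x, z.1⟫ + ⟪y, z.2⟫| ^ l) ∂μ.prod μ ≤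
      ENNReal.ofReal (b * (‖x‖ ^ l + ‖y‖ ^ l) + 2 ^ l * B ^ 2 * ‖k‖ ^ l) := by
  have hB0 : 0 ≤ B := by linarith
  have hsub : ∀ {x : E d}, ‖x‖ ≤ ‖k‖ → ∀ j < l,
      ∫⁻ v, ENNReal.ofReal (|⟪x, v⟫| ^ j) ∂μ ≤ ENNReal.ofReal (B * ‖k‖ ^ j) := fun hx j hj =>
    (hlow j hj _).trans (ENNReal.ofReal_le_ofReal (by gcongr))
  have hterm : ∀ j ∈ Finset.range (l + 1),
      ENNReal.ofReal (l.choose j) * ((∫⁻ v, ENNReal.ofReal (|⟪x, v⟫| ^ j) ∂μ) *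
        ∫⁻ v, ENNReal.ofReal (|⟪y, v⟫| ^ (l - j)) ∂μ) ≤
      ENNReal.ofReal ((if j = 0 then b * ‖y‖ ^ l else 0) + (if j = l then b * ‖x‖ ^ l else 0) +
        l.choose j * (B ^ 2 * ‖k‖ ^ l)) := fun j hj => by
    have hj' : j ≤ l := Nat.lt_succ_iff.1 (Finset.mem_range.1 hj)
    rcases eq_or_ne j 0 with rfl | h0
    · have h1 : (0 : ℕ) ≠ l := by omega
      simp only [pow_zero, Nat.choose_zero_right, Nat.cast_one, ENNReal.ofReal_one, one_mul,
        lintegral_one, measure_univ, Nat.sub_zero, if_true, if_neg h1, add_zero]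
      exact (hμ y).trans (ENNReal.ofReal_le_ofReal (le_add_of_nonneg_right (by positivity)))
    rcases eq_or_ne j l with rfl | h1
    · simp only [pow_zero, Nat.choose_self, Nat.cast_one, ENNReal.ofReal_one, one_mul, mul_one,
        lintegral_one, measure_univ, Nat.sub_self, if_true, if_neg h0, zero_add]
      exact (hμ x).trans (ENNReal.ofReal_le_ofReal (le_add_of_nonneg_right (by positivity)))
    · rw [if_neg h0, if_neg h1, zero_add, zero_add, ENNReal.ofReal_mul (by positivity)]
      gcongr
      calc _ ≤ ENNReal.ofReal (B * ‖k‖ ^ j) * ENNReal.ofReal (B * ‖k‖ ^ (l - j)) :=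
            mul_le_mul' (hsub hx j (by omega)) (hsub hy (l - j) (by omega))
        _ = _ := by
            rw [← ENNReal.ofReal_mul (by positivity), ← pow_mul_pow_sub ‖k‖ hj']
            ring_nf
  calc _ ≤ ∫⁻ z, ∑ j ∈ Finset.range (l + 1), ENNReal.ofReal (l.choose j) *
        (ENNReal.ofReal (|⟪x, z.1⟫| ^ j) * ENNReal.ofReal (|⟪y, z.2⟫| ^ (l - j))) ∂μ.prod μ := by
        refine lintegral_mono fun z => ?_
        have : ∀ j ∈ Finset.range (l + 1), 0 ≤ (l.choose j : ℝ) *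
            (|⟪x, z.1⟫| ^ j * |⟪y, z.2⟫| ^ (l - j)) := fun j _ => by positivity
        simp only [← ENNReal.ofReal_mul (pow_nonneg (abs_nonneg (⟪x, z.1⟫)) _),
          ← ENNReal.ofReal_mul (Nat.cast_nonneg (l.choose _) : (0 : ℝ) ≤ _)]
        rw [← ENNReal.ofReal_sum_of_nonneg this]
        refine ENNReal.ofReal_le_ofReal ?_
        calc _ ≤ (|⟪x, z.1⟫| + |⟪y, z.2⟫|) ^ l :=
              pow_le_pow_left₀ (abs_nonneg _) (abs_add_le _ _) l
          _ = _ := by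
              rw [add_pow]
              exact Finset.sum_congr rfl fun j _ => by ring
    _ = ∑ j ∈ Finset.range (l + 1), ENNReal.ofReal (l.choose j) *
        ((∫⁻ v, ENNReal.ofReal (|⟪x, v⟫| ^ j) ∂μ) *
          ∫⁻ v, ENNReal.ofReal (|⟪y, v⟫| ^ (l - j)) ∂μ) := by
        rw [lintegral_finsetSum _ fun j _ => by fun_prop]
        refine Finset.sum_congr rfl fun j _ => ?_
        rw [lintegral_const_mul _ (by fun_prop),
          lintegral_prod_mul (f := fun v => ENNReal.ofReal (|⟪x, v⟫| ^ j))
            (g := fun v => ENNReal.ofReal (|⟪y, v⟫| ^ (l - j))) (by fun_prop) (by fun_prop)]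
    _ ≤ _ := Finset.sum_le_sum hterm
    _ = _ := by
        rw [← ENNReal.ofReal_sum_of_nonneg fun j _ => by split_ifs <;> positivity]
        congr 1
        rw [Finset.sum_add_distrib, Finset.sum_add_distrib, ← Finset.sum_mul,
          Finset.sum_ite_eq' , Finset.sum_ite_eq', ← Nat.cast_sum, Nat.sum_range_choose]
        simp
        ring

lemma momBound_gainMeas (hd : 2 ≤ d) (hg : IsCollisionKernel d g) (μ : Measure (E d))
    [IsProbabilityMeasure μ] {l : ℕ} (hl : 1 ≤ l) {B b s : ℝ} (hB : 1 ≤ B) (hb : 0 ≤ b)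
    (hlow : ∀ j < l, MomBound μ j B) (hμ : MomBound μ l b)
    (hs : ∀ k : E d, ∫ n, (‖kplus k n‖ ^ l + ‖kminus k n‖ ^ l) ∂scat g (dir k) ≤ s * ‖k‖ ^ l) :
    MomBound (gainMeas g μ) l (s * b + 2 ^ l * B ^ 2) := fun k => by
  have hw := norm_dir hd k
  have := isProbabilityMeasure_scat hg hw
  have h1 := continuous_kplus k
  have h2 := continuous_kminus k
  have hc : Continuous (fun x : S d × E d × E d =>
      ⟪kplus k x.1, x.2.1⟫ + ⟪kminus k x.1, x.2.2⟫) := by fun_prop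
  have hm : Measurable fun x : ℝ => ENNReal.ofReal (|x| ^ l) := by fun_prop
  have hi : Integrable (fun n => ‖kplus k n‖ ^ l + ‖kminus k n‖ ^ l) (scat g (dir k)) :=
    integrable_scat hg hw (h1.norm.pow l |>.add (h2.norm.pow l))
  have hi2 : Integrable (fun n => b * (‖kplus k n‖ ^ l + ‖kminus k n‖ ^ l) +
      2 ^ l * B ^ 2 * ‖k‖ ^ l) (scat g (dir k)) := (hi.const_mul b).add (integrable_const _)
  calc ∫⁻ v, ENNReal.ofReal (|⟪k, v⟫| ^ l) ∂gainMeas g μ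
      = ∫⁻ x, ENNReal.ofReal (|x| ^ l) ∂(gainMeas g μ).map (fun v => ⟪k, v⟫) := by
        rw [lintegral_map hm (by fun_prop)]
    _ = ∫⁻ n, ∫⁻ z, ENNReal.ofReal (|⟪kplus k n, z.1⟫ + ⟪kminus k n, z.2⟫| ^ l) ∂μ.prod μ
          ∂scat g (dir k) := by
        rw [map_inner_gainMeas hd hg, lintegral_map hm hc.measurable, lintegral_prod]
        exact (hm.comp hc.measurable).aemeasurable
    _ ≤ ∫⁻ n, ENNReal.ofReal (b * (‖kplus k n‖ ^ l + ‖kminus k n‖ ^ l) +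
          2 ^ l * B ^ 2 * ‖k‖ ^ l) ∂scat g (dir k) :=
        lintegral_mono fun n => lintegral_abs_add_pow_le μ hl hB hb hlow hμ
          (norm_kplus_le k n) (norm_kminus_le k n)
    _ = ENNReal.ofReal (∫ n, (b * (‖kplus k n‖ ^ l + ‖kminus k n‖ ^ l) +
          2 ^ l * B ^ 2 * ‖k‖ ^ l) ∂scat g (dir k)) := by
        rw [ofReal_integral_eq_lintegral_ofReal hi2]
        exact Eventually.of_forall fun n => by dsimp; positivity
    _ ≤ _ := by
        refine ENNReal.ofReal_le_ofReal ?_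
        rw [integral_add (hi.const_mul b) (integrable_const _), integral_const_mul]
        simp only [integral_const, probReal_univ, one_smul]
        rw [add_mul]
        refine add_le_add_left ?_ _
        calc _ ≤ b * (s * ‖k‖ ^ l) := mul_le_mul_of_nonneg_left (hs k) hb
          _ = _ := by ring

lemma integral_pow_kplus_add_le_two (hd : 2 ≤ d) (hg : IsCollisionKernel d g) (l : ℕ) (k : E d) :
    ∫ n, (‖kplus k n‖ ^ l + ‖kminus k n‖ ^ l) ∂scat g (dir k) ≤ 2 * ‖k‖ ^ l := by
  have hw := norm_dir hd k
  have := isProbabilityMeasure_scat hg hw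
  calc _ ≤ ∫ _, 2 * ‖k‖ ^ l ∂scat g (dir k) := by
        refine integral_mono (integrable_scat hg hw (((continuous_kplus k).norm.pow l).add
          ((continuous_kminus k).norm.pow l))) (integrable_const _) fun n => ?_
        have h1 := pow_le_pow_left₀ (norm_nonneg _) (norm_kplus_le k n) l
        have h2 := pow_le_pow_left₀ (norm_nonneg _) (norm_kminus_le k n) l
        dsimp only
        linarith
    _ = _ := by simp

lemma integral_pow_kplus_add_le (hd : 2 ≤ d) (hg : IsCollisionKernel d g) {l : ℕ} (hl : 3 ≤ l)
    (k : E d) :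
    ∫ n, (‖kplus k n‖ ^ l + ‖kminus k n‖ ^ l) ∂scat g (dir k) ≤ lam d g * ‖k‖ ^ l := by
  have := integral_rpow_kplus_add_le hd hg (p := l) (by exact_mod_cast hl) k
  simpa only [Real.rpow_natCast] using this

lemma momBound_evolve (T : E d →L[ℝ] E d) (ν : Measure (E d)) [IsProbabilityMeasure ν] {l : ℕ}
    (hT : l * ‖T‖ < 1) {b : ℝ} (hb : 0 ≤ b) (h : MomBound ν l b) :
    MomBound (evolve T ν) l (b / (1 - l * ‖T‖)) := fun k => by
  have hm : Measurable fun x : ℝ => ENNReal.ofReal (|x| ^ l) := by fun_prop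
  have hi := (integrable_exp_waitMeas hT).const_mul (b * ‖k‖ ^ l)
  calc ∫⁻ v, ENNReal.ofReal (|⟪k, v⟫| ^ l) ∂evolve T ν
      = ∫⁻ x, ENNReal.ofReal (|x| ^ l) ∂(evolve T ν).map (fun v => ⟪k, v⟫) := by
        rw [lintegral_map hm (by fun_prop)]
    _ = ∫⁻ τ, ∫⁻ v, ENNReal.ofReal (|⟪flow T τ k, v⟫| ^ l) ∂ν ∂waitMeas := by
        rw [map_inner_evolve, lintegral_map hm (measurable_inner_flow T k), lintegral_prod]
        exact (hm.comp (measurable_inner_flow T k)).aemeasurable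
    _ ≤ ∫⁻ τ, ENNReal.ofReal (b * ‖k‖ ^ l * Real.exp (l * ‖T‖ * τ)) ∂waitMeas := by
        refine lintegral_mono_ae ?_
        filter_upwards [ae_waitMeas_pos] with τ hτ
        refine (h _).trans (ENNReal.ofReal_le_ofReal ?_)
        rw [mul_assoc]
        refine mul_le_mul_of_nonneg_left ?_ hb
        calc _ ≤ (Real.exp (‖T‖ * τ) * ‖k‖) ^ l :=
              pow_le_pow_left₀ (norm_nonneg _) (norm_flow_le T k hτ.le) _
          _ = _ := by rw [mul_pow, ← Real.exp_nat_mul, mul_comm, mul_assoc]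
    _ = _ := by
        rw [← ofReal_integral_eq_lintegral_ofReal hi
          (Eventually.of_forall fun τ => by dsimp; positivity), integral_const_mul,
          integral_exp_waitMeas hT]
        ring_nf

/-- The moment `∫ (-i k · v)^l / l! dμ(v)`. -/
def cmom (μ : Measure (E d)) (l : ℕ) (k : E d) : ℂ :=
  ∫ v, (-Complex.I * (⟪k, v⟫ : ℝ)) ^ l / (l.factorial : ℂ) ∂μ

lemma cmom_zero (μ : Measure (E d)) [IsProbabilityMeasure μ] (k : E d) : cmom μ 0 k = 1 := by
  simp [cmom]

lemma norm_cterm_le (l : ℕ) (x : ℝ) :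
    ‖(-Complex.I * (x : ℂ)) ^ l / (l.factorial : ℂ)‖ ≤ |x| ^ l := by
  rw [norm_div, norm_pow, norm_mul, norm_neg, Complex.norm_I, one_mul, Complex.norm_real,
    Complex.norm_natCast, Real.norm_eq_abs]
  exact div_le_self (by positivity) (by exact_mod_cast Nat.one_le_iff_ne_zero.2 l.factorial_ne_zero)

lemma MomBound.integrable_cterm {μ : Measure (E d)} {l : ℕ} {b : ℝ} (h : MomBound μ l b)
    (k : E d) :
    Integrable (fun v => (-Complex.I * (⟪k, v⟫ : ℝ)) ^ l / (l.factorial : ℂ)) μ :=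
  (h.integrable k).mono' (by fun_prop) (Eventually.of_forall fun v => norm_cterm_le l _)

lemma MomBound.norm_cmom_le {μ : Measure (E d)} {l : ℕ} {b : ℝ} (hb : 0 ≤ b)
    (h : MomBound μ l b) (k : E d) : ‖cmom μ l k‖ ≤ b * ‖k‖ ^ l := by
  refine (norm_integral_le_of_norm_le (h.integrable k)
    (Eventually.of_forall fun v => norm_cterm_le l _)).trans ?_
  rw [integral_eq_lintegral_of_nonneg_ae (Eventually.of_forall fun v => by positivity)
    (h.integrable k).aestronglyMeasurable]
  exact ENNReal.toReal_le_of_le_ofReal (by positivity) (h k)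

lemma cterm_add (l : ℕ) (x y : ℂ) :
    (x + y) ^ l / (l.factorial : ℂ) = ∑ jm ∈ Finset.HasAntidiagonal.antidiagonal l,
      x ^ jm.1 / (jm.1.factorial : ℂ) * (y ^ jm.2 / (jm.2.factorial : ℂ)) := by
  rw [(Commute.all x y).add_pow', Finset.sum_div]
  refine Finset.sum_congr rfl fun jm hjm => ?_
  rw [Finset.HasAntidiagonal.mem_antidiagonal] at hjm
  subst hjm
  have h := Nat.add_choose_mul_factorial_mul_factorial jm.1 jm.2
  have h1 : ((jm.1 + jm.2).choose jm.1 : ℂ) * jm.1.factorial * jm.2.factorial =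
      (jm.1 + jm.2).factorial := by
    rw [Nat.choose_symm_add]; exact_mod_cast h
  have e1 : (jm.1.factorial : ℂ) ≠ 0 := by exact_mod_cast jm.1.factorial_ne_zero
  have e2 : (jm.2.factorial : ℂ) ≠ 0 := by exact_mod_cast jm.2.factorial_ne_zero
  have e3 : ((jm.1 + jm.2).factorial : ℂ) ≠ 0 := by exact_mod_cast (jm.1 + jm.2).factorial_ne_zero
  rw [nsmul_eq_mul]
  field_simp
  rw [← h1]
  ring

lemma cmom_eq_map (μ : Measure (E d)) (l : ℕ) (k : E d) :
    cmom μ l k = ∫ x : ℝ, (-Complex.I * x) ^ l / (l.factorial : ℂ) ∂μ.map (fun v => ⟪k, v⟫) := by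
  rw [integral_map (by fun_prop) (by fun_prop)]
  rfl

lemma cmom_gainMeas (hd : 2 ≤ d) (hg : IsCollisionKernel d g) (μ : Measure (E d))
    [IsProbabilityMeasure μ] (l : ℕ) (hμ : ∀ j ≤ l, Integrable (fun v => ‖v‖ ^ j) μ) (k : E d) :
    cmom (gainMeas g μ) l k =
      ∑ jm ∈ Finset.HasAntidiagonal.antidiagonal l, gain g (cmom μ jm.1) (cmom μ jm.2) k := by
  have hw := norm_dir hd k
  have := isProbabilityMeasure_scat hg hw
  have h1 := continuous_kplus k
  have h2 := continuous_kminus k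
  have hc : Continuous (fun x : S d × E d × E d =>
      ⟪kplus k x.1, x.2.1⟫ + ⟪kminus k x.1, x.2.2⟫) := by fun_prop
  have hint : ∀ jm ∈ Finset.HasAntidiagonal.antidiagonal l, Integrable (fun x : S d × E d × E d =>
      (-Complex.I * (⟪kplus k x.1, x.2.1⟫ : ℝ)) ^ jm.1 / (jm.1.factorial : ℂ) *
      ((-Complex.I * (⟪kminus k x.1, x.2.2⟫ : ℝ)) ^ jm.2 / (jm.2.factorial : ℂ)))
      ((scat g (dir k)).prod (μ.prod μ)) := fun jm hjm => by
    rw [Finset.HasAntidiagonal.mem_antidiagonal] at hjm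
    have hi := ((integrable_const (μ := scat g (dir k)) (‖k‖ ^ l)).mul_prod
      ((hμ jm.1 (by omega)).mul_prod (hμ jm.2 (by omega))))
    refine hi.mono' (Continuous.aestronglyMeasurable (by fun_prop))
      (Eventually.of_forall fun x => ?_)
    rw [norm_mul]
    have key : ∀ (y : E d) (v : E d) (j : ℕ), ‖y‖ ≤ ‖k‖ →
        ‖(-Complex.I * (⟪y, v⟫ : ℝ)) ^ j / (j.factorial : ℂ)‖ ≤ ‖k‖ ^ j * ‖v‖ ^ j := by
      intro y v j hy
      refine (norm_cterm_le _ _).trans ?_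
      rw [← mul_pow]
      refine pow_le_pow_left₀ (abs_nonneg _) ((abs_real_inner_le_norm _ _).trans ?_) _
      gcongr
    refine (mul_le_mul (key _ _ _ (norm_kplus_le k _)) (key _ _ _ (norm_kminus_le k _))
      (norm_nonneg _) (by positivity)).trans (le_of_eq ?_)
    rw [← hjm, pow_add]
    ring
  rw [cmom_eq_map, map_inner_gainMeas hd hg, integral_map hc.measurable.aemeasurable
    (by fun_prop)]
  have e : ∀ x : S d × E d × E d,
      (-Complex.I * ((⟪kplus k x.1, x.2.1⟫ + ⟪kminus k x.1, x.2.2⟫ : ℝ) : ℂ)) ^ l /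
        (l.factorial : ℂ) = ∑ jm ∈ Finset.HasAntidiagonal.antidiagonal l,
      (-Complex.I * (⟪kplus k x.1, x.2.1⟫ : ℝ)) ^ jm.1 / (jm.1.factorial : ℂ) *
      ((-Complex.I * (⟪kminus k x.1, x.2.2⟫ : ℝ)) ^ jm.2 / (jm.2.factorial : ℂ)) := fun x => by
    rw [← cterm_add]; push_cast; ring
  simp only [e]
  rw [integral_finsetSum _ hint]
  refine Finset.sum_congr rfl fun jm hjm => ?_
  rw [integral_prod _ (hint jm hjm), gain_eq hd hg]
  refine integral_congr_ae (Eventually.of_forall fun n => ?_)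
  dsimp only
  rw [cmom, cmom, ← integral_prod_mul]

lemma cmom_evolve (T : E d →L[ℝ] E d) (ν : Measure (E d)) [IsProbabilityMeasure ν] {l : ℕ}
    (hT : l * ‖T‖ < 1) {b : ℝ} (hb : 0 ≤ b) (h : MomBound ν l b) (k : E d) :
    cmom (evolve T ν) l k = ∫ τ, cmom ν l (flow T τ k) ∂waitMeas := by
  have hm := measurable_inner_flow T k
  have h1 : Integrable (fun x : ℝ => |x| ^ l) ((evolve T ν).map (fun v => ⟪k, v⟫)) := by
    rw [integrable_map_measure (by fun_prop) (by fun_prop)]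
    exact (momBound_evolve T ν hT hb h).integrable k
  rw [map_inner_evolve] at h1
  rw [cmom_eq_map, map_inner_evolve, integral_map hm.aemeasurable (by fun_prop), integral_prod]
  · rfl
  · have h2 : Integrable (fun x : ℝ => (-Complex.I * x) ^ l / (l.factorial : ℂ))
        ((waitMeas.prod ν).map fun x => ⟪flow T x.1 k, x.2⟫) :=
      h1.mono' (by fun_prop) (Eventually.of_forall fun x => norm_cterm_le l x)
    rw [integrable_map_measure (by fun_prop) hm.aemeasurable] at h2
    exact h2

lemma norm_exp_sub_taylor_le (M : ℕ) {p : ℝ} (hp : (M : ℝ) ≤ p) (hp1 : p ≤ M + 1) (x : ℝ) :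
    ‖Complex.exp (-Complex.I * x) -
      ∑ l ∈ Finset.range (M + 1), (-Complex.I * (x : ℂ)) ^ l / (l.factorial : ℂ)‖ ≤
      (M + 2) * |x| ^ p := by
  have hn : ‖-Complex.I * (x : ℂ)‖ = |x| := by simp
  rcases le_or_gt |x| 1 with h | h
  · have h1 := Complex.exp_bound (x := -Complex.I * x) (by rw [hn]; exact h) (n := M + 1)
      (Nat.succ_pos M)
    rw [hn] at h1
    refine h1.trans ?_
    have h2 : |x| ^ (M + 1) ≤ |x| ^ p := by
      rw [← Real.rpow_natCast]
      exact Real.rpow_le_rpow_of_exponent_ge_of_imp (abs_nonneg x) h (by push_cast; exact hp1)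
        (fun _ h0 => by
          exfalso
          push_cast at *
          have := Nat.cast_nonneg (α := ℝ) M
          linarith)
    have h3 : ((M + 1).succ : ℝ) * (((M + 1).factorial : ℝ) * ((M + 1 : ℕ) : ℝ))⁻¹ ≤ M + 2 := by
      push_cast
      have h4 : (1 : ℝ) ≤ (M + 1).factorial := by
        exact_mod_cast Nat.one_le_iff_ne_zero.2 (Nat.factorial_ne_zero _)
      have h5 : (((M + 1).factorial : ℝ) * ((M : ℝ) + 1))⁻¹ ≤ 1 := by
        apply inv_le_one_of_one_le₀
        have := Nat.cast_nonneg (α := ℝ) M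
        nlinarith
      have := Nat.cast_nonneg (α := ℝ) M
      nlinarith
    rw [mul_comm]
    exact mul_le_mul h3 h2 (by positivity) (by positivity)
  · have h1 : ∀ l ∈ Finset.range (M + 1),
        ‖(-Complex.I * (x : ℂ)) ^ l / (l.factorial : ℂ)‖ ≤ |x| ^ M := fun l hl => by
      refine (norm_cterm_le l x).trans (pow_le_pow_right₀ h.le ?_)
      have := Finset.mem_range.1 hl
      omega
    have h2 : |x| ^ M ≤ |x| ^ p := by
      rw [← Real.rpow_natCast]
      exact Real.rpow_le_rpow_of_exponent_le h.le hp
    have h3 : 1 ≤ |x| ^ M := one_le_pow₀ h.le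
    refine (norm_sub_le _ _).trans ?_
    rw [norm_exp_neg_I_mul]
    have h4 := norm_sum_le_of_le _ h1
    simp only [Finset.sum_const, Finset.card_range, nsmul_eq_mul] at h4
    push_cast at h4
    have := Nat.cast_nonneg (α := ℝ) M
    nlinarith

/-- Taylor expansion of the characteristic function of a measure with finite moments. -/
lemma norm_charFn_sub_le (μ : Measure (E d)) [IsProbabilityMeasure μ] (M : ℕ) {p : ℝ}
    (hp : (M : ℝ) ≤ p) (hp1 : p ≤ M + 1) (hμ : ∀ j ≤ M, Integrable (fun v => ‖v‖ ^ j) μ)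
    (hμp : Integrable (fun v => ‖v‖ ^ p) μ) (k : E d) :
    ‖charFn μ k - ∑ l ∈ Finset.range (M + 1), cmom μ l k‖ ≤
      ((M + 2) * ∫ v, ‖v‖ ^ p ∂μ) * ‖k‖ ^ p := by
  have hi : ∀ l ∈ Finset.range (M + 1),
      Integrable (fun v => (-Complex.I * (⟪k, v⟫ : ℝ)) ^ l / (l.factorial : ℂ)) μ := fun l hl =>
    (momBound_of_integrable (hμ l (Nat.lt_succ_iff.1 (Finset.mem_range.1 hl)))).integrable_cterm k
  have he : Integrable (fun v => Complex.exp (-Complex.I * (⟪k, v⟫ : ℝ))) μ :=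
    (integrable_const (1 : ℝ)).mono' (by fun_prop)
      (Eventually.of_forall fun v => (norm_exp_neg_I_mul _).le)
  have hp0 : 0 ≤ p := (Nat.cast_nonneg M).trans hp
  simp only [cmom]
  rw [charFn, ← integral_finsetSum _ hi, ← integral_sub he (integrable_finsetSum _ hi)]
  refine (norm_integral_le_of_norm_le (hμp.const_mul ((M + 2) * ‖k‖ ^ p))
    (Eventually.of_forall fun v => ?_)).trans (le_of_eq ?_)
  · refine (norm_exp_sub_taylor_le M hp hp1 _).trans ?_
    rw [mul_assoc, ← Real.mul_rpow (norm_nonneg _) (norm_nonneg _)]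
    gcongr
    exact abs_real_inner_le_norm k v
  · rw [integral_const_mul]
    ring

end Moments

end

end MaxwellBoltzmann

namespace MaxwellBoltzmann

noncomputable section

open Set Filter Topology
open scoped ENNReal Pointwise

section Polynomials

variable {d : ℕ}

lemma continuous_pval (P : MvPolynomial (Fin d) ℂ) : Continuous (pval P) := by
  unfold pval
  exact (MvPolynomial.continuous_eval P).comp (by fun_prop)

lemma pval_sub (P Q : MvPolynomial (Fin d) ℂ) (k : E d) :
    pval (P - Q) k = pval P k - pval Q k := by simp [pval]

lemma pval_injective {P Q : MvPolynomial (Fin d) ℂ} (h : ∀ k, pval P k = pval Q k) : P = Q := by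
  refine MvPolynomial.funext_set (fun _ => range ((↑) : ℝ → ℂ))
    (fun _ => infinite_range_of_injective Complex.ofReal_injective) fun x hx => ?_
  choose y hy using fun i => hx i (mem_univ i)
  have := h (WithLp.toLp 2 y)
  have e : (fun i => ((WithLp.toLp 2 y : E d) i : ℂ)) = x := funext hy
  rwa [pval, pval, e] at this

lemma exists_norm_pval_le {P : MvPolynomial (Fin d) ℂ} {l : ℕ} (hP : P.IsHomogeneous l) :
    ∃ C, 0 ≤ C ∧ ∀ k, ‖pval P k‖ ≤ C * ‖k‖ ^ l := by
  refine ⟨∑ m ∈ P.support, ‖P.coeff m‖, Finset.sum_nonneg fun _ _ => norm_nonneg _, fun k => ?_⟩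
  rw [pval, MvPolynomial.eval_eq', Finset.sum_mul]
  refine norm_sum_le_of_le _ fun m hm => ?_
  rw [norm_mul, norm_prod]
  refine mul_le_mul_of_nonneg_left ?_ (norm_nonneg _)
  have hdeg : ∑ i, m i = l := by
    have := hP (MvPolynomial.mem_support_iff.1 hm)
    rw [Finsupp.weight_apply, Finsupp.sum_fintype _ _ (by simp)] at this
    simpa using this
  rw [← hdeg, ← Finset.prod_pow_eq_pow_sum]
  refine Finset.prod_le_prod (fun _ _ => norm_nonneg _) fun i _ => ?_
  rw [norm_pow, Complex.norm_real]
  exact pow_le_pow_left₀ (norm_nonneg _) (PiLp.norm_apply_le k i) _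

/-- The derivative of a polynomial along the linear vector field `T k`. -/
def drift (T : E d →L[ℝ] E d) (P : MvPolynomial (Fin d) ℂ) (k : E d) : ℂ :=
  ∑ j, ((T k) j : ℂ) * pval (MvPolynomial.pderiv j P) k

lemma continuous_drift (T : E d →L[ℝ] E d) (P : MvPolynomial (Fin d) ℂ) :
    Continuous (drift T P) := by
  unfold drift
  have := fun j => continuous_pval (MvPolynomial.pderiv j P)
  fun_prop

lemma drift_sub (T : E d →L[ℝ] E d) (P Q : MvPolynomial (Fin d) ℂ) (k : E d) :
    drift T (P - Q) k = drift T P k - drift T Q k := by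
  simp [drift, pval_sub, mul_sub, Finset.sum_sub_distrib]

lemma hasDerivAt_pval (P : MvPolynomial (Fin d) ℂ) {c : ℝ → E d} {c' : E d} {t : ℝ}
    (h : HasDerivAt c c' t) :
    HasDerivAt (fun t => pval P (c t))
      (∑ j, (c' j : ℂ) * pval (MvPolynomial.pderiv j P) (c t)) t := by
  induction P using MvPolynomial.induction_on with
  | C a => simpa [pval] using hasDerivAt_const t a
  | add P Q hP hQ =>
    refine ((hP.add hQ).congr_deriv ?_).congr_of_eventuallyEq
      (Eventually.of_forall fun t => by simp [pval])
    simp [pval, mul_add, Finset.sum_add_distrib]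
  | mul_X P i hP =>
    have hi : HasDerivAt (fun t => ((c t) i : ℂ)) (c' i : ℂ) t := by
      have := (EuclideanSpace.proj (𝕜 := ℝ) i).hasFDerivAt.comp_hasDerivAt t h
      exact this.ofReal_comp
    have := hP.mul hi
    refine (this.congr_deriv ?_).congr_of_eventuallyEq
      (Eventually.of_forall fun t => by simp [pval])
    simp only [pval, Derivation.leibniz, MvPolynomial.pderiv_X, smul_eq_mul, map_add, map_mul,
      MvPolynomial.eval_X, mul_add, Finset.sum_add_distrib, Finset.sum_mul]
    rw [add_comm]
    congr 1
    · rw [Finset.sum_eq_single i]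
      · simp [mul_comm]
      · intro j _ hj
        simp [hj.symm]
      · simp
    · exact Finset.sum_congr rfl fun j _ => by ring

lemma hasDerivAt_pval_flow (T : E d →L[ℝ] E d) (P : MvPolynomial (Fin d) ℂ) (k : E d) (τ : ℝ) :
    HasDerivAt (fun τ => pval P (flow T τ k)) (-drift T P (flow T τ k)) τ := by
  have := hasDerivAt_pval P (hasDerivAt_flow T k τ)
  simpa [drift] using this

lemma integrable_flow_pow (T : E d →L[ℝ] E d) {l : ℕ} (hT : l * ‖T‖ < 1) {f : E d → ℂ}
    (hf : Continuous f) {C : ℝ} (hC : 0 ≤ C) (h : ∀ k, ‖f k‖ ≤ C * ‖k‖ ^ l) (k : E d) :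
    Integrable (fun τ => f (flow T τ k)) waitMeas :=
  integrable_flow T (p := l) (Nat.cast_nonneg l) hT hC
    (fun k => by rw [Real.rpow_natCast]; exact h k) k
    (hf.comp (continuous_flow T k)).aestronglyMeasurable

lemma norm_integral_flow_pow_le (T : E d →L[ℝ] E d) {l : ℕ} (hT : l * ‖T‖ < 1) {f : E d → ℂ}
    {C : ℝ} (hC : 0 ≤ C) (h : ∀ k, ‖f k‖ ≤ C * ‖k‖ ^ l) (k : E d) :
    ‖∫ τ, f (flow T τ k) ∂waitMeas‖ ≤ C / (1 - l * ‖T‖) * ‖k‖ ^ l := by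
  have := norm_integral_flow_le T (p := l) (Nat.cast_nonneg l) hT hC
    (f := f) (fun k => by rw [Real.rpow_natCast]; exact h k) k
  rwa [Real.rpow_natCast] at this

/-- A polynomial is the average along the flow of its image under `1 + (T k) · ∂_k`. -/
lemma pval_eq_integral_flow (T : E d →L[ℝ] E d) (P : MvPolynomial (Fin d) ℂ) {l : ℕ}
    (hT : l * ‖T‖ < 1) {C C' : ℝ} (hC' : 0 ≤ C') (hP : ∀ k, ‖pval P k‖ ≤ C * ‖k‖ ^ l)
    (hH : ∀ k, ‖pval P k + drift T P k‖ ≤ C' * ‖k‖ ^ l) (k : E d) :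
    pval P k = ∫ τ, (pval P (flow T τ k) + drift T P (flow T τ k)) ∂waitMeas := by
  have hder : ∀ τ ∈ Ici (0 : ℝ), HasDerivAt (fun τ => Real.exp (-τ) • pval P (flow T τ k))
      (-(Real.exp (-τ) • (pval P (flow T τ k) + drift T P (flow T τ k)))) τ := fun τ _ => by
    have h1 : HasDerivAt (fun τ : ℝ => Real.exp (-τ)) (-Real.exp (-τ)) τ := by
      simpa using (hasDerivAt_neg τ).exp
    refine (h1.smul (hasDerivAt_pval_flow T P k τ)).congr_deriv ?_
    rw [smul_add, smul_neg, neg_smul, neg_add, add_comm]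
  have hint := integrable_flow_pow T hT ((continuous_pval P).add (continuous_drift T P)) hC' hH k
  have hint' : IntegrableOn
      (fun τ => -(Real.exp (-τ) • (pval P (flow T τ k) + drift T P (flow T τ k)))) (Ioi 0) :=
    (integrable_waitMeas_iff.1 hint).neg
  have hlim : Tendsto (fun τ => Real.exp (-τ) • pval P (flow T τ k)) atTop (𝓝 0) := by
    have hC : 0 ≤ C * ‖k‖ ^ l := (norm_nonneg _).trans (hP k)
    have h0 : Tendsto (fun τ => C * ‖k‖ ^ l * Real.exp (-((1 - l * ‖T‖) * τ))) atTop (𝓝 0) := by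
      rw [← mul_zero (C * ‖k‖ ^ l)]
      refine Tendsto.const_mul _ (Real.tendsto_exp_neg_atTop_nhds_zero.comp
        (tendsto_id.const_mul_atTop (by linarith)))
    refine squeeze_zero_norm' ?_ h0
    filter_upwards [eventually_ge_atTop 0] with τ hτ
    rw [norm_smul, Real.norm_of_nonneg (Real.exp_pos _).le]
    have hC0 : ‖flow T τ k‖ ^ l ≤ Real.exp (l * ‖T‖ * τ) * ‖k‖ ^ l := by
      calc _ ≤ (Real.exp (‖T‖ * τ) * ‖k‖) ^ l :=
            pow_le_pow_left₀ (norm_nonneg _) (norm_flow_le T k hτ) _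
        _ = _ := by rw [mul_pow, ← Real.exp_nat_mul, mul_assoc]
    rcases le_or_gt 0 C with hC1 | hC1
    · calc _ ≤ Real.exp (-τ) * (C * (Real.exp (l * ‖T‖ * τ) * ‖k‖ ^ l)) := by
            gcongr
            exact (hP _).trans (mul_le_mul_of_nonneg_left hC0 hC1)
        _ = C * ‖k‖ ^ l * (Real.exp (-τ) * Real.exp (l * ‖T‖ * τ)) := by ring
        _ = _ := by rw [← Real.exp_add]; ring_nf
    · have h2 : ‖pval P (flow T τ k)‖ ≤ 0 :=
        (hP _).trans (mul_nonpos_of_nonpos_of_nonneg hC1.le (by positivity))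
      calc _ ≤ Real.exp (-τ) * 0 := by gcongr
        _ ≤ _ := by rw [mul_zero]; positivity
  have key := integral_Ioi_of_hasDerivAt_of_tendsto' hder hint' hlim
  rw [integral_neg, zero_sub, neg_inj] at key
  rw [integral_waitMeas, key]
  simp [flow_zero]

/-- If a polynomial is the average of `H` along the flow, then `H` is the image of the
polynomial under `1 + (T k) · ∂_k`. -/
lemma pval_add_drift_eq_of_integral (T : E d →L[ℝ] E d) (P : MvPolynomial (Fin d) ℂ) {l : ℕ}
    (hT : l * ‖T‖ < 1) {H : E d → ℂ} (hH : Continuous H) {C : ℝ} (hC : 0 ≤ C)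
    (hHC : ∀ k, ‖H k‖ ≤ C * ‖k‖ ^ l) (h : ∀ k, pval P k = ∫ τ, H (flow T τ k) ∂waitMeas)
    (k : E d) : pval P k + drift T P k = H k := by
  set F : ℝ → ℂ := fun τ => Real.exp (-τ) • H (flow T τ k) with hF
  have hFc : Continuous F := by
    have := hH.comp (continuous_flow T k)
    exact (Real.continuous_exp.comp continuous_neg).smul this
  have hFi : IntegrableOn F (Ioi 0) :=
    integrable_waitMeas_iff.1 (integrable_flow_pow T hT hH hC hHC k)
  have e : ∀ s : ℝ, pval P (flow T s k) =
      Real.exp s • ((∫ τ in Ioi 0, F τ) - ∫ τ in (0 : ℝ)..s, F τ) := fun s => by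
    have h1 := intervalIntegral.integral_interval_add_Ioi' (hFc.intervalIntegrable s 0) hFi
    have h2 : ∫ τ in Ioi s, F τ = ∫ τ in Ioi (0 : ℝ), F (τ + s) := by
      have := (measurePreserving_add_right volume s).setIntegral_preimage_emb
        (measurableEmbedding_addRight s) F (Ioi s)
      rw [← this]
      simp
    rw [h, integral_waitMeas, intervalIntegral.integral_symm s 0, sub_neg_eq_add, add_comm, h1,
      h2, ← integral_smul]
    refine integral_congr_ae (Eventually.of_forall fun τ => ?_)
    simp only [F]
    rw [smul_smul, ← Real.exp_add, flow_add]
    congr 2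
    ring
  have d1 := hasDerivAt_pval_flow T P k 0
  have d2 : HasDerivAt (fun s : ℝ => Real.exp s • ((∫ τ in Ioi 0, F τ) - ∫ τ in (0 : ℝ)..s, F τ))
      (Real.exp 0 • (0 - F 0) +
        Real.exp 0 • ((∫ τ in Ioi 0, F τ) - ∫ τ in (0 : ℝ)..0, F τ)) 0 := by
    refine (Real.hasDerivAt_exp 0).smul ((hasDerivAt_const _ _).sub ?_)
    exact intervalIntegral.integral_hasDerivAt_right (hFc.intervalIntegrable _ _)
      (hFc.stronglyMeasurableAtFilter _ _) hFc.continuousAt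
  simp only [← e] at d2
  have := d1.unique d2
  simp only [F, flow_zero, Real.exp_zero, neg_zero, one_smul, one_apply_eq_self,
    zero_sub] at this
  linear_combination (-1 : ℂ) * this

/-- A function of order `p` is zero if its bounds contract. -/
lemma eq_zero_of_bound_contracts {u : E d → ℂ} {p θ : ℝ} (hθ0 : 0 ≤ θ) (hθ : θ < 1)
    (h0 : ∃ C, 0 ≤ C ∧ ∀ k, ‖u k‖ ≤ C * ‖k‖ ^ p)
    (h : ∀ C, 0 ≤ C → (∀ k, ‖u k‖ ≤ C * ‖k‖ ^ p) → ∀ k, ‖u k‖ ≤ θ * C * ‖k‖ ^ p) (k : E d) :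
    u k = 0 := by
  obtain ⟨C, hC, hu⟩ := h0
  have hn : ∀ n : ℕ, ∀ k, ‖u k‖ ≤ θ ^ n * C * ‖k‖ ^ p := fun n => by
    induction n with
    | zero => simpa using hu
    | succ n ih =>
      intro k
      have := h _ (by positivity) ih k
      rw [pow_succ']
      simpa [mul_assoc] using this
  have hlim : Tendsto (fun n : ℕ => θ ^ n * C * ‖k‖ ^ p) atTop (𝓝 (0 * C * ‖k‖ ^ p)) :=
    ((tendsto_pow_atTop_nhds_zero_of_lt_one hθ0 hθ).mul_const C).mul_const _
  rw [zero_mul, zero_mul] at hlim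
  exact norm_le_zero_iff.1 (ge_of_tendsto' hlim fun n => hn n k)

/-- The polynomial whose values are the moments `∫ (-i k · v)^l / l! dμ(v)`. -/
def momPoly (μ : Measure (E d)) (l : ℕ) : MvPolynomial (Fin d) ℂ :=
  ∑ f : Fin l → Fin d, MvPolynomial.C ((-Complex.I) ^ l / (l.factorial : ℂ) *
    ∫ v : E d, ∏ i, (v (f i) : ℂ) ∂μ) * ∏ i, MvPolynomial.X (f i)

lemma momPoly_isHomogeneous (μ : Measure (E d)) (l : ℕ) : (momPoly μ l).IsHomogeneous l := by
  refine MvPolynomial.IsHomogeneous.sum _ _ _ fun f _ => ?_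
  have h2 := MvPolynomial.IsHomogeneous.prod (R := ℂ) Finset.univ
    (fun i => MvPolynomial.X (f i)) (fun _ => 1) fun i _ => MvPolynomial.isHomogeneous_X ℂ (f i)
  have := (MvPolynomial.isHomogeneous_C (Fin d) ((-Complex.I) ^ l / (l.factorial : ℂ) *
    ∫ v : E d, ∏ i, (v (f i) : ℂ) ∂μ)).mul h2
  simpa using this

lemma pval_momPoly {μ : Measure (E d)} {l : ℕ} (h : Integrable (fun v => ‖v‖ ^ l) μ) (k : E d) :
    pval (momPoly μ l) k = cmom μ l k := by
  have hi : ∀ f : Fin l → Fin d, Integrable (fun v : E d => ∏ i, (v (f i) : ℂ)) μ := fun f => by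
    refine h.mono' (Continuous.aestronglyMeasurable (by fun_prop))
      (Eventually.of_forall fun v => ?_)
    rw [norm_prod]
    calc _ ≤ ∏ _i : Fin l, ‖v‖ := Finset.prod_le_prod (fun _ _ => norm_nonneg _) fun i _ => by
          rw [Complex.norm_real]; exact PiLp.norm_apply_le v _
      _ = _ := by simp
  have e : ∀ v : E d, (-Complex.I * (⟪k, v⟫ : ℝ)) ^ l / (l.factorial : ℂ) =
      ∑ f : Fin l → Fin d, ((-Complex.I) ^ l / (l.factorial : ℂ) * ∏ i, (k (f i) : ℂ)) *
        ∏ i, (v (f i) : ℂ) := fun v => by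
    have : ((⟪k, v⟫ : ℝ) : ℂ) = ∑ i, (k i : ℂ) * (v i : ℂ) := by
      rw [PiLp.inner_apply]
      push_cast
      exact Finset.sum_congr rfl fun i _ => by simp [mul_comm]
    rw [this, mul_pow, Fintype.sum_pow, mul_div_right_comm, Finset.mul_sum]
    refine Finset.sum_congr rfl fun f _ => ?_
    rw [Finset.prod_mul_distrib, mul_assoc]
  simp only [cmom, e]
  rw [integral_finsetSum _ fun f _ => (hi f).const_mul _]
  simp only [momPoly, pval, map_sum, map_mul, map_prod, MvPolynomial.eval_C, MvPolynomial.eval_X]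
  refine Finset.sum_congr rfl fun f _ => ?_
  rw [integral_const_mul]
  ring

end Polynomials

end

end MaxwellBoltzmann

namespace MaxwellBoltzmann

noncomputable section

open Set Filter Topology
open scoped ENNReal Pointwise

section LinearizedGain

variable {d : ℕ} {g : ℝ → ℝ}

lemma linGain_eq (hd : 2 ≤ d) (hg : IsCollisionKernel d g) {φ : E d → ℂ} (hφ : Continuous φ)
    (k : E d) : linGain g φ k = ∫ n, (φ (kplus k n) + φ (kminus k n)) ∂scat g (dir k) := by
  have i1 : Integrable (fun n => φ (kplus k n)) (scat g (dir k)) :=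
    integrable_scat hg (norm_dir hd k) (hφ.comp (continuous_kplus k))
  have i2 : Integrable (fun n => φ (kminus k n)) (scat g (dir k)) :=
    integrable_scat hg (norm_dir hd k) (hφ.comp (continuous_kminus k))
  rw [linGain, gain_eq hd hg, gain_eq hd hg, integral_add i1 i2]
  simp

lemma linGain_sub (hd : 2 ≤ d) (hg : IsCollisionKernel d g) {φ ψ : E d → ℂ} (hφ : Continuous φ)
    (hψ : Continuous ψ) (k : E d) :
    linGain g (fun k => φ k - ψ k) k = linGain g φ k - linGain g ψ k := by
  have h1 := continuous_kplus k
  have h2 := continuous_kminus k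
  have hw := norm_dir hd k
  have i1 : Integrable (fun n => φ (kplus k n) + φ (kminus k n)) (scat g (dir k)) :=
    integrable_scat hg hw (by fun_prop)
  have i2 : Integrable (fun n => ψ (kplus k n) + ψ (kminus k n)) (scat g (dir k)) :=
    integrable_scat hg hw (by fun_prop)
  rw [linGain_eq hd hg (φ := fun k => φ k - ψ k) (hφ.sub hψ), linGain_eq hd hg hφ, linGain_eq hd hg hψ,
    ← integral_sub i1 i2]
  refine integral_congr_ae (Eventually.of_forall fun n => ?_)
  dsimp only
  ring

lemma norm_linGain_le (hd : 2 ≤ d) (hg : IsCollisionKernel d g) {φ : E d → ℂ}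
    (hφ : Continuous φ) {l : ℕ} {s : ℝ}
    (hs : ∀ k : E d, ∫ n, (‖kplus k n‖ ^ l + ‖kminus k n‖ ^ l) ∂scat g (dir k) ≤ s * ‖k‖ ^ l)
    {C : ℝ} (hC : 0 ≤ C) (h : ∀ k, ‖φ k‖ ≤ C * ‖k‖ ^ l) (k : E d) :
    ‖linGain g φ k‖ ≤ s * C * ‖k‖ ^ l := by
  have h1 := continuous_kplus k
  have h2 := continuous_kminus k
  have hw := norm_dir hd k
  rw [linGain_eq hd hg hφ]
  calc _ ≤ ∫ n, C * (‖kplus k n‖ ^ l + ‖kminus k n‖ ^ l) ∂scat g (dir k) := by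
        refine norm_integral_le_of_norm_le (integrable_scat hg hw (by fun_prop))
          (Eventually.of_forall fun n => ?_)
        rw [mul_add]
        exact (norm_add_le _ _).trans (add_le_add (h _) (h _))
    _ ≤ _ := by
        rw [integral_const_mul, mul_comm s, mul_assoc]
        exact mul_le_mul_of_nonneg_left (hs k) hC

/-- A homogeneous polynomial of degree at least three that solves the homogeneous moment
equation is zero. -/
lemma eq_zero_of_homogeneous_equation (hd : 2 ≤ d) (hg : IsCollisionKernel d g)
    (T : E d →L[ℝ] E d) {l : ℕ} (hl : 3 ≤ l) (hT : lam d g + l * ‖T‖ < 1)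
    {P : MvPolynomial (Fin d) ℂ} (hP : P.IsHomogeneous l)
    (h : ∀ k, pval P k + drift T P k = linGain g (pval P) k) : P = 0 := by
  have hlam := lam_nonneg hd hg
  have hT1 : l * ‖T‖ < 1 := by linarith
  refine pval_injective fun k => ?_
  have h0 : pval (0 : MvPolynomial (Fin d) ℂ) k = 0 := by simp [pval]
  rw [h0]
  refine eq_zero_of_bound_contracts (p := l) (θ := lam d g / (1 - l * ‖T‖))
    (div_nonneg hlam (by linarith)) ((div_lt_one (by linarith)).2 (by linarith)) ?_ ?_ k
  · obtain ⟨C, hC, hPC⟩ := exists_norm_pval_le hP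
    exact ⟨C, hC, fun k => by rw [Real.rpow_natCast]; exact hPC k⟩
  · intro C hC hPC k
    simp only [Real.rpow_natCast] at hPC ⊢
    have hH := norm_linGain_le hd hg (continuous_pval P) (integral_pow_kplus_add_le hd hg hl)
      hC hPC
    have hs : 0 ≤ lam d g * C := mul_nonneg hlam hC
    rw [pval_eq_integral_flow T P hT1 hs hPC (fun k => by rw [h]; exact hH k) k]
    have := norm_integral_flow_pow_le T hT1 hs (fun k => by rw [h]; exact hH k)
      (f := fun k => pval P k + drift T P k) k
    refine this.trans (le_of_eq ?_)
    ring

lemma gain_congr_zero_left (φ : E d → ℂ) {z : E d → ℂ} (hz : ∀ k, z k = 0) (k : E d) :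
    gain g z φ k = 0 := by
  simp [gain, hz]

lemma gain_congr_zero_right (φ : E d → ℂ) {z : E d → ℂ} (hz : ∀ k, z k = 0) (k : E d) :
    gain g φ z k = 0 := by
  simp [gain, hz]

/-- Moments of the gain measure in terms of the moment polynomials. -/
lemma cmom_gainMeas_eq (hd : 2 ≤ d) (hg : IsCollisionKernel d g) (μ : Measure (E d))
    [IsProbabilityMeasure μ] {l M : ℕ} (hl : 2 ≤ l) (hlM : l ≤ M)
    (hμ : ∀ j ≤ l, Integrable (fun v => ‖v‖ ^ j) μ) (h1 : ∀ k, cmom μ 1 k = 0) (k : E d) :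
    cmom (gainMeas g μ) l k = linGain g (pval (momPoly μ l)) k +
      momentSource g M (momPoly μ) l k := by
  have hp : ∀ j ≤ l, pval (momPoly μ j) = cmom μ j := fun j hj =>
    funext fun k => pval_momPoly (hμ j hj) k
  have h0 : cmom μ 0 = fun _ => 1 := funext fun k => cmom_zero μ k
  rw [cmom_gainMeas hd hg μ l hμ, linGain, hp l le_rfl, momentSource]
  set s := (Finset.Icc 2 M ×ˢ Finset.Icc 2 M).filter fun jm => jm.1 + jm.2 = l
  have e1 : ∑ jm ∈ s, gain g (pval (momPoly μ jm.1)) (pval (momPoly μ jm.2)) k =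
      ∑ jm ∈ s, gain g (cmom μ jm.1) (cmom μ jm.2) k := by
    refine Finset.sum_congr rfl fun jm hjm => ?_
    simp only [s, Finset.mem_filter] at hjm
    rw [hp _ (by omega), hp _ (by omega)]
  have m1 : ((l, 0) : ℕ × ℕ) ∉ insert ((0, l) : ℕ × ℕ) s := by
    simp only [s, Finset.mem_insert, Finset.mem_filter, Finset.mem_product, Finset.mem_Icc,
      Prod.mk.injEq]
    omega
  have m2 : ((0, l) : ℕ × ℕ) ∉ s := by
    simp [s]
  have e2 : ∑ jm ∈ insert ((l, 0) : ℕ × ℕ) (insert ((0, l) : ℕ × ℕ) s),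
      gain g (cmom μ jm.1) (cmom μ jm.2) k = gain g (cmom μ l) (fun _ => 1) k +
        (gain g (fun _ => 1) (cmom μ l) k + ∑ jm ∈ s, gain g (cmom μ jm.1) (cmom μ jm.2) k) := by
    rw [Finset.sum_insert m1, Finset.sum_insert m2, h0]
  rw [e1, add_assoc, ← e2]
  symm
  refine Finset.sum_subset ?_ ?_
  · intro jm hjm
    rw [Finset.HasAntidiagonal.mem_antidiagonal]
    simp only [s, Finset.mem_insert, Finset.mem_filter] at hjm
    rcases hjm with rfl | rfl | h
    · simp
    · simp
    · exact h.2
  · rintro ⟨j, m⟩ hjm hn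
    rw [Finset.HasAntidiagonal.mem_antidiagonal] at hjm
    simp only [s, Finset.mem_insert, Finset.mem_filter, Finset.mem_product, Finset.mem_Icc,
      Prod.mk.injEq] at hn hjm
    have : j = 1 ∨ m = 1 := by omega
    rcases this with rfl | rfl
    · exact gain_congr_zero_left _ h1 k
    · exact gain_congr_zero_right _ h1 k

lemma integrable_norm_pow_gainMeas (hd : 2 ≤ d) (hg : IsCollisionKernel d g) (μ : Measure (E d))
    [IsProbabilityMeasure μ] {l : ℕ} (hμ : ∀ j ≤ l, Integrable (fun v => ‖v‖ ^ j) μ) :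
    Integrable (fun v => ‖v‖ ^ l) (gainMeas g μ) := by
  have := isProbabilityMeasure_gainMeas hd hg μ
  rcases Nat.eq_zero_or_pos l with rfl | hl
  · simp
  have hb : ∀ j ≤ l, MomBound μ j (1 + ∑ i ∈ Finset.range (l + 1), ∫ v, ‖v‖ ^ i ∂μ) :=
    fun j hj => (momBound_of_integrable (hμ j hj)).mono (by
      have := Finset.single_le_sum (f := fun i => ∫ v, ‖v‖ ^ i ∂μ)
        (fun i _ => integral_nonneg fun v => by positivity)
        (Finset.mem_range.2 (Nat.lt_succ_of_le hj))
      linarith)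
  have h1 : 1 ≤ 1 + ∑ i ∈ Finset.range (l + 1), ∫ v, ‖v‖ ^ i ∂μ :=
    le_add_of_nonneg_right (Finset.sum_nonneg fun i _ => integral_nonneg fun v => by positivity)
  exact (momBound_gainMeas hd hg μ hl h1 (by linarith) (fun j hj => hb j hj.le) (hb l le_rfl)
    (integral_pow_kplus_add_le_two hd hg l)).integrable_norm_pow

/-- The moment polynomials of a stationary measure solve the moment equations. -/
lemma momPoly_equation (hd : 2 ≤ d) (hg : IsCollisionKernel d g) (T : E d →L[ℝ] E d)
    (μ : Measure (E d)) [IsProbabilityMeasure μ] (hstat : stepMeas g T μ = μ) {l M : ℕ}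
    (hl : 2 ≤ l) (hlM : l ≤ M) (hT : l * ‖T‖ < 1)
    (hμ : ∀ j ≤ l, Integrable (fun v => ‖v‖ ^ j) μ) (h1 : ∀ k, cmom μ 1 k = 0) (k : E d) :
    pval (momPoly μ l) k + drift T (momPoly μ l) k =
      linGain g (pval (momPoly μ l)) k + momentSource g M (momPoly μ) l k := by
  have := isProbabilityMeasure_gainMeas hd hg μ
  have hG := integrable_norm_pow_gainMeas hd hg μ hμ
  have hGb := momBound_of_integrable hG
  have hGn : 0 ≤ ∫ v, ‖v‖ ^ l ∂gainMeas g μ := integral_nonneg fun v => by positivity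
  have hcont : Continuous (cmom (gainMeas g μ) l) := by
    have : cmom (gainMeas g μ) l = pval (momPoly (gainMeas g μ) l) :=
      funext fun k => (pval_momPoly hG k).symm
    rw [this]
    exact continuous_pval _
  rw [← cmom_gainMeas_eq hd hg μ hl hlM hμ h1]
  refine pval_add_drift_eq_of_integral T _ hT hcont hGn (hGb.norm_cmom_le hGn) (fun k => ?_) k
  rw [pval_momPoly (hμ l le_rfl)]
  conv_lhs => rw [← hstat, stepMeas]
  exact cmom_evolve T _ hT hGn hGb k

lemma momentFamily_unique (hd : 2 ≤ d) (hg : IsCollisionKernel d g)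
    {A : Matrix (Fin d) (Fin d) ℝ} {β : ℝ} {N : Matrix (Fin d) (Fin d) ℝ} {M : ℕ}
    (hT : lam d g + M * ‖op (shifted A β)‖ < 1) {Q Q' : ℕ → MvPolynomial (Fin d) ℂ}
    (hQ : IsMomentFamily g A β N M Q) (hQ' : IsMomentFamily g A β N M Q') :
    ∀ l ∈ Finset.Icc 2 M, Q' l = Q l := by
  intro l
  induction l using Nat.strong_induction_on with
  | _ l ih =>
    intro hl
    have hl' := Finset.mem_Icc.1 hl
    rcases hl'.1.eq_or_lt with rfl | h3
    · exact pval_injective fun k => by rw [hQ.second, hQ'.second]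
    have hl3 : l ∈ Finset.Icc 3 M := Finset.mem_Icc.2 ⟨h3, hl'.2⟩
    rw [← sub_eq_zero]
    refine eq_zero_of_homogeneous_equation hd hg (op (shifted A β)) h3 ?_
      ((hQ'.homogeneous l hl).sub (hQ.homogeneous l hl)) fun k => ?_
    · refine lt_of_le_of_lt ?_ hT
      gcongr
      exact hl'.2
    · have e1 := hQ.equation l hl3 k
      have e2 := hQ'.equation l hl3 k
      have e3 : momentSource g M Q' l k = momentSource g M Q l k := by
        refine Finset.sum_congr rfl fun jm hjm => ?_
        rw [Finset.mem_filter, Finset.mem_product, Finset.mem_Icc, Finset.mem_Icc] at hjm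
        rw [ih jm.1 (by omega) (Finset.mem_Icc.2 (by omega)),
          ih jm.2 (by omega) (Finset.mem_Icc.2 (by omega))]
      have e4 : pval (Q' l - Q l) = fun k => pval (Q' l) k - pval (Q l) k :=
        funext (pval_sub _ _)
      rw [e4, linGain_sub hd hg (continuous_pval _) (continuous_pval _), drift_sub]
      change _ - _ + drift _ _ _ = _ at e1 e2
      linear_combination e2 - e1 + e3

end LinearizedGain

section SecondOrder

variable {d : ℕ} {g : ℝ → ℝ}

open Matrix

lemma op_apply (A : Matrix (Fin d) (Fin d) ℝ) (k : E d) (i : Fin d) :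
    (op A k) i = ∑ j, A i j * k j := rfl

lemma op_shifted_apply (A : Matrix (Fin d) (Fin d) ℝ) (β : ℝ) (k : E d) :
    op (shifted A β) k = op A k + β • k := by
  simp [op, shifted]

lemma norm_op_shifted_le (A : Matrix (Fin d) (Fin d) ℝ) (β : ℝ) :
    ‖op (shifted A β)‖ ≤ ‖op A‖ + |β| := by
  refine ContinuousLinearMap.opNorm_le_bound _ (by positivity) fun k => ?_
  rw [op_shifted_apply, add_mul]
  refine (norm_add_le _ _).trans (add_le_add ((op A).le_opNorm k) ?_)
  rw [norm_smul, Real.norm_eq_abs]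

lemma exists_factor {N : Matrix (Fin d) (Fin d) ℝ} (hN : N.PosDef) :
    ∃ c : Fin d → E d, ∀ i j, N i j = ∑ m, (c m) i * (c m) j := by
  open scoped MatrixOrder Matrix.Norms.L2Operator in
  obtain ⟨B, hB⟩ := CStarAlgebra.nonneg_iff_eq_star_mul_self.mp hN.posSemidef.nonneg
  refine ⟨fun m => WithLp.toLp 2 (B m), fun i j => ?_⟩
  rw [hB]
  simp [Matrix.mul_apply, Matrix.star_eq_conjTranspose]

lemma inner_eq_sum (x y : E d) : ⟪x, y⟫ = ∑ i, x i * y i := by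
  rw [PiLp.inner_apply]
  exact Finset.sum_congr rfl fun i _ => by simp [mul_comm]

lemma sum_factor {N : Matrix (Fin d) (Fin d) ℝ} {c : Fin d → E d}
    (hc : ∀ i j, N i j = ∑ m, (c m) i * (c m) j) (x y : E d) :
    ∑ i, ∑ j, N i j * x i * y j = ∑ m, ⟪c m, x⟫ * ⟪c m, y⟫ := by
  simp only [inner_eq_sum, Finset.sum_mul_sum]
  conv_rhs => rw [Finset.sum_comm]
  refine Finset.sum_congr rfl fun i _ => ?_
  rw [Finset.sum_comm]
  refine Finset.sum_congr rfl fun j _ => ?_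
  rw [hc, Finset.sum_mul, Finset.sum_mul]
  exact Finset.sum_congr rfl fun m _ => by ring

lemma trace_factor {N : Matrix (Fin d) (Fin d) ℝ} {c : Fin d → E d}
    (hc : ∀ i j, N i j = ∑ m, (c m) i * (c m) j) : N.trace = ∑ m, ‖c m‖ ^ 2 := by
  simp only [Matrix.trace, Matrix.diag_apply, hc]
  rw [Finset.sum_comm]
  refine Finset.sum_congr rfl fun m _ => ?_
  rw [← real_inner_self_eq_norm_sq, inner_eq_sum]

/-- The entries of the eigenvalue equation for a real matrix. -/
lemma eigLHS_entry {A N : Matrix (Fin d) (Fin d) ℝ} {β : ℝ}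
    (h : eigLHS g A (β : ℂ) (N.map Complex.ofReal) = 0) (i j : Fin d) :
    2 * β * N i j + (∑ l, N i l * A l j + ∑ l, N j l * A l i) +
      qConst d g * d / (2 * (d - 1)) * (N i j - N.trace / d * (if i = j then 1 else 0)) = 0 := by
  have h1 := congrFun (congrFun h i) j
  have ht : (N.map Complex.ofReal).trace = (N.trace : ℂ) := by
    simp [Matrix.trace]
  simp only [eigLHS, Matrix.add_apply, Matrix.smul_apply, Matrix.sub_apply, Matrix.map_apply,
    Matrix.transpose_apply, Matrix.mul_apply, Matrix.one_apply, smul_eq_mul, ht,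
    Matrix.zero_apply] at h1
  split_ifs with hij
  · rw [if_pos hij] at h1
    exact_mod_cast h1
  · rw [if_neg hij] at h1
    exact_mod_cast h1

lemma eigLHS_quadratic {A N : Matrix (Fin d) (Fin d) ℝ} {β : ℝ}
    (h : eigLHS g A (β : ℂ) (N.map Complex.ofReal) = 0) {c : Fin d → E d}
    (hc : ∀ i j, N i j = ∑ m, (c m) i * (c m) j) (k : E d) :
    ∑ m, ⟪c m, k⟫ * ⟪c m, op (shifted A β) k⟫ + qConst d g * d / (4 * (d - 1)) *
      (∑ m, ⟪c m, k⟫ ^ 2 - (∑ m, ‖c m‖ ^ 2) / d * ‖k‖ ^ 2) = 0 := by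
  have h1 : ∑ i, ∑ j, (2 * β * N i j + (∑ l, N i l * A l j + ∑ l, N j l * A l i) +
      qConst d g * d / (2 * (d - 1)) * (N i j - N.trace / d * (if i = j then 1 else 0))) *
        (k i * k j) = 0 :=
    Finset.sum_eq_zero fun i _ => Finset.sum_eq_zero fun j _ => by
      rw [eigLHS_entry h, zero_mul]
  have e1 : ∑ i, ∑ j, N i j * (k i * k j) = ∑ m, ⟪c m, k⟫ ^ 2 := by
    simp only [← mul_assoc, sum_factor hc, sq]
  have e2 : ∑ i, ∑ j, (∑ l, N i l * A l j) * (k i * k j) =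
      ∑ m, ⟪c m, k⟫ * ⟪c m, op A k⟫ := by
    rw [← sum_factor hc]
    refine Finset.sum_congr rfl fun i _ => ?_
    simp only [op_apply, Finset.sum_mul, Finset.mul_sum]
    rw [Finset.sum_comm]
    exact Finset.sum_congr rfl fun l _ => Finset.sum_congr rfl fun j _ => by ring
  have e3 : ∑ i, ∑ j, (∑ l, N j l * A l i) * (k i * k j) =
      ∑ m, ⟪c m, k⟫ * ⟪c m, op A k⟫ := by
    rw [← e2, Finset.sum_comm]
    exact Finset.sum_congr rfl fun l _ => Finset.sum_congr rfl fun j _ => by ring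
  have e4 : ∑ i, ∑ j, (if i = j then (1 : ℝ) else 0) * (k i * k j) = ‖k‖ ^ 2 := by
    rw [← real_inner_self_eq_norm_sq, inner_eq_sum]
    simp
  have e5 : ∑ m, ⟪c m, k⟫ * ⟪c m, op (shifted A β) k⟫ =
      ∑ m, ⟪c m, k⟫ * ⟪c m, op A k⟫ + β * ∑ m, ⟪c m, k⟫ ^ 2 := by
    rw [Finset.mul_sum, ← Finset.sum_add_distrib]
    refine Finset.sum_congr rfl fun m _ => ?_
    rw [op_shifted_apply, inner_add_right, inner_smul_right]
    ring
  have e6 : ∀ (n a b δ w : Fin d → Fin d → ℝ) (x y z : ℝ),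
      ∑ i, ∑ j, (x * n i j + (a i j + b i j) + y * (n i j - z * δ i j)) * w i j =
        x * ∑ i, ∑ j, n i j * w i j + (∑ i, ∑ j, a i j * w i j + ∑ i, ∑ j, b i j * w i j) +
          y * (∑ i, ∑ j, n i j * w i j - z * ∑ i, ∑ j, δ i j * w i j) := by
    intro n a b δ w x y z
    simp only [Finset.mul_sum, ← Finset.sum_add_distrib, ← Finset.sum_sub_distrib]
    exact Finset.sum_congr rfl fun i _ => Finset.sum_congr rfl fun j _ => by ring
  rw [e6 N (fun i j => ∑ l, N i l * A l j) (fun i j => ∑ l, N j l * A l i), e1, e2, e3, e4,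
    trace_factor hc] at h1
  rw [e5]
  have e7 : qConst d g * d / (4 * (d - 1)) = qConst d g * d / (2 * (d - 1)) / 2 := by
    rw [div_div]; ring_nf
  rw [e7]
  linarith

/-- Traces of the eigenvalue equation bound the leading eigenvalue. -/
lemma abs_le_of_eigLHS (hd : 2 ≤ d) {A N : Matrix (Fin d) (Fin d) ℝ} {β : ℝ} (hN : N.PosDef)
    (h : eigLHS g A (β : ℂ) (N.map Complex.ofReal) = 0) : |β| ≤ ‖op A‖ := by
  obtain ⟨c, hc⟩ := exists_factor hN
  have : NeZero d := ⟨by omega⟩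
  have htr : 0 < ∑ m, ‖c m‖ ^ 2 := by
    rw [← trace_factor hc]; exact hN.trace_pos
  have h1 : ∑ i, (2 * β * N i i + (∑ l, N i l * A l i + ∑ l, N i l * A l i) +
      qConst d g * d / (2 * (d - 1)) * (N i i - N.trace / d)) = 0 :=
    Finset.sum_eq_zero fun i _ => by
      have := eigLHS_entry h i i
      rwa [if_pos rfl, mul_one] at this
  have e1 : ∑ i, ∑ l, N i l * A l i = ∑ m, ⟪c m, op A (c m)⟫ := by
    simp only [inner_eq_sum, op_apply, hc, Finset.sum_mul, Finset.mul_sum]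
    rw [Finset.sum_comm]
    conv_rhs => rw [Finset.sum_comm]
    refine Finset.sum_congr rfl fun i _ => ?_
    conv_rhs => rw [Finset.sum_comm]
    exact Finset.sum_congr rfl fun j _ => Finset.sum_congr rfl fun m _ => by ring
  have e2 : ∑ i, N i i = N.trace := rfl
  have hd0 : (d : ℝ) ≠ 0 := by exact_mod_cast NeZero.ne d
  simp only [Finset.sum_add_distrib, ← Finset.mul_sum, Finset.sum_sub_distrib, e1, e2,
    Finset.sum_const, Finset.card_univ, Fintype.card_fin, nsmul_eq_mul] at h1
  have e3 : N.trace - d * (N.trace / d) = 0 := by field_simp; ring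
  rw [e3, mul_zero, add_zero, trace_factor hc] at h1
  have h2 : |∑ m, ⟪c m, op A (c m)⟫| ≤ ‖op A‖ * ∑ m, ‖c m‖ ^ 2 := by
    rw [Finset.mul_sum]
    refine (Finset.abs_sum_le_sum_abs _ _).trans (Finset.sum_le_sum fun m _ => ?_)
    calc _ ≤ ‖c m‖ * ‖op A (c m)‖ := abs_real_inner_le_norm _ _
      _ ≤ ‖c m‖ * (‖op A‖ * ‖c m‖) := by gcongr; exact (op A).le_opNorm _
      _ = _ := by ring
  have h3 : β * ∑ m, ‖c m‖ ^ 2 = -∑ m, ⟪c m, op A (c m)⟫ := by linarith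
  have h4 : |β| * ∑ m, ‖c m‖ ^ 2 ≤ ‖op A‖ * ∑ m, ‖c m‖ ^ 2 := by
    rw [← abs_of_pos htr, ← abs_mul, abs_of_pos htr, h3, abs_neg]
    exact h2
  exact le_of_mul_le_mul_right h4 htr

/-- The linearized gain operator on a quadratic form. -/
lemma linGain_quadratic (hd : 2 ≤ d) (hg : IsCollisionKernel d g) (c : Fin d → E d) (k : E d) :
    linGain g (fun k => ((-(1 / 2) * ∑ m, ⟪c m, k⟫ ^ 2 : ℝ) : ℂ)) k =
      ((-(1 / 4) * ((2 - qConst d g * d / (d - 1)) * ∑ m, ⟪c m, k⟫ ^ 2 +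
        qConst d g / (d - 1) * ((∑ m, ‖c m‖ ^ 2) * ‖k‖ ^ 2)) : ℝ) : ℂ) := by
  have hw := norm_dir hd k
  have := isProbabilityMeasure_scat hg hw
  have hd1 : (d : ℝ) - 1 ≠ 0 := by
    have : (2 : ℝ) ≤ d := by exact_mod_cast hd
    linarith
  rw [linGain_eq hd hg (by fun_prop)]
  have e : ∀ n : S d, ((-(1 / 2) * ∑ m, ⟪c m, kplus k n⟫ ^ 2 : ℝ) : ℂ) +
      ((-(1 / 2) * ∑ m, ⟪c m, kminus k n⟫ ^ 2 : ℝ) : ℂ) =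
      ((-(1 / 4) * ∑ m, (⟪c m, k⟫ ^ 2 + ‖k‖ ^ 2 * ⟪c m, (n : E d)⟫ ^ 2) : ℝ) : ℂ) := fun n => by
    rw [← Complex.ofReal_add, ← mul_add, ← Finset.sum_add_distrib, Finset.mul_sum, Finset.mul_sum]
    congr 1
    refine Finset.sum_congr rfl fun m _ => ?_
    simp only [kplus, kminus, inner_smul_right, inner_add_right, inner_sub_right]
    ring
  simp only [e]
  rw [integral_complex_ofReal, integral_const_mul, integral_finsetSum _ fun m _ =>
    integrable_scat hg hw (by fun_prop)]
  congr 2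
  rw [Finset.mul_sum, Finset.sum_mul, Finset.mul_sum, ← Finset.sum_add_distrib]
  refine Finset.sum_congr rfl fun m _ => ?_
  rw [integral_add (integrable_const _) (integrable_scat hg hw (by fun_prop)),
    integral_const_mul, integral_scat_inner_sq hd hg hw]
  have hk : ⟪c m, k⟫ = ‖k‖ * ⟪dir k, c m⟫ := by
    conv_lhs => rw [← norm_smul_dir k, inner_smul_right, real_inner_comm]
  simp only [integral_const, probReal_univ, one_smul]
  rw [hk]
  field_simp
  ring

/-- The eigenvalue problem is the moment equation of order two. -/
lemma second_order_equation (hd : 2 ≤ d) (hg : IsCollisionKernel d g)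
    {A N : Matrix (Fin d) (Fin d) ℝ} {β : ℝ}
    (h : eigLHS g A (β : ℂ) (N.map Complex.ofReal) = 0) {c : Fin d → E d}
    (hc : ∀ i j, N i j = ∑ m, (c m) i * (c m) j) {P : MvPolynomial (Fin d) ℂ}
    (hP : ∀ k, pval P k = ((-(1 / 2) * ∑ m, ⟪c m, k⟫ ^ 2 : ℝ) : ℂ)) (k : E d) :
    pval P k + drift (op (shifted A β)) P k = linGain g (pval P) k := by
  set T := op (shifted A β)
  have hd1 : (d : ℝ) - 1 ≠ 0 := by
    have : (2 : ℝ) ≤ d := by exact_mod_cast hd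
    linarith
  have hd0 : (d : ℝ) ≠ 0 := by
    have : (2 : ℝ) ≤ d := by exact_mod_cast hd
    linarith
  have hdr : drift T P k = ((-∑ m, ⟪c m, k⟫ * ⟪c m, T k⟫ : ℝ) : ℂ) := by
    have d0 : HasDerivAt (fun t : ℝ => k + t • T k) (T k) 0 := by
      simpa using ((hasDerivAt_id (0 : ℝ)).smul_const (T k)).const_add k
    have d1 := hasDerivAt_pval P d0
    simp only [hP, zero_smul, add_zero] at d1
    have d2 : HasDerivAt (fun t : ℝ => -(1 / 2) * ∑ m, ⟪c m, k + t • T k⟫ ^ 2)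
        (-(1 / 2) * ∑ m, 2 * ⟪c m, k⟫ * ⟪c m, T k⟫) 0 := by
      refine HasDerivAt.const_mul _ (HasDerivAt.fun_sum fun m _ => ?_)
      have : HasDerivAt (fun t : ℝ => ⟪c m, k + t • T k⟫) ⟪c m, T k⟫ 0 := by
        simpa using (hasDerivAt_const (0 : ℝ) (c m)).inner ℝ d0
      simpa using this.fun_pow 2
    have := d1.unique d2.ofReal_comp
    rw [drift, this]
    congr 1
    rw [Finset.mul_sum, ← Finset.sum_neg_distrib]
    exact Finset.sum_congr rfl fun m _ => by ring
  have hq := eigLHS_quadratic h hc k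
  have hPf : pval P = fun k => ((-(1 / 2) * ∑ m, ⟪c m, k⟫ ^ 2 : ℝ) : ℂ) := funext hP
  rw [hdr, hPf, linGain_quadratic hd hg, ← Complex.ofReal_add]
  congr 1
  field_simp at hq ⊢
  linarith

end SecondOrder

end

end MaxwellBoltzmann

namespace MaxwellBoltzmann

noncomputable section

open Set Filter Topology
open scoped ENNReal Pointwise

section Levy

variable {d : ℕ}

/-- Lévy's continuity theorem: a pointwise limit of characteristic functions that is continuous
at `0` is a characteristic function, and the measures converge weakly. -/
lemma exists_charFn_eq_of_tendsto (μ : ℕ → ProbabilityMeasure (E d)) {f : E d → ℂ}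
    (hf : ContinuousAt f 0)
    (h : ∀ k, Tendsto (fun n => charFn (μ n : Measure (E d)) k) atTop (𝓝 (f k))) :
    ∃ ν : ProbabilityMeasure (E d), charFn (ν : Measure (E d)) = f ∧ Tendsto μ atTop (𝓝 ν) := by
  have h' : ∀ k, Tendsto (fun n => charFun (μ n : Measure (E d)) k) atTop (𝓝 (f (-k))) := fun k => by
    have := h (-k)
    simp only [charFn_eq, neg_neg] at this
    exact this
  have hf' : ContinuousAt (fun k : E d => f (-k)) 0 :=
    ContinuousAt.comp (g := f) (by simpa using hf) continuous_neg.continuousAt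
  have htight := isTightMeasureSet_of_tendsto_charFun hf' h'
  have hcomp : IsCompact (closure (range μ)) := isCompact_closure_of_isTightMeasureSet (by
    convert htight using 1
    · rfl
    · exact (Set.range_comp (fun ν : ProbabilityMeasure (E d) => (ν : Measure (E d))) μ).symm)
  obtain ⟨ν, -, hν : Tendsto _ _ _⟩ := hcomp.ultrafilter_le_nhds ((hyperfilter ℕ).map μ)
    (.trans (by simp) (monotone_principal subset_closure))
  have hU : ((hyperfilter ℕ : Ultrafilter ℕ) : Filter ℕ) ≤ atTop := by
    rw [← Nat.cofinite_eq_atTop]; exact hyperfilter_le_cofinite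
  have hνf : ∀ k, charFun (ν : Measure (E d)) k = f (-k) := fun k => by
    refine tendsto_nhds_unique ?_ ((h' k).mono_left hU)
    have h1 := (ProbabilityMeasure.tendsto_iff_forall_integral_rclike_tendsto ℂ).1 hν
      (BoundedContinuousFunction.innerProbChar k)
    simp only [charFun_eq_integral_innerProbChar]
    exact h1
  refine ⟨ν, funext fun k => by rw [charFn_eq, hνf, neg_neg],
    ProbabilityMeasure.tendsto_of_tendsto_charFun fun k => ?_⟩
  rw [hνf]
  exact h' k

lemma MomBound.of_tendsto {μ : ℕ → ProbabilityMeasure (E d)} {ν : ProbabilityMeasure (E d)}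
    (h : Tendsto μ atTop (𝓝 ν)) {l : ℕ} {b : ℝ} (hb : ∀ n, MomBound (μ n : Measure (E d)) l b) :
    MomBound (ν : Measure (E d)) l b := fun k => by
  refine (lintegral_le_liminf_lintegral_of_forall_isOpen_measure_le_liminf_measure
    (μs := fun n => (μ n : Measure (E d))) (f := fun v : E d => |⟪k, v⟫| ^ l) (by fun_prop)
    (fun v => by positivity)
    fun G hG => ProbabilityMeasure.le_liminf_measure_open_of_tendsto h hG).trans ?_
  exact liminf_le_of_le (by isBoundedDefault) fun a ha => by
    obtain ⟨n, hn⟩ := ha.exists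
    exact hn.trans (hb n k)

end Levy

section Initial

variable {d : ℕ}

/-- The uniform distribution on the points `± √d c_m`. -/
def pairMeas (c : Fin d → E d) : Measure (E d) :=
  ENNReal.ofReal (1 / (2 * d)) • ∑ m, (Measure.dirac (√d • c m) + Measure.dirac (-(√d • c m)))

lemma isProbabilityMeasure_pairMeas (hd : 2 ≤ d) (c : Fin d → E d) :
    IsProbabilityMeasure (pairMeas c) := by
  constructor
  have h0 : (0 : ℝ) < d := by exact_mod_cast (by omega : 0 < d)
  simp only [pairMeas, Measure.smul_apply, Measure.finsetSum_apply, Measure.add_apply, measure_univ,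
    smul_eq_mul, Finset.sum_const, Finset.card_univ, Fintype.card_fin, nsmul_eq_mul]
  have : (d : ℝ≥0∞) * (1 + 1) = ENNReal.ofReal (2 * d) := by
    rw [ENNReal.ofReal_mul (by norm_num)]; simp [one_add_one_eq_two, mul_comm]
  rw [this, ← ENNReal.ofReal_mul (by positivity)]
  rw [one_div, inv_mul_cancel₀ (by positivity), ENNReal.ofReal_one]

lemma integrable_pairMeas {G : Type*} [NormedAddCommGroup G] (c : Fin d → E d) (f : E d → G) :
    Integrable f (pairMeas c) := by
  refine Integrable.smul_measure ?_ ENNReal.ofReal_ne_top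
  rw [integrable_finsetSum_measure]
  exact fun m _ => (integrable_dirac (by simp)).add_measure (integrable_dirac (by simp))

lemma integral_pairMeas (c : Fin d → E d) (f : E d → ℂ) :
    ∫ v, f v ∂pairMeas c = (1 / (2 * d) : ℝ) * ∑ m, (f (√d • c m) + f (-(√d • c m))) := by
  rw [pairMeas, integral_smul_measure, integral_finsetSum_measure fun m _ =>
    (integrable_dirac (by simp)).add_measure (integrable_dirac (by simp)),
    ENNReal.toReal_ofReal (by positivity), Complex.real_smul]
  congr 1
  refine Finset.sum_congr rfl fun m _ => ?_
  rw [integral_add_measure (integrable_dirac (by simp)) (integrable_dirac (by simp)),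
    integral_dirac, integral_dirac]

lemma cmom_one_pairMeas (c : Fin d → E d) (k : E d) : cmom (pairMeas c) 1 k = 0 := by
  rw [cmom, integral_pairMeas]
  simp

lemma cmom_two_pairMeas (hd : 2 ≤ d) (c : Fin d → E d) (k : E d) :
    cmom (pairMeas c) 2 k = ((-(1 / 2) * ∑ m, ⟪c m, k⟫ ^ 2 : ℝ) : ℂ) := by
  have h0 : (0 : ℝ) < d := by exact_mod_cast (by omega : 0 < d)
  have h0' : (d : ℂ) ≠ 0 := by exact_mod_cast h0.ne'
  have hs : ((√(d : ℝ) : ℝ) : ℂ) ^ 2 = d := by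
    rw [← Complex.ofReal_pow, Real.sq_sqrt h0.le]; simp
  rw [cmom, integral_pairMeas]
  push_cast
  rw [Finset.mul_sum, Finset.mul_sum]
  refine Finset.sum_congr rfl fun m _ => ?_
  rw [inner_neg_right, inner_smul_right, real_inner_comm]
  push_cast
  simp only [mul_pow, neg_sq, Complex.I_sq, mul_neg, neg_mul, hs, Nat.factorial]
  field_simp
  push_cast
  ring

end Initial

section Moments

variable {d : ℕ} {g : ℝ → ℝ}

/-- Centered probability measures with second moments `∑ m, ⟪c m, k⟫²` and finite absolute
moments up to order `R`. -/
structure HasCovariance (c : Fin d → E d) (R : ℕ) (μ : Measure (E d)) : Prop where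
  prob : IsProbabilityMeasure μ
  integrable : ∀ j ≤ R, Integrable (fun v => ‖v‖ ^ j) μ
  first : ∀ k, cmom μ 1 k = 0
  second : ∀ k, cmom μ 2 k = ((-(1 / 2) * ∑ m, ⟪c m, k⟫ ^ 2 : ℝ) : ℂ)

lemma hasCovariance_pairMeas (hd : 2 ≤ d) (c : Fin d → E d) (R : ℕ) :
    HasCovariance c R (pairMeas c) :=
  ⟨isProbabilityMeasure_pairMeas hd c, fun _ _ => integrable_pairMeas c _,
    cmom_one_pairMeas c, cmom_two_pairMeas hd c⟩

lemma HasCovariance.stepMeas (hd : 2 ≤ d) (hg : IsCollisionKernel d g)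
    {A N : Matrix (Fin d) (Fin d) ℝ} {β : ℝ}
    (h : eigLHS g A (β : ℂ) (N.map Complex.ofReal) = 0) {c : Fin d → E d}
    (hc : ∀ i j, N i j = ∑ m, (c m) i * (c m) j) {R : ℕ} (hR : 2 ≤ R)
    (hT : R * ‖op (shifted A β)‖ < 1) {μ : Measure (E d)} (hμ : HasCovariance c R μ) :
    HasCovariance c R (stepMeas g (op (shifted A β)) μ) := by
  set T := op (shifted A β)
  have := hμ.prob
  have := isProbabilityMeasure_gainMeas hd hg μ
  have hTj : ∀ j ≤ R, (j : ℝ) * ‖T‖ < 1 := fun j hj =>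
    (mul_le_mul_of_nonneg_right (by exact_mod_cast hj) (norm_nonneg T)).trans_lt hT
  have hG : ∀ j ≤ R, Integrable (fun v => ‖v‖ ^ j) (gainMeas g μ) := fun j hj =>
    integrable_norm_pow_gainMeas hd hg μ fun i hi => hμ.integrable i (hi.trans hj)
  have hn : ∀ j, 0 ≤ ∫ v, ‖v‖ ^ j ∂gainMeas g μ := fun j => integral_nonneg fun v => by positivity
  have hp := isProbabilityMeasure_stepMeas hd hg T μ
  refine ⟨hp, fun j hj => ?_, fun k => ?_, fun k => ?_⟩
  · exact (momBound_evolve T _ (hTj j hj) (hn j) (momBound_of_integrable (hG j hj))).integrable_norm_pow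
  · rw [MaxwellBoltzmann.stepMeas, cmom_evolve T _ (hTj 1 (by omega)) (hn 1)
      (momBound_of_integrable (hG 1 (by omega)))]
    have h0 : ∀ k, cmom (gainMeas g μ) 1 k = 0 := fun k => by
      rw [cmom_gainMeas hd hg μ 1 fun j hj => hμ.integrable j (hj.trans (by omega))]
      refine Finset.sum_eq_zero fun jm hjm => ?_
      rw [Finset.HasAntidiagonal.mem_antidiagonal] at hjm
      obtain ⟨j, m⟩ := jm
      obtain ⟨rfl, rfl⟩ | ⟨rfl, rfl⟩ : j = 0 ∧ m = 1 ∨ j = 1 ∧ m = 0 := by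
        simp only at hjm; omega
      · exact gain_congr_zero_right _ hμ.first k
      · exact gain_congr_zero_left _ hμ.first k
    simp [h0]
  · have hP : ∀ k, pval (momPoly μ 2) k = ((-(1 / 2) * ∑ m, ⟪c m, k⟫ ^ 2 : ℝ) : ℂ) := fun k => by
      rw [pval_momPoly (hμ.integrable 2 hR), hμ.second]
    have h2 : ∀ k, cmom (gainMeas g μ) 2 k = pval (momPoly μ 2) k + drift T (momPoly μ 2) k :=
      fun k => by
        rw [cmom_gainMeas_eq hd hg μ le_rfl le_rfl (fun j hj => hμ.integrable j (hj.trans hR))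
          hμ.first, second_order_equation hd hg h hc hP, momentSource, Finset.sum_eq_zero, add_zero]
        intro jm hjm
        simp only [Finset.mem_filter, Finset.mem_product, Finset.mem_Icc] at hjm
        omega
    obtain ⟨C, hC, hCb⟩ := exists_norm_pval_le (momPoly_isHomogeneous μ 2)
    rw [MaxwellBoltzmann.stepMeas, cmom_evolve T _ (hTj 2 hR) (hn 2)
      (momBound_of_integrable (hG 2 hR)), ← hP]
    simp only [h2]
    refine (pval_eq_integral_flow T (momPoly μ 2) (hTj 2 hR) (hn 2) hCb (fun k => ?_) k).symm
    rw [← h2]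
    exact (momBound_of_integrable (hG 2 hR)).norm_cmom_le (hn 2) k

lemma HasCovariance.momBound_two {c : Fin d → E d} {R : ℕ} (hR : 2 ≤ R) {μ : Measure (E d)}
    (h : HasCovariance c R μ) : MomBound μ 2 (∑ m, ‖c m‖ ^ 2) := fun k => by
  have h2 := (momBound_of_integrable (h.integrable 2 hR)).integrable k
  have h3 := h.second k
  have h4 : cmom μ 2 k = ((-(1 / 2) * ∫ v, |⟪k, v⟫| ^ 2 ∂μ : ℝ) : ℂ) := by
    rw [cmom, ← integral_const_mul, ← integral_complex_ofReal]
    refine integral_congr_ae (Eventually.of_forall fun v => ?_)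
    simp only [sq_abs, mul_pow, neg_sq, Complex.I_sq]
    push_cast
    simp [Nat.factorial]
    ring
  rw [h4] at h3
  have h5 : ∫ v, |⟪k, v⟫| ^ 2 ∂μ = ∑ m, ⟪c m, k⟫ ^ 2 := by
    have := Complex.ofReal_injective h3
    linarith
  rw [← ofReal_integral_eq_lintegral_ofReal h2 (Eventually.of_forall fun v => by positivity), h5,
    Finset.sum_mul]
  refine ENNReal.ofReal_le_ofReal (Finset.sum_le_sum fun m _ => ?_)
  rw [← mul_pow, ← sq_abs]
  exact pow_le_pow_left₀ (abs_nonneg _) (abs_real_inner_le_norm _ _) 2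

lemma MomBound.stepMeas (hd : 2 ≤ d) (hg : IsCollisionKernel d g) (T : E d →L[ℝ] E d)
    (μ : Measure (E d)) [IsProbabilityMeasure μ] {l : ℕ} (hl : 3 ≤ l)
    (hT : lam d g + l * ‖T‖ < 1) {B b : ℝ} (hB : 1 ≤ B) (hlow : ∀ j < l, MomBound μ j B)
    (hb : 2 ^ l * B ^ 2 / (1 - l * ‖T‖ - lam d g) ≤ b) (h : MomBound μ l b) :
    MomBound (MaxwellBoltzmann.stepMeas g T μ) l b := by
  have hlam := lam_nonneg hd hg
  have h1 : 0 < 1 - l * ‖T‖ - lam d g := by linarith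
  have h2 : 0 < 1 - l * ‖T‖ := by linarith
  have hb0 : 0 ≤ b := le_trans (by positivity) hb
  have := isProbabilityMeasure_gainMeas hd hg μ
  refine (momBound_evolve T (gainMeas g μ) (by linarith) (by positivity)
    (momBound_gainMeas hd hg μ (by omega) hB hb0 hlow h
      (integral_pow_kplus_add_le hd hg hl))).mono ?_
  rw [div_le_iff₀ h1] at hb
  rw [div_le_iff₀ h2]
  linarith

end Moments

end

end MaxwellBoltzmann

namespace MaxwellBoltzmann

noncomputable section

open Set Filter Topology
open scoped ENNReal Pointwise

section Existence

variable {d : ℕ} {g : ℝ → ℝ}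

lemma eq_zero_of_norm_add_mul_le {a b : ℂ} {K : ℝ} (h : ∀ t : ℝ, 0 < t → ‖a + t * b‖ ≤ K * t ^ 2) :
    a = 0 ∧ b = 0 := by
  have key : ∀ u : ℂ, (∃ w : ℂ, ∃ K : ℝ, ∀ t : ℝ, 0 < t → t ≤ 1 → ‖u + t * w‖ ≤ K * t) →
      u = 0 := by
    rintro u ⟨w, K, hu⟩
    have h1 : Tendsto (fun t : ℝ => ‖u + t * w‖) (𝓝[>] 0) (𝓝 ‖u + (0 : ℝ) * w‖) :=
      (Continuous.tendsto (by fun_prop) _).mono_left nhdsWithin_le_nhds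
    have h2 : Tendsto (fun t : ℝ => K * t) (𝓝[>] 0) (𝓝 (K * 0)) :=
      (Continuous.tendsto (by fun_prop) _).mono_left nhdsWithin_le_nhds
    have h3 := le_of_tendsto_of_tendsto h1 h2 (by
      filter_upwards [Ioc_mem_nhdsGT zero_lt_one] with t ht using hu t ht.1 ht.2)
    simpa using h3
  have ha : a = 0 := key a ⟨b, |K|, fun t ht ht1 => ?_⟩
  · refine ⟨ha, key b ⟨0, K, fun t ht _ => ?_⟩⟩
    have := h t ht
    rw [ha, zero_add, norm_mul, Complex.norm_real, Real.norm_of_nonneg ht.le] at this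
    rw [mul_zero, add_zero]
    refine le_of_mul_le_mul_left ?_ ht
    linarith
  · refine (h t ht).trans ?_
    have h1 : K * t ^ 2 ≤ |K| * t ^ 2 := mul_le_mul_of_nonneg_right (le_abs_self K) (by positivity)
    have h2 : t ^ 2 ≤ t := by nlinarith
    exact h1.trans (mul_le_mul_of_nonneg_left h2 (abs_nonneg K))

lemma cmom_smul (μ : Measure (E d)) (l : ℕ) (t : ℝ) (k : E d) :
    cmom μ l (t • k) = (t : ℂ) ^ l * cmom μ l k := by
  rw [cmom, cmom, ← integral_const_mul]
  refine integral_congr_ae (Eventually.of_forall fun v => ?_)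
  simp only [real_inner_smul_left]
  push_cast
  rw [mul_left_comm, mul_pow, mul_div_assoc]

lemma norm_charFn_sub_second_le (μ : Measure (E d)) [IsProbabilityMeasure μ]
    (hμ : ∀ j ≤ 3, Integrable (fun v => ‖v‖ ^ j) μ) :
    ∃ C, 0 ≤ C ∧ ∀ k, ‖charFn μ k - (1 + cmom μ 1 k + cmom μ 2 k)‖ ≤ C * ‖k‖ ^ (3 : ℝ) := by
  have h := norm_charFn_sub_le μ 2 (p := 3) (by norm_num) (by norm_num)
    (fun j hj => hμ j (by omega)) (by simpa using hμ 3 le_rfl)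
  simp only [Finset.sum_range_succ, Finset.sum_range_zero, zero_add, cmom_zero] at h
  exact ⟨_, mul_nonneg (by positivity) (integral_nonneg fun v => by positivity), h⟩

lemma HasCovariance.norm_charFn_sub_le {c : Fin d → E d} {R : ℕ} (hR : 3 ≤ R)
    {μ ν : Measure (E d)} (hμ : HasCovariance c R μ) (hν : HasCovariance c R ν) :
    ∃ C, 0 ≤ C ∧ ∀ k, ‖charFn μ k - charFn ν k‖ ≤ C * ‖k‖ ^ (3 : ℝ) := by
  have := hμ.prob
  have := hν.prob
  obtain ⟨C, hC, h⟩ := norm_charFn_sub_second_le μ fun j hj => hμ.integrable j (hj.trans hR)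
  obtain ⟨C', hC', h'⟩ := norm_charFn_sub_second_le ν fun j hj => hν.integrable j (hj.trans hR)
  refine ⟨C + C', by positivity, fun k => ?_⟩
  have h1 := h k
  have h2 := h' k
  rw [hμ.first, hμ.second] at h1
  rw [hν.first, hν.second] at h2
  calc _ = ‖(charFn μ k - (1 + 0 + ((-(1 / 2) * ∑ m, ⟪c m, k⟫ ^ 2 : ℝ) : ℂ))) -
        (charFn ν k - (1 + 0 + ((-(1 / 2) * ∑ m, ⟪c m, k⟫ ^ 2 : ℝ) : ℂ)))‖ := by congr 1; ring
    _ ≤ _ := (norm_sub_le _ _).trans (by rw [add_mul]; exact add_le_add h1 h2)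

lemma HasCovariance.of_norm_charFn_sub_le {c : Fin d → E d} {R : ℕ} (hR : 3 ≤ R)
    {μ ν : Measure (E d)} [IsProbabilityMeasure μ]
    (hμ : ∀ j ≤ R, Integrable (fun v => ‖v‖ ^ j) μ) (hν : HasCovariance c R ν) {K : ℝ}
    (h : ∀ k, ‖charFn μ k - charFn ν k‖ ≤ K * ‖k‖ ^ (3 : ℝ)) : HasCovariance c R μ := by
  have := hν.prob
  obtain ⟨C, hC, h1⟩ := norm_charFn_sub_second_le μ fun j hj => hμ j (hj.trans hR)
  obtain ⟨C', hC', h2⟩ := norm_charFn_sub_second_le ν fun j hj => hν.integrable j (hj.trans hR)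
  have key : ∀ k, cmom μ 1 k = 0 ∧ cmom μ 2 k - cmom ν 2 k = 0 := fun k => by
    refine eq_zero_of_norm_add_mul_le (K := (C + C' + K) * ‖k‖ ^ (3 : ℝ)) fun t ht => ?_
    have e1 := h1 (t • k)
    have e2 := h2 (t • k)
    have e3 := h (t • k)
    rw [hν.first] at e2
    have e4 : ‖cmom μ 1 (t • k) + (cmom μ 2 (t • k) - cmom ν 2 (t • k))‖ ≤
        (C + C' + K) * ‖t • k‖ ^ (3 : ℝ) := by
      calc _ = ‖(charFn μ (t • k) - charFn ν (t • k)) -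
            (charFn μ (t • k) - (1 + cmom μ 1 (t • k) + cmom μ 2 (t • k))) +
            (charFn ν (t • k) - (1 + 0 + cmom ν 2 (t • k)))‖ := by congr 1; ring
        _ ≤ _ := (norm_add_le _ _).trans (add_le_add_left (norm_sub_le _ _) _)
        _ ≤ _ := by linarith
    rw [cmom_smul, cmom_smul, cmom_smul, norm_smul, Real.norm_of_nonneg ht.le,
      Real.mul_rpow ht.le (norm_nonneg _)] at e4
    have e5 : ((t : ℂ) ^ 1 * cmom μ 1 k + ((t : ℂ) ^ 2 * cmom μ 2 k - (t : ℂ) ^ 2 * cmom ν 2 k)) =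
        t * (cmom μ 1 k + t * (cmom μ 2 k - cmom ν 2 k)) := by ring
    rw [e5, norm_mul, Complex.norm_real, Real.norm_of_nonneg ht.le] at e4
    refine le_of_mul_le_mul_left (e4.trans_eq ?_) ht
    rw [show (3 : ℝ) = ((3 : ℕ) : ℝ) by norm_num, Real.rpow_natCast, Real.rpow_natCast]
    ring
  exact ⟨inferInstance, hμ, fun k => (key k).1, fun k => by
    rw [← hν.second, ← sub_eq_zero]; exact (key k).2⟩

lemma exists_uniform_momBound (hd : 2 ≤ d) (hg : IsCollisionKernel d g) (T : E d →L[ℝ] E d)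
    {c : Fin d → E d} {R : ℕ} (hT : lam d g + R * ‖T‖ < 1) {μ : ℕ → Measure (E d)}
    (hμ : ∀ n, HasCovariance c R (μ n)) (hs : ∀ n, μ (n + 1) = stepMeas g T (μ n)) {l : ℕ}
    (hl : 2 ≤ l) (hlR : l ≤ R) : ∃ B, 1 ≤ B ∧ ∀ j ≤ l, ∀ n, MomBound (μ n) j B := by
  have := fun n => (hμ n).prob
  induction l, hl using Nat.le_induction with
  | base =>
    have hb : 0 ≤ ∑ m, ‖c m‖ ^ 2 := Finset.sum_nonneg fun m _ => by positivity
    refine ⟨1 + ∑ m, ‖c m‖ ^ 2, by linarith, fun j hj n => ?_⟩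
    have h2 := (hμ n).momBound_two hlR
    interval_cases j
    · exact (momBound_zero _).mono (by linarith)
    · exact h2.one_of_two hb
    · exact h2.mono (by linarith)
  | succ l hl ih =>
    obtain ⟨B, hB, h⟩ := ih (by omega)
    have hT' : lam d g + (l + 1 : ℕ) * ‖T‖ < 1 := by
      have : ((l + 1 : ℕ) : ℝ) * ‖T‖ ≤ R * ‖T‖ :=
        mul_le_mul_of_nonneg_right (by exact_mod_cast hlR) (norm_nonneg _)
      linarith
    set b := max (∫ v, ‖v‖ ^ (l + 1) ∂μ 0)
      (2 ^ (l + 1) * B ^ 2 / (1 - (l + 1 : ℕ) * ‖T‖ - lam d g))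
    have hb : ∀ n, MomBound (μ n) (l + 1) b := fun n => by
      induction n with
      | zero => exact (momBound_of_integrable ((hμ 0).integrable _ hlR)).mono (le_max_left _ _)
      | succ n ihn =>
        rw [hs]
        exact ihn.stepMeas hd hg T (μ n) (by omega) hT' hB (fun j hj => h j (by omega) n)
          (le_max_right _ _)
    refine ⟨max B b, hB.trans (le_max_left _ _), fun j hj n => ?_⟩
    rcases Nat.lt_or_ge l j with hj' | hj'
    · obtain rfl : j = l + 1 := by omega
      exact (hb n).mono (le_max_right _ _)
    · exact (h j hj' n).mono (le_max_left _ _)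

theorem exists_stationary (hd : 2 ≤ d) (hg : IsCollisionKernel d g)
    {A N : Matrix (Fin d) (Fin d) ℝ} {β : ℝ}
    (h : eigLHS g A (β : ℂ) (N.map Complex.ofReal) = 0) {c : Fin d → E d}
    (hc : ∀ i j, N i j = ∑ m, (c m) i * (c m) j) {R : ℕ} (hR : 3 ≤ R)
    (hT : lam d g + R * ‖op (shifted A β)‖ < 1) :
    ∃ μ, HasCovariance c R μ ∧ stepMeas g (op (shifted A β)) μ = μ := by
  set T := op (shifted A β)
  have hlam := lam_nonneg hd hg
  have hR1 : R * ‖T‖ < 1 := by linarith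
  have hT3 : (3 : ℝ) * ‖T‖ ≤ R * ‖T‖ :=
    mul_le_mul_of_nonneg_right (by exact_mod_cast hR) (norm_nonneg _)
  have hT3' : 0 < 1 - 3 * ‖T‖ := by linarith
  let μ : ℕ → Measure (E d) := fun n => (stepMeas g T)^[n] (pairMeas c)
  have hs : ∀ n, μ (n + 1) = stepMeas g T (μ n) := fun n => Function.iterate_succ_apply' _ _ _
  have hμ : ∀ n, HasCovariance c R (μ n) := fun n => by
    induction n with
    | zero => exact hasCovariance_pairMeas hd c R
    | succ n ih => rw [hs]; exact ih.stepMeas hd hg h hc (by omega) hR1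
  have hprob := fun n => (hμ n).prob
  obtain ⟨B, hB, hBm⟩ := exists_uniform_momBound hd hg T hT hμ hs (l := R) (by omega) le_rfl
  set θ := lam d g / (1 - 3 * ‖T‖) with hθ
  have hθ0 : 0 ≤ θ := by positivity
  have hθ1 : θ < 1 := (div_lt_one hT3').2 (by linarith)
  obtain ⟨D, hD, hD0⟩ := (hμ 0).norm_charFn_sub_le hR (hμ 1)
  have hstep : ∀ n k, dist (charFn (μ n) k) (charFn (μ (n + 1)) k) ≤
      D * ‖k‖ ^ (3 : ℝ) * θ ^ n := fun n => by
    suffices ∀ k, ‖charFn (μ n) k - charFn (μ (n + 1)) k‖ ≤ θ ^ n * D * ‖k‖ ^ (3 : ℝ) by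
      intro k
      rw [dist_eq_norm]
      exact (this k).trans_eq (by ring)
    induction n with
    | zero => simpa using hD0
    | succ n ih =>
      intro k
      have := norm_charFn_stepMeas_sub_le hd hg T (p := 3) le_rfl (by linarith) (μ n) (μ (n + 1))
        (by positivity) ih k
      rw [← hs, ← hs] at this
      refine this.trans_eq ?_
      rw [hθ]
      ring
  have hlim : ∀ k, ∃ z, Tendsto (fun n => charFn (μ n) k) atTop (𝓝 z) := fun k =>
    cauchySeq_tendsto_of_complete (cauchySeq_of_le_geometric _ _ hθ1 fun n => hstep n k)
  choose f hf using hlim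
  have hdist : ∀ n k, ‖charFn (μ n) k - f k‖ ≤ D * θ ^ n / (1 - θ) * ‖k‖ ^ (3 : ℝ) := fun n k => by
    rw [← dist_eq_norm]
    refine (dist_le_of_le_geometric_of_tendsto _ _ hθ1 (fun n => hstep n k) (hf k) n).trans_eq ?_
    ring
  have hfc : ContinuousAt f 0 := by
    have h1 : Tendsto (fun k : E d => charFn (μ 0) k - f k) (𝓝 0) (𝓝 0) := by
      refine squeeze_zero_norm (hdist 0) ?_
      have : Continuous fun k : E d => D * θ ^ 0 / (1 - θ) * ‖k‖ ^ (3 : ℝ) :=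
        continuous_const.mul (continuous_norm.rpow_const fun _ => Or.inr (by norm_num))
      simpa using this.tendsto 0
    have h0 : charFn (μ 0) 0 = f 0 := by
      have := hdist 0 0
      rw [norm_zero, Real.zero_rpow (by norm_num), mul_zero] at this
      exact sub_eq_zero.1 (norm_le_zero_iff.1 this)
    have h2 := ((continuous_charFn (μ 0)).tendsto 0).sub h1
    simp only [sub_sub_cancel, sub_zero, h0] at h2
    exact h2
  obtain ⟨ν, hνf, hν⟩ := exists_charFn_eq_of_tendsto (fun n => ⟨μ n, hprob n⟩) hfc hf
  have hνi : ∀ j ≤ R, Integrable (fun v => ‖v‖ ^ j) (ν : Measure (E d)) := fun j hj =>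
    (MomBound.of_tendsto hν fun n => hBm j hj n).integrable_norm_pow
  refine ⟨ν, (hμ 0).of_norm_charFn_sub_le hR hνi (K := D * θ ^ 0 / (1 - θ)) fun k => ?_, ?_⟩
  · rw [hνf, norm_sub_rev]
    exact hdist 0 k
  · have := isProbabilityMeasure_stepMeas hd hg T (ν : Measure (E d))
    refine measure_ext_of_charFn (funext fun k => ?_)
    rw [hνf]
    refine tendsto_nhds_unique (tendsto_iff_norm_sub_tendsto_zero.2 ?_)
      ((tendsto_add_atTop_iff_nat 1).2 (hf k))
    have hC : ∀ n, 0 ≤ D * θ ^ n / (1 - θ) := fun n =>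
      div_nonneg (by positivity) (by linarith)
    refine squeeze_zero (fun _ => norm_nonneg _) (fun n => ?_)
      (g := fun n : ℕ => θ * (D * θ ^ n / (1 - θ)) * ‖k‖ ^ (3 : ℝ)) ?_
    · rw [hs]
      refine norm_charFn_stepMeas_sub_le hd hg T (p := 3) le_rfl (by linarith) (μ n)
        (ν : Measure (E d)) (hC n) (fun k => ?_) k
      rw [hνf]
      exact hdist n k
    · have h1 := tendsto_pow_atTop_nhds_zero_of_lt_one hθ0 hθ1
      have h2 := (((h1.const_mul D).div_const (1 - θ)).const_mul θ).mul_const (‖k‖ ^ (3 : ℝ))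
      simpa using h2

end Existence

end

end MaxwellBoltzmann

namespace MaxwellBoltzmann

noncomputable section

open Set Filter Topology
open scoped ENNReal Pointwise

section Profile

variable {d : ℕ} {g : ℝ → ℝ}

lemma isMomentFamily_momPoly (hd : 2 ≤ d) (hg : IsCollisionKernel d g)
    {A N : Matrix (Fin d) (Fin d) ℝ} {β : ℝ} {c : Fin d → E d}
    (hc : ∀ i j, N i j = ∑ m, (c m) i * (c m) j) {M R : ℕ} (hR : 2 ≤ R) (hMR : M ≤ R)
    (hT : R * ‖op (shifted A β)‖ < 1) {μ : Measure (E d)} (hμ : HasCovariance c R μ)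
    (hstat : stepMeas g (op (shifted A β)) μ = μ) :
    IsMomentFamily g A β N M (momPoly μ) := by
  have := hμ.prob
  refine ⟨fun l _ => momPoly_isHomogeneous μ l, fun k => ?_, fun l hl k => ?_⟩
  · have h1 := sum_factor hc k k
    have h2 : ∑ i, ∑ j, (N i j : ℂ) * (k i : ℂ) * (k j : ℂ) =
        ((∑ i, ∑ j, N i j * k i * k j : ℝ) : ℂ) := by push_cast; rfl
    rw [pval_momPoly (hμ.integrable 2 hR), hμ.second, h2, h1]
    push_cast
    simp only [sq]
  · have hl' := Finset.mem_Icc.1 hl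
    have hTl : l * ‖op (shifted A β)‖ < 1 :=
      (mul_le_mul_of_nonneg_right (by exact_mod_cast hl'.2.trans hMR)
        (norm_nonneg _)).trans_lt hT
    have h := momPoly_equation hd hg (op (shifted A β)) μ hstat (l := l) (M := M) (by omega) hl'.2
      hTl (fun j hj => hμ.integrable j (by omega)) hμ.first k
    have h' : driftPoly A β (momPoly μ l) k = drift (op (shifted A β)) (momPoly μ l) k := rfl
    rw [h', sub_add_eq_add_sub, h]
    ring

lemma charFn_mem_F {c : Fin d → E d} {M : ℕ} (hM : 2 ≤ M) {μ : Measure (E d)}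
    (hμ : HasCovariance c (M + 1) μ) {p : ℝ} (hp : (M : ℝ) ≤ p) (hp1 : p ≤ M + 1) :
    charFn μ ∈ F p M (momPoly μ) := by
  have := hμ.prob
  have hp0 : 0 ≤ p := (Nat.cast_nonneg M).trans hp
  refine ⟨⟨μ, hμ.prob, rfl⟩, (M + 2) * ∫ v, ‖v‖ ^ p ∂μ, fun k => ?_⟩
  have hi : Integrable (fun v => ‖v‖ ^ p) μ := by
    refine ((integrable_const (1 : ℝ)).add (hμ.integrable (M + 1) le_rfl)).mono'
      (continuous_norm.rpow_const fun _ => Or.inr hp0).aestronglyMeasurable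
      (Eventually.of_forall fun v => ?_)
    rw [Real.norm_of_nonneg (by positivity)]
    show ‖v‖ ^ p ≤ 1 + ‖v‖ ^ (M + 1)
    rcases le_total ‖v‖ 1 with h | h
    · have := Real.rpow_le_one (norm_nonneg v) h hp0
      have : 0 ≤ ‖v‖ ^ (M + 1) := by positivity
      linarith
    · have := Real.rpow_le_rpow_of_exponent_le h (y := p) (z := (M + 1 : ℕ))
        (by push_cast; exact hp1)
      rw [Real.rpow_natCast] at this
      linarith
  have h := norm_charFn_sub_le μ M hp hp1 (fun j hj => hμ.integrable j (by omega)) hi k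
  have hsum : ∑ l ∈ Finset.range (M + 1), cmom μ l k =
      1 + ∑ l ∈ Finset.Icc 2 M, pval (momPoly μ l) k := by
    rw [Finset.range_eq_Ico, Finset.sum_eq_sum_Ico_succ_bot (by omega),
      Finset.sum_eq_sum_Ico_succ_bot (by omega), cmom_zero, hμ.first, zero_add]
    congr 1
    refine Finset.sum_congr rfl fun l hl => (pval_momPoly (hμ.integrable l ?_) k).symm
    have := Finset.mem_Ico.1 hl
    omega
  rwa [hsum] at h

lemma charFn_eq_of_mem_F (hd : 2 ≤ d) (hg : IsCollisionKernel d g) (T : E d →L[ℝ] E d) {p : ℝ}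
    (hp : 3 ≤ p) (hT : lam d g + p * ‖T‖ < 1) {M : ℕ} {Q : ℕ → MvPolynomial (Fin d) ℂ}
    {μ ν : Measure (E d)} [IsProbabilityMeasure μ] [IsProbabilityMeasure ν]
    (hμ : charFn μ ∈ F p M Q) (hν : charFn ν ∈ F p M Q) (hμs : stepMeas g T μ = μ)
    (hνs : stepMeas g T ν = ν) : charFn μ = charFn ν := by
  obtain ⟨-, C, hC⟩ := hμ
  obtain ⟨-, C', hC'⟩ := hν
  have hlam := lam_nonneg hd hg
  have hp1 : 0 < 1 - p * ‖T‖ := by linarith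
  have h0 : ∀ k, ‖charFn μ k - charFn ν k‖ ≤ (|C| + |C'|) * ‖k‖ ^ p := fun k => by
    have hk : 0 ≤ ‖k‖ ^ p := by positivity
    have h1 := (hC k).trans (mul_le_mul_of_nonneg_right (le_abs_self C) hk)
    have h2 := (hC' k).trans (mul_le_mul_of_nonneg_right (le_abs_self C') hk)
    calc _ = ‖(charFn μ k - (1 + ∑ l ∈ Finset.Icc 2 M, pval (Q l) k)) -
          (charFn ν k - (1 + ∑ l ∈ Finset.Icc 2 M, pval (Q l) k))‖ := by congr 1; ring
      _ ≤ _ := (norm_sub_le _ _).trans (by rw [add_mul]; exact add_le_add h1 h2)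
  refine funext fun k => sub_eq_zero.1 ?_
  refine eq_zero_of_bound_contracts (u := fun k => charFn μ k - charFn ν k) (p := p)
    (θ := lam d g / (1 - p * ‖T‖)) (by positivity) ((div_lt_one hp1).2 (by linarith))
    ⟨|C| + |C'|, by positivity, h0⟩ (fun K hK h k => ?_) k
  have := norm_charFn_stepMeas_sub_le hd hg T hp (by linarith) μ ν hK h k
  rwa [hμs, hνs] at this

theorem stationary_profile (hd : 2 ≤ d) (hg : IsCollisionKernel d g) {M : ℕ} (hM : 3 ≤ M)
    {A N : Matrix (Fin d) (Fin d) ℝ} {β : ℝ} (hN : N.PosDef)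
    (heig : eigLHS g A (β : ℂ) (N.map Complex.ofReal) = 0)
    (hT : lam d g + (M + 1) * ‖op (shifted A β)‖ < 1) :
    ∃ Q : ℕ → MvPolynomial (Fin d) ℂ, IsMomentFamily g A β N M Q ∧
      (∀ Q' : ℕ → MvPolynomial (Fin d) ℂ, IsMomentFamily g A β N M Q' →
        ∀ l ∈ Finset.Icc 2 M, Q' l = Q l) ∧
      ∀ p : ℝ, (M : ℝ) < p → p ≤ (M : ℝ) + 1 →
        (F p M Q).Nonempty ∧ (∃! Ψ : E d → ℂ, Ψ ∈ F p M Q ∧ IsStationary g A β Ψ) ∧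
        (∀ μ : Measure (E d), IsProbabilityMeasure μ → charFn μ ∈ F p M Q →
          IsStationary g A β (charFn μ) →
          ∀ m : ℕ, m ≤ M → Integrable (fun v => ‖v‖ ^ m) μ) := by
  have hlam := lam_nonneg hd hg
  have hn := norm_nonneg (op (shifted A β))
  have hTp : ∀ {p : ℝ}, p ≤ M + 1 → lam d g + p * ‖op (shifted A β)‖ < 1 := fun hp => by
    have := mul_le_mul_of_nonneg_right hp hn
    linarith
  obtain ⟨c, hc⟩ := exists_factor hN
  obtain ⟨μ, hμ, hstat⟩ := exists_stationary hd hg heig hc (R := M + 1) (by omega)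
    (hTp (by push_cast; exact le_rfl))
  have hprob := hμ.prob
  have hfam : IsMomentFamily g A β N M (momPoly μ) :=
    isMomentFamily_momPoly hd hg hc (R := M + 1) (by omega) (by omega)
      (by have := hTp (p := (M + 1 : ℕ)) (by push_cast; exact le_rfl); linarith) hμ hstat
  refine ⟨momPoly μ, hfam, fun Q' hQ' => momentFamily_unique hd hg (hTp (by linarith)) hfam hQ',
    fun p hp hp1 => ?_⟩
  have hF := charFn_mem_F (by omega) hμ hp.le hp1
  have hM' : (3 : ℝ) ≤ M := by exact_mod_cast hM
  have huniq : ∀ ν : Measure (E d), IsProbabilityMeasure ν → charFn ν ∈ F p M (momPoly μ) →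
      IsStationary g A β (charFn ν) → charFn ν = charFn μ := fun ν hν hνF hνs =>
    charFn_eq_of_mem_F hd hg _ (by linarith) (hTp hp1) hνF hF
      ((isStationary_iff hd hg A β ν).1 hνs) hstat
  refine ⟨⟨_, hF⟩, ⟨charFn μ, ⟨hF, (isStationary_iff hd hg A β μ).2 hstat⟩, ?_⟩, ?_⟩
  · rintro Ψ ⟨hΨ, hΨs⟩
    obtain ⟨ν, hν, rfl⟩ := hΨ.1
    exact huniq ν hν hΨ hΨs
  · intro ν hν hνF hνs m hm
    rw [measure_ext_of_charFn (huniq ν hν hνF hνs)]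
    exact hμ.integrable m (by omega)

end Profile

end

end MaxwellBoltzmann

namespace MaxwellBoltzmann

noncomputable section

open Set Filter Topology
open scoped ENNReal Pointwise

section Matrices

open scoped Matrix Matrix.Norms.L2Operator

variable {d : ℕ}

lemma norm_entry_le_l2OpNorm {𝕜 : Type*} [RCLike 𝕜] (Z : Matrix (Fin d) (Fin d) 𝕜) (i j : Fin d) :
    ‖Z i j‖ ≤ ‖Z‖ := by
  have h1 := (Matrix.toEuclideanCLM (n := Fin d) (𝕜 := 𝕜) Z).le_opNorm (EuclideanSpace.single j 1)
  have h2 := PiLp.norm_apply_le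
    (Matrix.toEuclideanCLM (n := Fin d) (𝕜 := 𝕜) Z (EuclideanSpace.single j 1)) i
  have h3 : (Matrix.toEuclideanCLM (n := Fin d) (𝕜 := 𝕜) Z (EuclideanSpace.single j 1)) i =
      Z i j := by
    simp [Matrix.ofLp_toEuclideanCLM]
  rw [h3] at h2
  rw [PiLp.norm_single, norm_one, mul_one] at h1
  exact h2.trans h1

lemma norm_trace_le {𝕜 : Type*} [RCLike 𝕜] (Z : Matrix (Fin d) (Fin d) 𝕜) :
    ‖Z.trace‖ ≤ d * ‖Z‖ := by
  refine (norm_sum_le_of_le _ fun i _ => norm_entry_le_l2OpNorm Z i i).trans_eq ?_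
  simp

lemma exists_norm_map_ofReal_le (d : ℕ) : ∃ K, 0 ≤ K ∧ ∀ Z : Matrix (Fin d) (Fin d) ℝ,
    ‖Z.map Complex.ofReal‖ ≤ K * ‖Z‖ := by
  refine ⟨∑ i : Fin d, ∑ j : Fin d, ‖Matrix.single i j (1 : ℂ)‖,
    Finset.sum_nonneg fun i _ => Finset.sum_nonneg fun j _ => norm_nonneg _, fun Z => ?_⟩
  rw [Matrix.matrix_eq_sum_single (Z.map Complex.ofReal), Finset.sum_mul]
  refine norm_sum_le_of_le _ fun i _ => ?_
  rw [Finset.sum_mul]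
  refine norm_sum_le_of_le _ fun j _ => ?_
  have h1 : Matrix.single i j (Z.map Complex.ofReal i j) =
      (Z i j : ℂ) • Matrix.single i j (1 : ℂ) := by simp
  rw [h1, norm_smul, mul_comm, Complex.norm_real]
  exact mul_le_mul_of_nonneg_left (norm_entry_le_l2OpNorm Z i j) (norm_nonneg _)

lemma norm_transpose_real (A : Matrix (Fin d) (Fin d) ℝ) : ‖Aᵀ‖ = ‖A‖ := by
  rw [← Matrix.conjTranspose_eq_transpose_of_trivial, Matrix.l2_opNorm_conjTranspose]

lemma posDef_one_add {X : Matrix (Fin d) (Fin d) ℝ} (hs : X.IsSymm) (hX : ‖X‖ < 1) :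
    (1 + X).PosDef := by
  rw [Matrix.posDef_iff_dotProduct_mulVec]
  refine ⟨?_, fun x hx => ?_⟩
  · rw [Matrix.IsHermitian, Matrix.conjTranspose_eq_transpose_of_trivial, Matrix.transpose_add,
      Matrix.transpose_one, hs.eq]
  · set v : E d := WithLp.toLp 2 x
    have hv : 0 < ‖v‖ := by
      rw [norm_pos_iff]
      intro h
      exact hx (by simpa [v] using congrArg WithLp.ofLp h)
    have h1 := abs_real_inner_le_norm v (op X v)
    have h2 : ‖op X v‖ ≤ ‖X‖ * ‖v‖ := (op X).le_opNorm v
    have h3 : star x ⬝ᵥ ((1 + X) *ᵥ x) = ‖v‖ ^ 2 + ⟪v, op X v⟫ := by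
      rw [Matrix.add_mulVec, Matrix.one_mulVec, dotProduct_add, ← real_inner_self_eq_norm_sq,
        inner_eq_sum, inner_eq_sum]
      rfl
    rw [h3]
    have h4 := neg_abs_le ⟪v, op X v⟫
    nlinarith [mul_le_mul_of_nonneg_left h2 hv.le, mul_pos hv hv]

end Matrices

section FixedPoint

open scoped Matrix Matrix.Norms.L2Operator

variable {d : ℕ}

/-- The constant `q d / (2 (d - 1))`. -/
def relax (d : ℕ) (g : ℝ → ℝ) : ℝ := qConst d g * d / (2 * (d - 1))

lemma relax_pos {g : ℝ → ℝ} (hd : 2 ≤ d) (hg : IsCollisionKernel d g) : 0 < relax d g := by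
  have h1 := qConst_pos hd hg
  have h2 : (2 : ℝ) ≤ d := by exact_mod_cast hd
  have h3 : (0 : ℝ) < d - 1 := by linarith
  have h4 : (0 : ℝ) < d := by linarith
  rw [relax]
  positivity

/-- `Y(B) = B A + Aᵀ B`. -/
def symMul (A B : Matrix (Fin d) (Fin d) ℝ) : Matrix (Fin d) (Fin d) ℝ := B * A + Aᵀ * B

lemma norm_symMul_le (A B : Matrix (Fin d) (Fin d) ℝ) : ‖symMul A B‖ ≤ 2 * ‖A‖ * ‖B‖ := by
  refine (norm_add_le _ _).trans ?_
  have h1 := norm_mul_le B A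
  have h2 := norm_mul_le Aᵀ B
  rw [norm_transpose_real] at h2
  linarith

lemma symMul_sub (A B C : Matrix (Fin d) (Fin d) ℝ) :
    symMul A (B - C) = symMul A B - symMul A C := by
  simp only [symMul, sub_mul, mul_sub]
  abel

/-- `(Tr Y(B) / d) B - Y(B)`. -/
def relaxMap (A B : Matrix (Fin d) (Fin d) ℝ) : Matrix (Fin d) (Fin d) ℝ :=
  ((symMul A B).trace / d) • B - symMul A B

lemma abs_trace_div_le (hd : 2 ≤ d) (Z : Matrix (Fin d) (Fin d) ℝ) : |Z.trace / d| ≤ ‖Z‖ := by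
  have h2 : (0 : ℝ) < d := by exact_mod_cast (by omega : 0 < d)
  rw [abs_div, abs_of_pos h2, div_le_iff₀ h2, mul_comm]
  exact norm_trace_le Z

lemma norm_relaxMap_le (hd : 2 ≤ d) {A B : Matrix (Fin d) (Fin d) ℝ} (hB : ‖B‖ ≤ 3 / 2) :
    ‖relaxMap A B‖ ≤ 8 * ‖A‖ := by
  have h1 := norm_symMul_le A B
  have h2 := abs_trace_div_le hd (symMul A B)
  have ha := norm_nonneg A
  have h3 : ‖symMul A B‖ ≤ 3 * ‖A‖ := by nlinarith
  refine (norm_sub_le _ _).trans ?_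
  rw [norm_smul, Real.norm_eq_abs]
  nlinarith [norm_nonneg B, abs_nonneg ((symMul A B).trace / d)]

lemma norm_relaxMap_sub_le (hd : 2 ≤ d) {A B C : Matrix (Fin d) (Fin d) ℝ} (hB : ‖B‖ ≤ 3 / 2)
    (hC : ‖C‖ ≤ 3 / 2) : ‖relaxMap A B - relaxMap A C‖ ≤ 8 * ‖A‖ * ‖B - C‖ := by
  have h1 := norm_symMul_le A (B - C)
  have h2 := norm_symMul_le A C
  have h3 := abs_trace_div_le hd (symMul A (B - C))
  have h4 := abs_trace_div_le hd (symMul A C)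
  have ha := norm_nonneg A
  have hδ := norm_nonneg (B - C)
  have e : relaxMap A B - relaxMap A C = ((symMul A (B - C)).trace / d) • B +
      ((symMul A C).trace / d) • (B - C) - symMul A (B - C) := by
    rw [relaxMap, relaxMap, symMul_sub, Matrix.trace_sub]
    module
  rw [e]
  refine (norm_sub_le _ _).trans ((add_le_add_left (norm_add_le _ _) _).trans ?_)
  rw [norm_smul, norm_smul, Real.norm_eq_abs, Real.norm_eq_abs]
  have h5 : |(symMul A (B - C)).trace / d| * ‖B‖ ≤ (2 * ‖A‖ * ‖B - C‖) * (3 / 2) :=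
    mul_le_mul (h3.trans h1) hB (norm_nonneg _) (by positivity)
  have h6 : |(symMul A C).trace / d| * ‖B - C‖ ≤ (2 * ‖A‖ * (3 / 2)) * ‖B - C‖ :=
    mul_le_mul_of_nonneg_right ((h4.trans h2).trans
      (mul_le_mul_of_nonneg_left hC (by positivity))) hδ
  linarith

/-- Existence of a normalized positive definite eigenvector for small `A`. -/
lemma exists_relax_eigenvector (hd : 2 ≤ d) {κ : ℝ} (hκ : 0 < κ) {A : Matrix (Fin d) (Fin d) ℝ}
    (hA : ‖A‖ ≤ κ / 32) : ∃ X : Matrix (Fin d) (Fin d) ℝ, X.IsSymm ∧ X.trace = 0 ∧ ‖X‖ ≤ 1 / 2 ∧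
      κ • X = relaxMap A (1 + X) := by
  have hd0 : (d : ℝ) ≠ 0 := by exact_mod_cast (by omega : d ≠ 0)
  set s : Set (Matrix (Fin d) (Fin d) ℝ) := {X | Xᵀ = X ∧ X.trace = 0 ∧ ‖X‖ ≤ 1 / 2}
  have hsc : IsClosed s := by
    refine IsClosed.inter (isClosed_eq (by fun_prop) continuous_id) (IsClosed.inter
      (isClosed_eq (by fun_prop) continuous_const) (isClosed_le continuous_norm continuous_const))
  have hone : ‖(1 : Matrix (Fin d) (Fin d) ℝ)‖ ≤ 1 := by
    rw [Matrix.cstar_norm_def, map_one]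
    exact ContinuousLinearMap.norm_id_le
  have hball : ∀ X ∈ s, ‖1 + X‖ ≤ 3 / 2 := fun X hX =>
    (norm_add_le _ _).trans (by linarith [hX.2.2])
  set G : Matrix (Fin d) (Fin d) ℝ → Matrix (Fin d) (Fin d) ℝ := fun X => κ⁻¹ • relaxMap A (1 + X)
  have hmaps : MapsTo G s s := fun X hX => by
    have hsymm : (1 + X)ᵀ = 1 + X := by
      rw [Matrix.transpose_add, Matrix.transpose_one, hX.1]
    refine ⟨?_, ?_, ?_⟩
    · have h1 : (symMul A (1 + X))ᵀ = symMul A (1 + X) := by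
        rw [symMul, Matrix.transpose_add, Matrix.transpose_mul, Matrix.transpose_mul,
          Matrix.transpose_transpose, hsymm, add_comm]
      simp only [G, relaxMap, Matrix.transpose_smul, Matrix.transpose_sub, h1, hsymm]
    · simp only [G, relaxMap, Matrix.trace_smul, Matrix.trace_sub, Matrix.trace_add,
        Matrix.trace_one, hX.2.1, Fintype.card_fin, add_zero, smul_eq_mul]
      field_simp
      simp
    · have := norm_relaxMap_le hd (A := A) (hball X hX)
      simp only [G]
      rw [norm_smul, norm_inv, Real.norm_of_nonneg hκ.le, inv_mul_le_iff₀ hκ]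
      linarith
  have hcontr : ContractingWith (1 / 2) (hmaps.restrict G s s) := by
    refine ⟨by norm_num, LipschitzWith.of_dist_le_mul fun X Y => ?_⟩
    have := norm_relaxMap_sub_le hd (A := A) (hball X X.2) (hball Y Y.2)
    rw [Subtype.dist_eq, Subtype.dist_eq]
    simp only [MapsTo.val_restrict_apply, G]
    rw [dist_eq_norm, dist_eq_norm, ← smul_sub, norm_smul, norm_inv, Real.norm_of_nonneg hκ.le,
      inv_mul_le_iff₀ hκ]
    refine this.trans ?_
    rw [add_sub_add_left_eq_sub]
    have h0 := norm_nonneg ((X : Matrix (Fin d) (Fin d) ℝ) - Y)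
    push_cast
    nlinarith
  have h0 : (0 : Matrix (Fin d) (Fin d) ℝ) ∈ s := ⟨by simp, by simp, by simp⟩
  obtain ⟨X, hX, hfix, -⟩ := ContractingWith.exists_fixedPoint' hsc.isComplete hmaps hcontr h0
    (edist_ne_top _ _)
  refine ⟨X, hX.1, hX.2.1, hX.2.2, ?_⟩
  have h1 : κ⁻¹ • relaxMap A (1 + X) = X := hfix
  rw [← h1, smul_inv_smul₀ hκ.ne', h1]

end FixedPoint

end

end MaxwellBoltzmann

namespace MaxwellBoltzmann

noncomputable section

open Set Filter Topology
open scoped ENNReal Pointwise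

section Spectrum

open scoped Matrix Matrix.Norms.L2Operator

variable {d : ℕ} {g : ℝ → ℝ}

lemma eigLHS_eq (g : ℝ → ℝ) (A : Matrix (Fin d) (Fin d) ℝ) (β : ℂ)
    (B : Matrix (Fin d) (Fin d) ℂ) :
    eigLHS g A β B = (2 * β) • B + (B * A.map Complex.ofReal + (B * A.map Complex.ofReal)ᵀ) +
      (relax d g : ℂ) • (B - (B.trace / d) • 1) := by
  rw [eigLHS, relax]
  push_cast
  rfl

lemma eigLHS_add_param (A : Matrix (Fin d) (Fin d) ℝ) (β γ : ℂ) (B : Matrix (Fin d) (Fin d) ℂ) :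
    eigLHS g A (β + γ) B = eigLHS g A β B + (2 * γ) • B := by
  simp only [eigLHS]
  module

lemma eigLHS_smul (A : Matrix (Fin d) (Fin d) ℝ) (β t : ℂ) (B : Matrix (Fin d) (Fin d) ℂ) :
    eigLHS g A β (t • B) = t • eigLHS g A β B := by
  simp only [eigLHS, Matrix.smul_mul, Matrix.transpose_smul, Matrix.trace_smul, smul_eq_mul]
  module

lemma eigLHS_sub (A : Matrix (Fin d) (Fin d) ℝ) (β : ℂ) (B C : Matrix (Fin d) (Fin d) ℂ) :
    eigLHS g A β (B - C) = eigLHS g A β B - eigLHS g A β C := by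
  simp only [eigLHS, Matrix.sub_mul, Matrix.transpose_sub, Matrix.trace_sub]
  module

lemma isSymm_eigLHS (A : Matrix (Fin d) (Fin d) ℝ) (β : ℂ) {B : Matrix (Fin d) (Fin d) ℂ}
    (hB : B.IsSymm) : (eigLHS g A β B).IsSymm := by
  rw [Matrix.IsSymm, eigLHS]
  simp only [Matrix.transpose_add, Matrix.transpose_smul, Matrix.transpose_sub,
    Matrix.transpose_transpose, Matrix.transpose_one, hB.eq]
  rw [add_comm (B * A.map Complex.ofReal)ᵀ]

lemma trace_map_ofReal (N : Matrix (Fin d) (Fin d) ℝ) :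
    (N.map Complex.ofReal).trace = (N.trace : ℂ) := by
  simp [Matrix.trace]

/-- The operator induced by `eigLHS g A β` on symmetric matrices modulo an eigenvector with
large trace is a small perturbation of multiplication by `relax d g`. -/
lemma norm_relax_add_lt {A N : Matrix (Fin d) (Fin d) ℝ} {β a L : ℝ} (hβ : |β| ≤ a)
    (hAa : ‖A.map Complex.ofReal‖ ≤ a)
    (hN : 0 < N.trace) (hNL : ‖N.map Complex.ofReal‖ ≤ L * N.trace)
    (hA : (4 + 2 * d * L) * a < relax d g) {Y : Matrix (Fin d) (Fin d) ℂ}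
    (hY : Y.IsSymm) (hY0 : Y.trace = 0) (hne : Y ≠ 0) {w z : ℂ}
    (h : eigLHS g A β Y = z • N.map Complex.ofReal - w • Y) :
    ‖(relax d g : ℂ) + w‖ < relax d g := by
  have ha : 0 ≤ a := (norm_nonneg _).trans hAa
  set R := Y * A.map Complex.ofReal + (Y * A.map Complex.ofReal)ᵀ with hR
  have hRn : ‖R‖ ≤ 2 * a * ‖Y‖ := by
    have h1 : ‖(Y * A.map Complex.ofReal)ᵀ‖ ≤ a * ‖Y‖ := by
      have : (A.map Complex.ofReal)ᵀ = (A.map Complex.ofReal)ᴴ := by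
        ext i j; simp
      rw [Matrix.transpose_mul, hY.eq, this]
      refine (norm_mul_le _ _).trans ?_
      rw [Matrix.l2_opNorm_conjTranspose]
      exact mul_le_mul_of_nonneg_right hAa (norm_nonneg Y)
    have h2 := (norm_mul_le Y (A.map Complex.ofReal)).trans
      (mul_le_mul_of_nonneg_left hAa (norm_nonneg Y))
    refine (norm_add_le _ _).trans ?_
    linarith
  have hE : eigLHS g A β Y = (2 * (β : ℂ)) • Y + R + (relax d g : ℂ) • Y := by
    rw [eigLHS_eq, hY0]; simp [hR]
  have htr : R.trace = z * N.trace := by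
    have := congrArg Matrix.trace (hE.symm.trans h)
    simpa [Matrix.trace_add, Matrix.trace_sub, Matrix.trace_smul, hY0, trace_map_ofReal] using this
  have hz : ‖z‖ * N.trace ≤ d * (2 * a * ‖Y‖) := by
    calc ‖z‖ * N.trace = ‖R.trace‖ := by
          rw [htr, norm_mul, Complex.norm_real, Real.norm_of_nonneg hN.le]
      _ ≤ d * ‖R‖ := norm_trace_le R
      _ ≤ _ := mul_le_mul_of_nonneg_left hRn (Nat.cast_nonneg d)
  have hL : 0 ≤ L := by
    by_contra hL
    have := mul_neg_of_neg_of_pos (not_le.1 hL) hN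
    linarith [norm_nonneg (N.map Complex.ofReal)]
  have hkey : ((relax d g : ℂ) + w) • Y = z • N.map Complex.ofReal - R - (2 * (β : ℂ)) • Y := by
    have : z • N.map Complex.ofReal = (2 * (β : ℂ)) • Y + R + (relax d g : ℂ) • Y + w • Y := by
      rw [← hE, h]; abel
    rw [this]
    module
  have hYp : 0 < ‖Y‖ := norm_pos_iff.2 hne
  have hzN : ‖z • N.map Complex.ofReal‖ ≤ L * (d * (2 * a * ‖Y‖)) := by
    rw [norm_smul]
    calc _ ≤ ‖z‖ * (L * N.trace) := mul_le_mul_of_nonneg_left hNL (norm_nonneg z)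
      _ = L * (‖z‖ * N.trace) := by ring
      _ ≤ _ := mul_le_mul_of_nonneg_left hz hL
  have hβn : ‖(2 * (β : ℂ)) • Y‖ ≤ 2 * a * ‖Y‖ := by
    rw [norm_smul, norm_mul, Complex.norm_real, Complex.norm_ofNat]
    exact mul_le_mul_of_nonneg_right (mul_le_mul_of_nonneg_left hβ (by norm_num)) hYp.le
  have hle : ‖(relax d g : ℂ) + w‖ * ‖Y‖ ≤ ((4 + 2 * d * L) * a) * ‖Y‖ := by
    rw [← norm_smul, hkey]
    refine (norm_sub_le _ _).trans ((add_le_add_left (norm_sub_le _ _) _).trans ?_)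
    linarith
  exact (le_of_mul_le_mul_right hle hYp).trans_lt hA

/-- A real positive eigenvector spans a simple eigenspace, and its eigenvalue has the largest real
part, when `A` is small. -/
lemma isLeadingPair_of_eigenvector (hd : 2 ≤ d) (hg : IsCollisionKernel d g)
    {A N : Matrix (Fin d) (Fin d) ℝ} {β a L : ℝ} (hβ : |β| ≤ a)
    (hAa : ‖A.map Complex.ofReal‖ ≤ a) (hN : N.PosDef) (hn : (1 / (d : ℝ)) * (Nᵀ * N).trace = 1)
    (hNL : ‖N.map Complex.ofReal‖ ≤ L * N.trace)
    (hA : (4 + 2 * d * L) * a < relax d g)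
    (heig : eigLHS g A (β : ℂ) (N.map Complex.ofReal) = 0) : IsLeadingPair g A β N := by
  have : NeZero d := ⟨by omega⟩
  have hκ := relax_pos hd hg
  have htr : 0 < N.trace := hN.trace_pos
  have htr0 : (N.trace : ℂ) ≠ 0 := by exact_mod_cast htr.ne'
  have hsymm : N.IsSymm := by
    have := hN.isHermitian
    rwa [Matrix.IsHermitian, Matrix.conjTranspose_eq_transpose_of_trivial] at this
  have hsymm' : (N.map Complex.ofReal).IsSymm := hsymm.map _
  have hcore := @norm_relax_add_lt d g A N β a L hβ hAa htr hNL hA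
  have hY : ∀ B : Matrix (Fin d) (Fin d) ℂ, B.IsSymm →
      (B - (B.trace / N.trace) • N.map Complex.ofReal).IsSymm ∧
      (B - (B.trace / N.trace) • N.map Complex.ofReal).trace = 0 ∧
      eigLHS g A β (B - (B.trace / N.trace) • N.map Complex.ofReal) = eigLHS g A β B := by
    intro B hB
    refine ⟨hB.sub (hsymm'.smul _), ?_, ?_⟩
    · rw [Matrix.trace_sub, Matrix.trace_smul, trace_map_ofReal, smul_eq_mul,
        div_mul_cancel₀ _ htr0, sub_self]
    · rw [eigLHS_sub, eigLHS_smul, heig, smul_zero, sub_zero]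
  have hker : ∀ (B : Matrix (Fin d) (Fin d) ℂ) (z : ℂ), B.IsSymm →
      eigLHS g A β B = z • N.map Complex.ofReal → ∃ c : ℂ, B = c • N.map Complex.ofReal := by
    intro B z hB h
    obtain ⟨h1, h2, h3⟩ := hY B hB
    refine ⟨B.trace / N.trace, sub_eq_zero.1 ?_⟩
    by_contra hne
    have := hcore h1 h2 hne (w := 0) (z := z) (by rw [h3, h, zero_smul, sub_zero])
    rw [add_zero, Complex.norm_real, Real.norm_of_nonneg hκ.le] at this
    exact lt_irrefl _ this
  refine ⟨hsymm, hN, hn, heig, fun B hB h => ?_, ?_⟩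
  · obtain ⟨z, hz⟩ := hker _ 0 (isSymm_eigLHS A β hB) (by rw [h, zero_smul])
    exact hker B z hB hz
  · rintro β' ⟨B, hB0, hB, h⟩ hne
    obtain ⟨h1, h2, h3⟩ := hY B hB
    set t := B.trace / N.trace
    set γ := β' - β with hγ
    have hE : eigLHS g A β B = -((2 * γ) • B) := by
      have := eigLHS_add_param (g := g) A β γ B
      rw [hγ, add_sub_cancel, h] at this
      rw [eq_neg_iff_add_eq_zero, ← this]
    have hγ0 : γ ≠ 0 := sub_ne_zero.2 hne
    have hXne : B - t • N.map Complex.ofReal ≠ 0 := fun h0 => by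
      have h4 : B = t • N.map Complex.ofReal := sub_eq_zero.1 h0
      rw [h4, eigLHS_smul, heig, smul_zero, eq_comm, neg_eq_zero, ← h4] at hE
      rcases smul_eq_zero.1 hE with h5 | h5
      · simp [hγ0] at h5
      · exact hB0 h5
    have h5 := hcore h1 h2 hXne (w := 2 * γ) (z := -(2 * γ * t)) (by rw [h3, hE]; module)
    have h6 := (Complex.re_le_norm _).trans_lt h5
    simp [hγ] at h6
    linarith

lemma eigLHS_of_relax (hd : 2 ≤ d) {A X : Matrix (Fin d) (Fin d) ℝ} (hs : X.IsSymm)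
    (hX : X.trace = 0) (h : relax d g • X = relaxMap A (1 + X)) :
    eigLHS g A ((-((symMul A (1 + X)).trace / (2 * d)) : ℝ) : ℂ) ((1 + X).map Complex.ofReal) =
      0 := by
  have hd0 : (d : ℝ) ≠ 0 := by exact_mod_cast (by omega : d ≠ 0)
  set B := 1 + X with hB
  have hBs : Bᵀ = B := by rw [hB, Matrix.transpose_add, Matrix.transpose_one, hs.eq]
  have hBt : B.trace / d = 1 := by
    rw [hB, Matrix.trace_add, Matrix.trace_one, hX, Fintype.card_fin, add_zero, div_self hd0]
  have hreal : (2 * (-((symMul A B).trace / (2 * d)))) • B + (B * A + (B * A)ᵀ) +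
      relax d g • (B - (B.trace / d) • (1 : Matrix (Fin d) (Fin d) ℝ)) = 0 := by
    rw [hBt, one_smul, hB, add_sub_cancel_left, h, ← hB, Matrix.transpose_mul, hBs]
    change _ + symMul A B + _ = _
    rw [relaxMap]
    have : 2 * (-((symMul A B).trace / (2 * d))) = -((symMul A B).trace / d) := by
      field_simp
    rw [this]
    module
  ext i j
  have h1 := congrFun (congrFun hreal i) j
  rw [eigLHS_eq, trace_map_ofReal]
  simp only [Matrix.add_apply, Matrix.smul_apply, Matrix.sub_apply, Matrix.map_apply,
    Matrix.transpose_apply, Matrix.mul_apply, Matrix.one_apply, smul_eq_mul,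
    Matrix.zero_apply] at h1 ⊢
  have h2 : ((1 : ℂ)) = ((1 : ℝ) : ℂ) := by simp
  split_ifs at h1 ⊢ <;> exact_mod_cast congrArg Complex.ofReal h1

theorem exists_isLeadingPair (hd : 2 ≤ d) (hg : IsCollisionKernel d g) :
    ∃ ε : ℝ, 0 < ε ∧ ∀ A : Matrix (Fin d) (Fin d) ℝ, ‖op A‖ ≤ ε →
      ∃ (β : ℝ) (N : Matrix (Fin d) (Fin d) ℝ), IsLeadingPair g A β N := by
  have hκ := relax_pos hd hg
  have hd0 : (0 : ℝ) < d := by exact_mod_cast (by omega : 0 < d)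
  have : NeZero d := ⟨by omega⟩
  obtain ⟨K, hK, hKb⟩ := exists_norm_map_ofReal_le d
  refine ⟨min (relax d g / 32) (relax d g / (2 * ((4 + 3 * K) * (K + 1)))), by positivity,
    fun A hA => ?_⟩
  have hA1 : ‖A‖ ≤ relax d g / 32 := hA.trans (min_le_left _ _)
  have hA2 : ‖A‖ ≤ relax d g / (2 * ((4 + 3 * K) * (K + 1))) := hA.trans (min_le_right _ _)
  obtain ⟨X, hXs, hXt, hXn, hX⟩ := exists_relax_eigenvector hd hκ hA1
  have heig := eigLHS_of_relax hd hXs hXt hX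
  have hpos := posDef_one_add hXs (hXn.trans_lt (by norm_num))
  set B := 1 + X with hB
  set β := -((symMul A B).trace / (2 * d))
  have hBt : B.trace = d := by
    rw [hB, Matrix.trace_add, Matrix.trace_one, hXt, Fintype.card_fin, add_zero]
  have hBn : ‖B‖ ≤ 3 / 2 := by
    have : ‖(1 : Matrix (Fin d) (Fin d) ℝ)‖ ≤ 1 := by
      rw [Matrix.cstar_norm_def, map_one]
      exact ContinuousLinearMap.norm_id_le
    refine (norm_add_le _ _).trans (by linarith)
  have hBB : 0 < (Bᵀ * B).trace := by
    rw [← Matrix.conjTranspose_eq_transpose_of_trivial]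
    refine lt_of_le_of_ne (Matrix.posSemidef_conjTranspose_mul_self B).trace_nonneg
      fun h0 => ?_
    rw [eq_comm, Matrix.trace_conjTranspose_mul_self_eq_zero_iff] at h0
    rw [h0, Matrix.trace_zero] at hBt
    exact hd0.ne hBt
  have hβ : |β| ≤ ‖A‖ := abs_le_of_eigLHS hd hpos heig
  set s := (√((1 / (d : ℝ)) * (Bᵀ * B).trace))⁻¹ with hs
  have hs0 : 0 < s := by positivity
  have hsq : s * s * ((1 / (d : ℝ)) * (Bᵀ * B).trace) = 1 := by
    rw [hs, ← mul_inv, Real.mul_self_sqrt (by positivity), inv_mul_cancel₀ (by positivity)]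
  have hmap : (s • B).map Complex.ofReal = (s : ℂ) • B.map Complex.ofReal := by
    ext i j; simp
  refine ⟨β, s • B, isLeadingPair_of_eigenvector hd hg (a := (K + 1) * ‖A‖)
    (L := 3 * K / (2 * d)) ?_ ?_ (hpos.smul hs0) ?_ ?_ ?_ ?_⟩
  · nlinarith [norm_nonneg A]
  · exact (hKb A).trans (by nlinarith [norm_nonneg A])
  · refine Eq.trans ?_ hsq
    rw [Matrix.transpose_smul, Matrix.smul_mul, Matrix.mul_smul, Matrix.trace_smul,
      Matrix.trace_smul, smul_eq_mul, smul_eq_mul]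
    ring
  · rw [hmap, norm_smul, Complex.norm_real, Real.norm_of_nonneg hs0.le, Matrix.trace_smul, hBt,
      smul_eq_mul]
    have h1 := (hKb B).trans (mul_le_mul_of_nonneg_left hBn hK)
    refine (mul_le_mul_of_nonneg_left h1 hs0.le).trans_eq ?_
    field_simp
  · have e : (4 + 2 * d * (3 * K / (2 * d))) * ((K + 1) * ‖A‖) =
        ‖A‖ * ((4 + 3 * K) * (K + 1)) := by field_simp
    rw [le_div_iff₀ (by positivity)] at hA2
    rw [e]
    linarith
  · rw [hmap, eigLHS_smul, heig, smul_zero]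

end Spectrum

end

end MaxwellBoltzmann

theorem mainTheorem6 (d : ℕ) (hd : 2 ≤ d) (g : ℝ → ℝ)
    (hg : MaxwellBoltzmann.IsCollisionKernel d g) (M : ℕ) (hM : 3 ≤ M) :
    ∃ εM : ℝ, 0 < εM ∧ ∀ A : Matrix (Fin d) (Fin d) ℝ, ‖MaxwellBoltzmann.op A‖ ≤ εM →
      (∃ (β : ℝ) (N : Matrix (Fin d) (Fin d) ℝ), MaxwellBoltzmann.IsLeadingPair g A β N) ∧
      ∀ (β : ℝ) (N : Matrix (Fin d) (Fin d) ℝ), MaxwellBoltzmann.IsLeadingPair g A β N →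
        ∃ Q : ℕ → MvPolynomial (Fin d) ℂ,
          MaxwellBoltzmann.IsMomentFamily g A β N M Q ∧
          (∀ Q' : ℕ → MvPolynomial (Fin d) ℂ, MaxwellBoltzmann.IsMomentFamily g A β N M Q' →
            ∀ l ∈ Finset.Icc 2 M, Q' l = Q l) ∧
          ∀ p : ℝ, (M : ℝ) < p → p ≤ (M : ℝ) + 1 →
            (MaxwellBoltzmann.F p M Q).Nonempty ∧
            (∃! Ψ : MaxwellBoltzmann.E d → ℂ,
              Ψ ∈ MaxwellBoltzmann.F p M Q ∧ MaxwellBoltzmann.IsStationary g A β Ψ) ∧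
            (∀ μ : MeasureTheory.Measure (MaxwellBoltzmann.E d),
              MeasureTheory.IsProbabilityMeasure μ →
              MaxwellBoltzmann.charFn μ ∈ MaxwellBoltzmann.F p M Q →
              MaxwellBoltzmann.IsStationary g A β (MaxwellBoltzmann.charFn μ) →
              ∀ m : ℕ, m ≤ M → MeasureTheory.Integrable (fun v => ‖v‖ ^ m) μ) := by
  have hlam := MaxwellBoltzmann.lam_lt_one hd hg
  obtain ⟨ε, hε, h⟩ := MaxwellBoltzmann.exists_isLeadingPair hd hg
  have hδ : 0 < (1 - MaxwellBoltzmann.lam d g) / (4 * (M + 1)) := div_pos (by linarith) (by positivity)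
  refine ⟨min ε ((1 - MaxwellBoltzmann.lam d g) / (4 * (M + 1))), lt_min hε hδ, fun A hA =>
    ⟨h A (hA.trans (min_le_left _ _)), fun β N hN => ?_⟩⟩
  refine MaxwellBoltzmann.stationary_profile hd hg hM hN.posDef hN.eigenvector ?_
  have h1 := MaxwellBoltzmann.norm_op_shifted_le A β
  have h2 := MaxwellBoltzmann.abs_le_of_eigLHS hd hN.posDef hN.eigenvector
  have h3 := hA.trans (min_le_right _ _)
  rw [le_div_iff₀ (by positivity)] at h3
  have h4 : ((M : ℝ) + 1) * ‖MaxwellBoltzmann.op (MaxwellBoltzmann.shifted A β)‖ ≤ (M + 1) * (2 * ‖MaxwellBoltzmann.op A‖) :=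
    mul_le_mul_of_nonneg_left (by linarith) (by positivity)
  linarith
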